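/- **Notation.** Let $S(t)f=\Gamma(\cdot,t)*f$ be the heat semigroup on $\mathbb R^3$ ($\Gamma$ the heat kernel) and let $\mathbb P$ be the Leray projector, i.e. the Fourier multiplier with symbol $I-\xi\otimes\xi/|\xi|^2$. For $0<T\le\infty$ put $Q_T=\mathbb R^3\times]0,T[$. For matrix fields $F$ and vector fields $U,V$ on $Q_T$ put $$L(F)(\cdot,t)=\int_0^tS(t-s)\,\mathbb P\,\mathrm{div}\,F(\cdot,s)\,ds,\qquad B(U,V)=L(U\otimes V),$$ where $S(t)\mathbb P\,\mathrm{div}$ acts by convolution with the gradient of the Oseen kernel. The Picard iterates are $$P_0(u_0,F)(\cdot,t)=S(t)u_0+L(F)(\cdot,t),\qquad P_{k+1}=P_0-B(P_k,P_k)\ (k\ge0),\qquad P_{-1}=0,$$ with $P_k(u_0)=P_k(u_0,0)$, and $F_k=P_k\otimes P_k-P_{k-1}\otimes P_{k-1}$ for $k\ge0$. For $p\in[1,\infty]$ and $s\in\mathbb R$, the spaces $\mathcal K^s_p(Q_T)$ (vector fields) and $\mathcal F^s_p(Q_T)$ (matrix fields) consist of the locally integrable fields with finite norm $\operatorname{ess\,sup}_{0<t<T}t^{-s/2}\|u(\cdot,t)\|_{L^p(\mathbb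 R^3)}$; $\mathcal K_p=\mathcal K_p^{-1+3/p}$ and $\mathcal F_p=\mathcal F_p^{-2+3/p}$. The spaces $\mathcal X_T$ (vector fields) and $\mathcal Y_T$ (matrix fields) consist of the locally integrable fields with finite norm $$\|u\|_{\mathcal X_T}=\operatorname*{ess\,sup}_{0<t<T}t^{1/2}\|u(\cdot,t)\|_{L^\infty}+\sup_{x\in\mathbb R^3}\sup_{0<R<\sqrt T}R^{-3/2}\|u\|_{L^2(B(x,R)\times]0,R^2[)},$$ $$\|F\|_{\mathcal Y_T}=\operatorname*{ess\,sup}_{0<t<T}t\|F(\cdot,t)\|_{L^\infty}+\sup_{x\in\mathbb R^3}\sup_{0<R<\sqrt T}R^{-3}\|F\|_{L^1(B(x,R)\times]0,R^2[)}.$$ A tempered distribution $f$ belongs to $\mathrm{BMO}^{-1}(\mathbb R^3)$ if $Sf\in\mathcal X_\infty$, and $\mathcal F(Q_T)=\mathcal Y_T\cup\bigcup_{3<q<\infty}\mathcal F_q(Q_T)$. The homogeneous Besov space $\dot B^s_{p,\infty}(\mathbb R^3)$, $s<3/p$, consists of the tempered distributions $f$ with values in $\mathbb R^3$ such that $\|f\|_{\dot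 B^s_{p,\infty}}=\sup_{j\in\mathbb Z}2^{js}\|\varphi(2^{-j}D)f\|_{L^p}<\infty$ and $\sum_{j\in\mathbb Z}\varphi(2^{-j}D)f$ converges to $f$ as tempered distributions; here $\varphi\ge0$ is a fixed smooth radial function supported in $\{3/4\le|\xi|\le8/3\}$ with $\sum_{j\in\mathbb Z}\varphi(2^{-j}\xi)=1$ for $\xi\ne0$. **Lemma (finite energy forcing).** Let $p\in]3,\infty[$, let $M\ge0$, and let $k\ge\lceil p/2\rceil-2$ be an integer. (i) There is a constant $C=C(k,M,p)$ (depending also on the fixed $\varphi$) such that for every divergence-free $u_0\in\dot B^{-1+3/p}_{p,\infty}(\mathbb R^3)$ with $\|u_0\|_{\dot B^{-1+3/p}_{p,\infty}}\le M$ and every $T\in]0,\infty[$, the Picard iterates $P_k=P_k(u_0)$ satisfy $$F_k\in L^2(Q_T),\qquad P_{k+1}-P_k\in C([0,T];L^2(\mathbb R^3))\cap L^2_t\dot H^1_x(Q_T),$$ $$\|F_k\|_{\mathcal F_2(Q_T)}+\|P_{k+1}-P_k\|_{\mathcal K_2(Q_T)}\le C,$$ $$\|F_k\|_{L^2(Q_T)}+\|P_{k+1}-P_k\|_{L^\infty_tL^2_x(Q_T)}\le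 T^{1/4}\,C.$$ (ii) There is a constant $C=C(k,M,p)$ such that the same four assertions hold for the Picard iterates $P_k=P_k(u_0,F)$ whenever $T\in]0,\infty[$, $u_0\in\mathrm{BMO}^{-1}(\mathbb R^3)$ is a divergence-free distribution with values in $\mathbb R^3$, $F\in\mathcal F(Q_T)$, and $P_0(u_0,F)\in\mathcal K_p(Q_T)\cap\mathcal X_T$ with $$\|P_0(u_0,F)\|_{\mathcal K_p(Q_T)}+\|P_0(u_0,F)\|_{\mathcal X_T}\le M.$$ -/

import Mathlib

open MeasureTheory Set Filter Topology
open scoped ENNReal NNReal SchwartzMap ContDiff FourierTransform LineDeriv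

noncomputable section

namespace BesovNS

/-- `ℝ³` with the Euclidean norm. -/
abbrev E3 : Type := EuclideanSpace ℝ (Fin 3)

/-- `ℂ³` with the Hermitian norm, the target of Mathlib's tempered distributions. -/
abbrev C3 : Type := EuclideanSpace ℂ (Fin 3)

/-- Real `3 × 3` matrices with the Frobenius norm. -/
abbrev M33 : Type := EuclideanSpace ℝ (Fin 3 × Fin 3)

/-- The standard basis vectors of `ℝ³`. -/
def e (i : Fin 3) : E3 := EuclideanSpace.single i 1

/-! ### Tempered distributions and homogeneous Besov spaces -/

/-- The tempered distribution `f` takes values in `ℝ³`: it is real on real test functions. -/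
def IsRealDistribution (f : 𝓢'(E3, C3)) : Prop :=
  ∀ ψ : 𝓢(E3, ℂ), (∀ x, (ψ x).im = 0) → ∀ i, (f ψ i).im = 0

/-- `div f = ∑ᵢ ∂ᵢ fᵢ = 0` in the sense of tempered distributions. -/
def IsDivergenceFree (f : 𝓢'(E3, C3)) : Prop :=
  ∀ ψ : 𝓢(E3, ℂ), ∑ i, (∂_{e i} f) ψ i = 0

/-- A function generating a homogeneous dyadic partition of unity. -/
structure IsLittlewoodPaley (φ : E3 → ℝ) : Prop where
  smooth : ContDiff ℝ ∞ φ
  nonneg : ∀ ξ, 0 ≤ φ ξ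
  radial : ∀ ξ η, ‖ξ‖ = ‖η‖ → φ ξ = φ η
  support_subset : Function.support φ ⊆ {ξ | 3 / 4 ≤ ‖ξ‖ ∧ ‖ξ‖ ≤ 8 / 3}
  partition : ∀ ξ, ξ ≠ 0 → HasSum (fun j : ℤ => φ ((2 : ℝ) ^ (-j) • ξ)) 1

/-- The homogeneous Littlewood-Paley projector `φ(2⁻ʲ D)`. Mathlib's Fourier transform uses the
character `exp (-2πi x·ξ)`, so the frequency variable of `D` is `2π ξ`. -/
def lpBlock (φ : E3 → ℝ) (j : ℤ) (f : 𝓢'(E3, C3)) : 𝓢'(E3, C3) :=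
  TemperedDistribution.fourierMultiplierCLM C3
    (fun ξ : E3 => ((φ ((2 : ℝ) ^ (-j) • (2 * Real.pi) • ξ) : ℝ) : ℂ)) f

/-- The `L^p` norm of a tempered distribution; it is `∞` if `f` is not given by an `L^p` function
(the infimum is over the, a.e. unique, `L^p` functions that represent `f`). -/
def distLpNorm (p : ℝ≥0∞) (f : 𝓢'(E3, C3)) : ℝ≥0∞ :=
  ⨅ (g : E3 → C3) (_ : MemLp g p volume) (_ : ∀ ψ : 𝓢(E3, ℂ), f ψ = ∫ x, ψ x • g x),
    eLpNorm g p volume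

/-- The norm of the homogeneous Besov space `B^s_{p,∞}`. -/
def besovNorm (φ : E3 → ℝ) (s : ℝ) (p : ℝ≥0∞) (f : 𝓢'(E3, C3)) : ℝ≥0∞ :=
  ⨆ j : ℤ, ENNReal.ofReal ((2 : ℝ) ^ ((j : ℝ) * s)) * distLpNorm p (lpBlock φ j f)

/-- Membership in the homogeneous Besov space `B^s_{p,∞}` (of complex vector fields), `s < 3/p`:
finite norm, and the Littlewood-Paley series converges to `f` in the sense of tempered
distributions. -/
def MemBesov (φ : E3 → ℝ) (s : ℝ) (p : ℝ≥0∞) (f : 𝓢'(E3, C3)) : Prop :=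
  besovNorm φ s p f < ⊤ ∧
    Tendsto (fun N : ℕ × ℕ => ∑ j ∈ Finset.Icc (-(N.1 : ℤ)) (N.2 : ℤ), lpBlock φ j f) atTop (𝓝 f)

/-! ### The heat semigroup on tempered distributions -/

/-- The heat kernel `Γ(x,t)` in three dimensions. -/
def heatKernel (t : ℝ) (x : E3) : ℝ :=
  (4 * Real.pi * t) ^ (-(3 : ℝ) / 2) * Real.exp (-(‖x‖ ^ 2 / (4 * t)))

theorem gaussian_decay {a : ℝ} (ha : 0 < a) (k n : ℕ) :
    ∃ C : ℝ, ∀ x : E3,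
      ‖x‖ ^ k * ‖iteratedFDeriv ℝ n (fun x : E3 => Real.exp (-(a * ‖x‖ ^ 2))) x‖ ≤ C := by
  have hq : Function.HasTemperateGrowth (fun x : E3 => -(a * ‖x‖ ^ 2)) :=
    ((Function.HasTemperateGrowth.const a).mul
      (Function.hasTemperateGrowth_norm_sq (H := E3))).neg
  obtain ⟨l, K, hK, hb⟩ := hq.norm_iteratedFDeriv_le_uniform n
  set m := k + l * n with hm
  refine ⟨(n.factorial : ℝ) * (1 + K) ^ n * ((m.factorial : ℝ) / a ^ m * Real.exp (2 * a)), fun x => ?_⟩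
  set r := ‖x‖ with hr
  have hr0 : 0 ≤ r := norm_nonneg x
  have hD1 : 1 ≤ (1 + K) * (1 + r) ^ l := by
    have : 1 ≤ (1 + r) ^ l := one_le_pow₀ (by linarith)
    nlinarith
  have h1 : ‖iteratedFDeriv ℝ n (Real.exp ∘ fun x : E3 => -(a * ‖x‖ ^ 2)) x‖
      ≤ (n.factorial : ℝ) * Real.exp (-(a * r ^ 2)) * ((1 + K) * (1 + r) ^ l) ^ n := by
    refine norm_iteratedFDeriv_comp_le (N := ∞) Real.contDiff_exp hq.1 (by exact_mod_cast le_top)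
      x ?_ ?_
    · intro i _
      rw [norm_iteratedFDeriv_eq_norm_iteratedDeriv, iteratedDeriv_eq_iterate,
        Real.iter_deriv_exp, Real.norm_of_nonneg (Real.exp_pos _).le]
    · intro i hi hin
      have h2 : (0 : ℝ) ≤ (1 + r) ^ l := by positivity
      calc _ ≤ K * (1 + r) ^ l := hb i hin x
        _ ≤ (1 + K) * (1 + r) ^ l := by nlinarith
        _ ≤ _ := le_self_pow₀ hD1 (by omega)
  have h3 : (1 + r) ^ m * Real.exp (-(a * r ^ 2)) ≤ (m.factorial : ℝ) / a ^ m * Real.exp (2 * a) := by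
    have h4 := Real.pow_div_factorial_le_exp (x := a * (1 + r)) (by positivity) m
    have h5 : Real.exp (a * (1 + r)) * Real.exp (-(a * r ^ 2)) ≤ Real.exp (2 * a) := by
      rw [← Real.exp_add, Real.exp_le_exp]
      nlinarith [sq_nonneg (r - 1 / 2)]
    have h6 : (1 + r) ^ m = (m.factorial : ℝ) / a ^ m * ((a * (1 + r)) ^ m / (m.factorial : ℝ)) := by
      rw [mul_pow]; field_simp
    calc _ = (m.factorial : ℝ) / a ^ m * ((a * (1 + r)) ^ m / (m.factorial : ℝ) * Real.exp (-(a * r ^ 2))) := by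
          rw [h6]; ring
      _ ≤ (m.factorial : ℝ) / a ^ m * (Real.exp (a * (1 + r)) * Real.exp (-(a * r ^ 2))) := by gcongr
      _ ≤ _ := by gcongr
  calc _ ≤ (1 + r) ^ k * ((n.factorial : ℝ) * Real.exp (-(a * r ^ 2)) * ((1 + K) * (1 + r) ^ l) ^ n) := by
        gcongr
        · linarith
        · exact h1
    _ = (n.factorial : ℝ) * (1 + K) ^ n * ((1 + r) ^ m * Real.exp (-(a * r ^ 2))) := by
        rw [hm, pow_add, pow_mul, mul_pow]; ring
    _ ≤ _ := by gcongr

/-- The Gaussian `exp (-a |x|²)` as a Schwartz function. -/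
def gaussianSchwartz (a : ℝ) (ha : 0 < a) : 𝓢(E3, ℝ) where
  toFun x := Real.exp (-(a * ‖x‖ ^ 2))
  smooth' := by
    have h : ContDiff ℝ ∞ fun x : E3 => ‖x‖ ^ 2 := contDiff_norm_sq ℝ
    exact Real.contDiff_exp.comp (contDiff_const.mul h).neg
  decay' k n := gaussian_decay ha k n

/-- The test function `y ↦ Γ(x - y, t)`, for `t > 0`; see `heatTest_apply`. -/
def heatTest (t : ℝ) (ht : 0 < t) (x : E3) : 𝓢(E3, ℂ) :=
  (((4 * Real.pi * t) ^ (-(3 : ℝ) / 2) : ℝ) : ℂ) •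
    SchwartzMap.compSubConstCLM ℂ x
      (SchwartzMap.postcompCLM Complex.ofRealCLM (gaussianSchwartz (1 / (4 * t)) (by positivity)))

theorem heatTest_apply (t : ℝ) (ht : 0 < t) (x y : E3) :
    heatTest t ht x y = (heatKernel t (x - y) : ℂ) := by
  have h : (gaussianSchwartz (1 / (4 * t)) (by positivity)) (y - x)
      = Real.exp (-(‖x - y‖ ^ 2 / (4 * t))) := by
    change Real.exp (-(1 / (4 * t) * ‖y - x‖ ^ 2)) = _
    rw [norm_sub_rev, one_div_mul_eq_div]
  simp only [heatTest, heatKernel, _root_.smul_apply, SchwartzMap.compSubConstCLM_apply,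
    SchwartzMap.postcompCLM_apply, h, smul_eq_mul, Complex.ofRealCLM_apply, Complex.ofReal_mul]

/-- The heat evolution `S(t)f (x) = (Γ(·,t) ∗ f)(x) = ⟨f, Γ(x - ·, t)⟩`, `t > 0`, of a tempered
distribution with values in `ℝ³` (the imaginary part vanishes for such `f`). -/
def heatEvolution (f : 𝓢'(E3, C3)) (t : ℝ) (x : E3) : E3 :=
  if ht : 0 < t then WithLp.toLp 2 fun i => (f (heatTest t ht x) i).re else 0

/-! ### The Oseen kernel and the bilinear term -/

/-- The symbol of `S(1) ℙ`, that is `exp (-|ξ|²) (δᵢⱼ - ξᵢ ξⱼ / |ξ|²)`. -/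
def oseenSymbol (i j : Fin 3) (ξ : E3) : ℝ :=
  Real.exp (-‖ξ‖ ^ 2) * ((if i = j then 1 else 0) - ξ i * ξ j / ‖ξ‖ ^ 2)

/-- The Oseen kernel `G` at time `1`: the inverse Fourier transform of the symbol of `S(1) ℙ`. It
is real, the symbol being even. -/
def oseenKernel (i j : Fin 3) (x : E3) : ℝ :=
  (𝓕⁻ (fun ξ : E3 => ((oseenSymbol i j ((2 * Real.pi) • ξ) : ℝ) : ℂ)) x).re

/-- `S(t) ℙ div F`, for `t > 0` and a matrix field `F` on `ℝ³`, as a convolution. -/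
def heatLerayDiv (t : ℝ) (F : E3 → M33) (x : E3) : E3 :=
  WithLp.toLp 2 fun i => ∑ j, ∑ k, ∫ y : E3,
    (t ^ 2)⁻¹ * fderiv ℝ (oseenKernel i j) ((Real.sqrt t)⁻¹ • (x - y)) (e k) * F y (j, k)

/-- `L(F)(·,t) = ∫₀ᵗ S(t-s) ℙ div F(·,s) ds`. Time-dependent fields take time as first argument. -/
def duhamel (F : ℝ → E3 → M33) (t : ℝ) (x : E3) : E3 :=
  WithLp.toLp 2 fun i => ∫ s in (0 : ℝ)..t, heatLerayDiv (t - s) (F s) x i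

/-- The tensor product `U ⊗ V` of two time-dependent vector fields. -/
def tensor (U V : ℝ → E3 → E3) (t : ℝ) (x : E3) : M33 :=
  WithLp.toLp 2 fun ij => U t x ij.1 * V t x ij.2

/-- The bilinear term `B(U,V) = L(U ⊗ V)`. -/
def bilinearTerm (U V : ℝ → E3 → E3) : ℝ → E3 → E3 := duhamel (tensor U V)

/-- The zeroth Picard iterate `P_0(u₀,F)(·,t) = S(t)u₀ + L(F)(·,t)` with forcing `div F`. -/
def picardZero (u₀ : 𝓢'(E3, C3)) (F : ℝ → E3 → M33) : ℝ → E3 → E3 :=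
  heatEvolution u₀ + duhamel F

/-- The Picard iterates `P_k`, `k ≥ 0`, starting from `P_0`: `P_{k+1} = P_0 - B(P_k, P_k)`. -/
def picard (P₀ : ℝ → E3 → E3) : ℕ → ℝ → E3 → E3
  | 0 => P₀
  | k + 1 => P₀ - bilinearTerm (picard P₀ k) (picard P₀ k)

/-- `P_{k-1}`, with the convention `P_{-1} = 0`. -/
def picardPred (P₀ : ℝ → E3 → E3) : ℕ → ℝ → E3 → E3
  | 0 => 0
  | k + 1 => picard P₀ k

/-- The forcing term `F_k = P_k ⊗ P_k - P_{k-1} ⊗ P_{k-1}`. -/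
def picardForcing (P₀ : ℝ → E3 → E3) (k : ℕ) : ℝ → E3 → M33 :=
  tensor (picard P₀ k) (picard P₀ k) - tensor (picardPred P₀ k) (picardPred P₀ k)

/-! ### Function spaces on space-time -/

/-- The time interval `]0,T[`, `0 < T ≤ ∞`. -/
def timeInterval (T : ℝ≥0∞) : Set ℝ := {t | 0 < t ∧ ENNReal.ofReal t < T}

/-- The parabolic cylinder `Q_T`, with time as first coordinate. -/
def Q (T : ℝ≥0∞) : Set (ℝ × E3) := timeInterval T ×ˢ univ

section Spaces

variable {V : Type*} [NormedAddCommGroup V]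

/-- `ess sup_{t ∈ ]0,T[} t^{-s/2} ‖u(·,t)‖_{L^p}`, the norm of the Kato space `𝒦^s_p(Q_T)` for
vector fields and of `ℱ^s_p(Q_T)` for matrix fields. -/
def katoNorm (s : ℝ) (p : ℝ≥0∞) (T : ℝ≥0∞) (u : ℝ → E3 → V) : ℝ≥0∞ :=
  essSup (fun t => ENNReal.ofReal (t ^ (-s / 2)) * eLpNorm (u t) p volume)
    (volume.restrict (timeInterval T))

/-- Membership in `𝒦^s_p(Q_T)` (vector fields) or `ℱ^s_p(Q_T)` (matrix fields). -/
def MemKato (s : ℝ) (p : ℝ≥0∞) (T : ℝ≥0∞) (u : ℝ → E3 → V) : Prop :=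
  LocallyIntegrableOn (Function.uncurry u) (Q T) ∧ katoNorm s p T u < ⊤

/-- The norm of `𝒳_T`. -/
def xNorm (T : ℝ≥0∞) (u : ℝ → E3 → V) : ℝ≥0∞ :=
  essSup (fun t => ENNReal.ofReal (t ^ (1 / 2 : ℝ)) * eLpNorm (u t) ⊤ volume)
      (volume.restrict (timeInterval T)) +
    ⨆ (x : E3) (R : ℝ) (_ : 0 < R) (_ : ENNReal.ofReal (R ^ 2) < T),
      ENNReal.ofReal (R ^ (-(3 : ℝ) / 2)) *
        eLpNorm (Function.uncurry u) 2 (volume.restrict (Ioo 0 (R ^ 2) ×ˢ Metric.ball x R))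

/-- Membership in `𝒳_T`. -/
def MemX (T : ℝ≥0∞) (u : ℝ → E3 → V) : Prop :=
  LocallyIntegrableOn (Function.uncurry u) (Q T) ∧ xNorm T u < ⊤

/-- The norm of `𝒴_T`. -/
def yNorm (T : ℝ≥0∞) (F : ℝ → E3 → V) : ℝ≥0∞ :=
  essSup (fun t => ENNReal.ofReal t * eLpNorm (F t) ⊤ volume)
      (volume.restrict (timeInterval T)) +
    ⨆ (x : E3) (R : ℝ) (_ : 0 < R) (_ : ENNReal.ofReal (R ^ 2) < T),
      ENNReal.ofReal (R ^ (-(3 : ℝ))) *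
        eLpNorm (Function.uncurry F) 1 (volume.restrict (Ioo 0 (R ^ 2) ×ˢ Metric.ball x R))

/-- Membership in `𝒴_T`. -/
def MemY (T : ℝ≥0∞) (F : ℝ → E3 → V) : Prop :=
  LocallyIntegrableOn (Function.uncurry F) (Q T) ∧ yNorm T F < ⊤

end Spaces

/-- The critical exponent `s_p = -1 + 3/p`: `𝒦_p = 𝒦^{s_p}_p`. -/
def sK (p : ℝ) : ℝ := -1 + 3 / p

/-- The critical exponent `s'_p = -2 + 3/p`: `ℱ_p = ℱ^{s'_p}_p`. -/
def sF (p : ℝ) : ℝ := -2 + 3 / p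

/-- The admissible forcing terms `ℱ(Q_T) = 𝒴_T ∪ ⋃_{3 < q < ∞} ℱ_q(Q_T)`. -/
def MemForcing (T : ℝ≥0∞) (F : ℝ → E3 → M33) : Prop :=
  MemY T F ∨ ∃ q : ℝ, 3 < q ∧ MemKato (sF q) (ENNReal.ofReal q) T F

/-- Membership in `BMO⁻¹`, by the Carleson measure characterization. -/
def MemBMOInv (f : 𝓢'(E3, C3)) : Prop := MemX ⊤ (heatEvolution f)

/-- `w ∈ C([0,T]; L²(ℝ³))`. -/
def ContinuousInL2 (T : ℝ) (w : ℝ → E3 → E3) : Prop :=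
  ∃ v : ℝ → Lp E3 2 (volume : Measure E3),
    ContinuousOn v (Icc 0 T) ∧ ∀ t ∈ Icc 0 T, w t =ᵐ[volume] v t

/-- `w ∈ L²_t Ḣ¹_x(Q_T)`: the weak spatial gradient of `w` on `Q_T`, with entries
`g (i, j) = ∂ⱼ wᵢ`, is square integrable. -/
def HasL2Gradient (T : ℝ≥0∞) (w : ℝ → E3 → E3) : Prop :=
  LocallyIntegrableOn (Function.uncurry w) (Q T) ∧
  ∃ g : ℝ × E3 → M33, MemLp g 2 (volume.restrict (Q T)) ∧
    ∀ (i j : Fin 3) (ψ : ℝ × E3 → ℝ), ContDiff ℝ ∞ ψ → HasCompactSupport ψ → tsupport ψ ⊆ Q T →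
      ∫ z in Q T, w z.1 z.2 i * fderiv ℝ ψ z (0, e j) = -∫ z in Q T, g z (i, j) * ψ z

/-- The assertions about the forcing term `F_k` and the increment `P_{k+1} - P_k` on `Q_T`, for
the Picard iterates starting from `P₀`, with constant `C`. -/
structure FiniteEnergyForcing (P₀ : ℝ → E3 → E3) (k : ℕ) (T : ℝ) (C : ℝ≥0) : Prop where
  /-- `F_k ∈ L²(Q_T)`. -/
  forcing_memLp : MemLp (Function.uncurry (picardForcing P₀ k)) 2
    (volume.restrict (Q (ENNReal.ofReal T)))
  /-- `P_{k+1} - P_k ∈ C([0,T]; L²)`. -/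
  continuous_diff : ContinuousInL2 T (picard P₀ (k + 1) - picard P₀ k)
  /-- `P_{k+1} - P_k ∈ L²_t Ḣ¹_x(Q_T)`. -/
  gradient_diff : HasL2Gradient (ENNReal.ofReal T) (picard P₀ (k + 1) - picard P₀ k)
  /-- `F_k ∈ ℱ_2(Q_T)`. -/
  forcing_memKato : MemKato (sF 2) 2 (ENNReal.ofReal T) (picardForcing P₀ k)
  /-- `P_{k+1} - P_k ∈ 𝒦_2(Q_T)`. -/
  diff_memKato : MemKato (sK 2) 2 (ENNReal.ofReal T) (picard P₀ (k + 1) - picard P₀ k)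
  /-- `‖F_k‖_{ℱ_2(Q_T)} + ‖P_{k+1} - P_k‖_{𝒦_2(Q_T)} ≤ C`. -/
  kato_bound : katoNorm (sF 2) 2 (ENNReal.ofReal T) (picardForcing P₀ k)
    + katoNorm (sK 2) 2 (ENNReal.ofReal T) (picard P₀ (k + 1) - picard P₀ k) ≤ C
  /-- `‖F_k‖_{L²(Q_T)} + ‖P_{k+1} - P_k‖_{L^∞_t L²_x(Q_T)} ≤ T^{1/4} C`; the second norm is that
  of `𝒦^0_2(Q_T)`. -/
  energy_bound : eLpNorm (Function.uncurry (picardForcing P₀ k)) 2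
      (volume.restrict (Q (ENNReal.ofReal T)))
    + katoNorm 0 2 (ENNReal.ofReal T) (picard P₀ (k + 1) - picard P₀ k)
    ≤ ENNReal.ofReal (T ^ (1 / 4 : ℝ)) * C

end BesovNS

end

/-! The proof runs on scale-invariant bounds: `KBound` says ‖u(t)‖_{L^q} ≤ M t^{-(1/2 - 3/(2q))} and
`FBound` says ‖F(t)‖_{L^q} ≤ M t^{-(1 - 3/(2q))}, both indexed by a = 1/q so that Hölder's
inequality adds indices. The kernel of S(τ)ℙ div has L¹ norm O(τ^{-1/2}) and supremum O(τ^{-2}).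
Young's inequality in space and a Beta integral in time then show that L sends index b in the ℱ
scale to index b' in the 𝒦 scale if 0 < b' ≤ b ≤ 2/3 and b - b' < 1/3, with a constant independent
of T (`exists_lnorm_potential_le_of_FBound`).

In both parts P₀ lies in 𝒦_r with r = max(p,4). For Besov data this comes from summing the heat
evolution of the Littlewood-Paley blocks (`exists_KBound_heatEvolution`); in the forced case it is
interpolation between L^p and L^∞ (`KBound_of_katoNorm_of_xNorm`).

The heart of the matter is a gain of integrability (`exists_picard_bounds`). One has P_{k+1} - P_k =
-L(F_k) and F_k = (P_k - P_{k-1}) ⊗ P_k + P_{k-1} ⊗ (P_k - P_{k-1}), so every iteration raises the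
index of the increment by 1/r, up to the cap 1/2 - 1/r. The condition on k says that the cap has
been reached. Then F_k has index exactly 1/2, that is ‖F_k(t)‖_{L²} ≤ N t^{-1/4}, and both energy
norms follow with the factor T^{1/4}.

For such a forcing, L(F) is 1/4-Hölder continuous in time with values in L², by a time modulus of
continuity of the kernel (`exists_lnorm_duhamel_sub_le`). Its gradient is square integrable by
maximal regularity, obtained by duality: the adjoint of L applied to a spatial derivative of a test
function is estimated by Plancherel's theorem and Schur's test at each frequency
(`lintegral_adjointDuhamel_sq_le`), and Riesz representation produces the weak gradient
(`exists_weak_derivative`). -/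

namespace BesovNS

/-! ### Integral inequalities for nonnegative functions -/

section Lintegral

variable {α β : Type*} [MeasurableSpace α] [MeasurableSpace β]

/-- Jensen's inequality for the convex function `x ↦ x ^ q` and the weight `k`. -/
theorem lintegral_mul_rpow_le_weight {μ : Measure α} {k f : α → ℝ≥0∞} {q : ℝ} (hq : 1 ≤ q)
    (hk : AEMeasurable k μ) (hf : AEMeasurable f μ) :
    (∫⁻ x, k x * f x ∂μ) ^ q ≤ (∫⁻ x, k x ∂μ) ^ (q - 1) * ∫⁻ x, k x * f x ^ q ∂μ := by
  have hq0 : 0 < q := by linarith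
  have hq1 : 0 ≤ 1 - 1 / q := by
    rw [sub_nonneg, div_le_one hq0]; exact hq
  have h := ENNReal.lintegral_mul_norm_pow_le (μ := μ) (f := k) (g := fun x => k x * f x ^ q)
    (p := 1 - 1 / q) (q := 1 / q) hk (hk.mul (hf.pow_const q)) hq1 (by positivity) (by ring)
  have h' : ∀ x, k x ^ (1 - 1 / q) * (k x * f x ^ q) ^ (1 / q) = k x * f x := fun x => by
    rw [ENNReal.mul_rpow_of_nonneg _ _ (by positivity), ← mul_assoc,
      ← ENNReal.rpow_add_of_nonneg _ _ hq1 (by positivity), ← ENNReal.rpow_mul]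
    simp [hq0.ne']
  simp only [h'] at h
  calc _ ≤ ((∫⁻ x, k x ∂μ) ^ (1 - 1 / q) * (∫⁻ x, k x * f x ^ q ∂μ) ^ (1 / q)) ^ q := by gcongr
    _ = _ := by
      rw [ENNReal.mul_rpow_of_nonneg _ _ hq0.le, ← ENNReal.rpow_mul, ← ENNReal.rpow_mul]
      congr 2
      · field_simp
      · rw [one_div_mul_cancel hq0.ne', ENNReal.rpow_one]

/-- Minkowski's integral inequality, for a family of functions whose `L^p` norms are controlled by
a positive finite function. -/
theorem lintegral_lintegral_rpow_le {μ : Measure α} {ν : Measure β} [SFinite μ] [SFinite ν]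
    {f : α → β → ℝ≥0∞} (hf : Measurable (Function.uncurry f)) {a : α → ℝ≥0∞} (ha : Measurable a)
    {p : ℝ} (hp : 1 ≤ p) (ha0 : ∀ᵐ s ∂μ, a s ≠ 0) (ha1 : ∀ᵐ s ∂μ, a s ≠ ⊤)
    (h : ∀ᵐ s ∂μ, ∫⁻ x, f s x ^ p ∂ν ≤ a s ^ p) :
    ∫⁻ x, (∫⁻ s, f s x ∂μ) ^ p ∂ν ≤ (∫⁻ s, a s ∂μ) ^ p := by
  have hp0 : 0 < p := by linarith
  have hm : Measurable (Function.uncurry fun s x => a s * (f s x / a s) ^ p) :=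
    (ha.comp measurable_fst).mul ((hf.div (ha.comp measurable_fst)).pow_const p)
  -- Dividing by `a` turns the inner integral into an average with weight `a`, and Jensen's
  -- inequality takes the place of a duality argument. This division is why `a` has to be positive
  -- and finite almost everywhere.
  calc ∫⁻ x, (∫⁻ s, f s x ∂μ) ^ p ∂ν
      = ∫⁻ x, (∫⁻ s, a s * (f s x / a s) ∂μ) ^ p ∂ν := by
        refine lintegral_congr fun x => ?_
        congr 1
        refine lintegral_congr_ae ?_
        filter_upwards [ha0, ha1] with s h0 h1
        rw [ENNReal.mul_div_cancel h0 h1]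
    _ ≤ ∫⁻ x, (∫⁻ s, a s ∂μ) ^ (p - 1) * ∫⁻ s, a s * (f s x / a s) ^ p ∂μ ∂ν := by
        refine lintegral_mono fun x => lintegral_mul_rpow_le_weight hp ha.aemeasurable ?_
        exact ((hf.comp measurable_prodMk_right).div ha).aemeasurable
    _ = (∫⁻ s, a s ∂μ) ^ (p - 1) * ∫⁻ s, ∫⁻ x, a s * (f s x / a s) ^ p ∂ν ∂μ := by
        rw [lintegral_const_mul _ hm.lintegral_prod_left, lintegral_lintegral_swap]
        exact (hm.comp measurable_swap).aemeasurable
    _ ≤ (∫⁻ s, a s ∂μ) ^ (p - 1) * ∫⁻ s, a s ∂μ := by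
        gcongr 1
        refine lintegral_mono_ae ?_
        filter_upwards [ha0, ha1, h] with s h0 h1 h2
        have h3 : ∀ x, a s * (f s x / a s) ^ p = (a s * (a s ^ p)⁻¹) * f s x ^ p := fun x => by
          rw [ENNReal.div_rpow_of_nonneg _ _ hp0.le, ENNReal.div_eq_inv_mul, mul_assoc]
        simp only [h3]
        rw [lintegral_const_mul _ (hf.of_uncurry_left.pow_const p)]
        calc _ ≤ (a s * (a s ^ p)⁻¹) * a s ^ p := by gcongr
          _ = a s := by
            rw [mul_assoc, ENNReal.inv_mul_cancel, mul_one]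
            · simp [h0, hp0, hp0.le]
            · simp [h1, hp0.le]
    _ = _ := by
        nth_rw 2 [← ENNReal.rpow_one (∫⁻ s, a s ∂μ)]
        rw [← ENNReal.rpow_add_of_nonneg _ _ (by linarith) (by linarith)]
        simp

/-- Schur's test, in the form that is needed for convolutions. -/
theorem lintegral_rpow_lintegral_mul_le {μ : Measure α} {ν : Measure β} [SFinite μ] [SFinite ν]
    {k : β → α → ℝ≥0∞} (hk : Measurable (Function.uncurry k)) {f : α → ℝ≥0∞} (hf : Measurable f)
    {A : ℝ≥0∞} {q : ℝ} (hq : 1 ≤ q) (h1 : ∀ x, ∫⁻ y, k x y ∂μ ≤ A)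
    (h2 : ∀ y, ∫⁻ x, k x y ∂ν ≤ A) :
    ∫⁻ x, (∫⁻ y, k x y * f y ∂μ) ^ q ∂ν ≤ A ^ q * ∫⁻ y, f y ^ q ∂μ := by
  have hm : Measurable (Function.uncurry fun x y => k x y * f y ^ q) :=
    hk.mul ((hf.comp measurable_snd).pow_const q)
  calc _ ≤ ∫⁻ x, A ^ (q - 1) * ∫⁻ y, k x y * f y ^ q ∂μ ∂ν := by
        refine lintegral_mono fun x => (lintegral_mul_rpow_le_weight hq
          hk.of_uncurry_left.aemeasurable hf.aemeasurable).trans ?_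
        gcongr 1
        exact ENNReal.rpow_le_rpow (h1 x) (by linarith)
    _ = A ^ (q - 1) * ∫⁻ y, ∫⁻ x, k x y * f y ^ q ∂ν ∂μ := by
        rw [lintegral_const_mul _ hm.lintegral_prod_right, lintegral_lintegral_swap]
        exact hm.aemeasurable
    _ ≤ A ^ (q - 1) * ∫⁻ y, A * f y ^ q ∂μ := by
        gcongr with y
        rw [lintegral_mul_const _ hk.of_uncurry_right]
        gcongr
        exact h2 y
    _ = _ := by
        rw [lintegral_const_mul _ (hf.pow_const q), ← mul_assoc]
        congr 1
        nth_rw 2 [← ENNReal.rpow_one A]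
        rw [← ENNReal.rpow_add_of_nonneg _ _ (by linarith) (by linarith)]
        simp

end Lintegral

/-! ### Convolution and Young's inequality on ℝ³. -/

/-- Convolution of nonnegative functions on `ℝ³`. -/
noncomputable def lconv (k f : E3 → ℝ≥0∞) (x : E3) : ℝ≥0∞ := ∫⁻ y, k (x - y) * f y

theorem measurable_lconv {k f : E3 → ℝ≥0∞} (hk : Measurable k) (hf : Measurable f) :
    Measurable (lconv k f) := by
  have : Measurable (Function.uncurry fun x y : E3 => k (x - y) * f y) :=
    (hk.comp (measurable_fst.sub measurable_snd)).mul (hf.comp measurable_snd)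
  exact this.lintegral_prod_right

/-- The norm of `L^q`, `q < ∞`, for nonnegative functions. -/
noncomputable def lnorm (q : ℝ) (f : E3 → ℝ≥0∞) : ℝ≥0∞ := (∫⁻ x, f x ^ q) ^ (1 / q)

theorem lnorm_mono {q : ℝ} (hq : 0 < q) {f g : E3 → ℝ≥0∞} (h : ∀ᵐ x, f x ≤ g x) :
    lnorm q f ≤ lnorm q g := by
  unfold lnorm
  gcongr 1
  refine lintegral_mono_ae ?_
  filter_upwards [h] with x hx
  gcongr

theorem lnorm_rpow {q : ℝ} (hq : 0 < q) (f : E3 → ℝ≥0∞) : lnorm q f ^ q = ∫⁻ x, f x ^ q := by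
  rw [lnorm, ← ENNReal.rpow_mul, one_div_mul_cancel hq.ne', ENNReal.rpow_one]

theorem lnorm_add_le {q : ℝ} (hq : 1 ≤ q) {f g : E3 → ℝ≥0∞} (hf : Measurable f)
    (hg : Measurable g) : lnorm q (f + g) ≤ lnorm q f + lnorm q g :=
  ENNReal.lintegral_Lp_add_le hf.aemeasurable hg.aemeasurable hq

theorem eLpNorm_eq_lnorm {V : Type*} [NormedAddCommGroup V] {q : ℝ} (hq : 0 < q) (f : E3 → V) :
    eLpNorm f (ENNReal.ofReal q) volume = lnorm q (fun x => ‖f x‖ₑ) := by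
  rw [eLpNorm_eq_lintegral_rpow_enorm_toReal (by simpa using hq) ENNReal.ofReal_ne_top,
    ENNReal.toReal_ofReal hq.le, lnorm]

/-- The endpoint L^q → L^∞: Jensen's inequality with weight `k (x - ·)`, after which the remaining
kernel is bounded by its supremum. -/
theorem lconv_rpow_le {k f : E3 → ℝ≥0∞} (hk : Measurable k) (hf : Measurable f)
    {A B : ℝ≥0∞} (hA : ∫⁻ x, k x ≤ A) (hB : ∀ x, k x ≤ B) {q : ℝ} (hq : 1 ≤ q) (x : E3) :
    lconv k f x ^ q ≤ A ^ (q - 1) * (B * ∫⁻ y, f y ^ q) := by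
  have hk' : Measurable fun y => k (x - y) := hk.comp (measurable_const.sub measurable_id)
  refine (lintegral_mul_rpow_le_weight hq hk'.aemeasurable hf.aemeasurable).trans ?_
  rw [← lintegral_const_mul _ (hf.pow_const q)]
  have : ∫⁻ y, k (x - y) ≤ A := by rwa [lintegral_sub_left_eq_self k x]
  gcongr with y
  exact hB _

/-- The endpoint L^q → L^q: Schur's test, both marginals of `k (x - y)` being the integral of `k`.
-/
theorem lintegral_lconv_rpow_le {k f : E3 → ℝ≥0∞} (hk : Measurable k) (hf : Measurable f)
    {A : ℝ≥0∞} (hA : ∫⁻ x, k x ≤ A) {q : ℝ} (hq : 1 ≤ q) :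
    ∫⁻ x, lconv k f x ^ q ≤ A ^ q * ∫⁻ y, f y ^ q := by
  refine lintegral_rpow_lintegral_mul_le (k := fun x y => k (x - y))
    (hk.comp (measurable_fst.sub measurable_snd)) hf hq (fun x => ?_) fun y => ?_
  · rwa [lintegral_sub_left_eq_self k x]
  · rwa [lintegral_sub_right_eq_self k y]

/-- Young's inequality for a bounded integrable kernel. -/
theorem lnorm_lconv_le {k f : E3 → ℝ≥0∞} (hk : Measurable k) (hf : Measurable f)
    {A B : ℝ≥0∞} (hA : ∫⁻ x, k x ≤ A) (hB : ∀ x, k x ≤ B) {q r : ℝ} (hq : 1 ≤ q) (hqr : q ≤ r) :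
    lnorm r (lconv k f) ≤ A ^ (1 - (1 / q - 1 / r)) * B ^ (1 / q - 1 / r) * lnorm q f := by
  have hq0 : 0 < q := by linarith
  have hr0 : 0 < r := by linarith
  have hd : 0 ≤ 1 / q - 1 / r := sub_nonneg.2 (one_div_le_one_div_of_le hq0 hqr)
  set N := ∫⁻ y, f y ^ q with hN
  -- Interpolation by hand: r - q powers of the convolution are estimated in supremum and the other
  -- q powers in L^q.
  have h1 : ∫⁻ x, lconv k f x ^ r ≤
      ((A ^ (q - 1) * (B * N)) ^ (1 / q)) ^ (r - q) * (A ^ q * N) := by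
    calc _ ≤ ∫⁻ x, ((A ^ (q - 1) * (B * N)) ^ (1 / q)) ^ (r - q) * lconv k f x ^ q := by
          refine lintegral_mono fun x => ?_
          have h2 : lconv k f x ≤ (A ^ (q - 1) * (B * N)) ^ (1 / q) := by
            rw [one_div]
            exact (ENNReal.le_rpow_inv_iff hq0).2 (lconv_rpow_le hk hf hA hB hq x)
          calc lconv k f x ^ r = lconv k f x ^ (r - q) * lconv k f x ^ q := by
                rw [← ENNReal.rpow_add_of_nonneg _ _ (by linarith) hq0.le, sub_add_cancel]
            _ ≤ _ := by
                gcongr 1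
                exact ENNReal.rpow_le_rpow h2 (by linarith)
      _ = ((A ^ (q - 1) * (B * N)) ^ (1 / q)) ^ (r - q) * ∫⁻ x, lconv k f x ^ q :=
          lintegral_const_mul _ ((measurable_lconv hk hf).pow_const q)
      _ ≤ _ := by
          gcongr 1
          exact lintegral_lconv_rpow_le hk hf hA hq
  calc lnorm r (lconv k f)
      ≤ (((A ^ (q - 1) * (B * N)) ^ (1 / q)) ^ (r - q) * (A ^ q * N)) ^ (1 / r) := by
        unfold lnorm; gcongr
    _ = (A ^ ((q - 1) * (1 / q - 1 / r)) * (B ^ (1 / q - 1 / r) * N ^ (1 / q - 1 / r))) *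
          (A ^ (q * (1 / r)) * N ^ (1 / r)) := by
        rw [← ENNReal.rpow_mul, ENNReal.mul_rpow_of_nonneg _ _ (by positivity), ← ENNReal.rpow_mul,
          ENNReal.mul_rpow_of_nonneg (A ^ q) _ (by positivity), ← ENNReal.rpow_mul A q]
        have : 1 / q * (r - q) * (1 / r) = 1 / q - 1 / r := by field_simp
        rw [this, ENNReal.mul_rpow_of_nonneg _ _ hd, ENNReal.mul_rpow_of_nonneg _ _ hd,
          ← ENNReal.rpow_mul]
    _ = (A ^ ((q - 1) * (1 / q - 1 / r)) * A ^ (q * (1 / r))) * B ^ (1 / q - 1 / r) *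
          (N ^ (1 / q - 1 / r) * N ^ (1 / r)) := by ring
    _ = _ := by
        rw [← ENNReal.rpow_add_of_nonneg _ _ (mul_nonneg (by linarith) hd) (by positivity),
          ← ENNReal.rpow_add_of_nonneg _ _ hd (by positivity), lnorm, sub_add_cancel]
        congr 3
        field_simp
        ring

/-! ### Time integrals and parabolic kernels -/

theorem lintegral_rpow_neg_Ioo {α t : ℝ} (hα : α < 1) (ht : 0 < t) :
    ∫⁻ s in Ioo 0 t, ENNReal.ofReal (s ^ (-α)) = ENNReal.ofReal (t ^ (1 - α) / (1 - α)) := by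
  have hi : IntegrableOn (fun s : ℝ => s ^ (-α)) (Ioo 0 t) := by
    rw [← integrableOn_Ioc_iff_integrableOn_Ioo, ← intervalIntegrable_iff_integrableOn_Ioc_of_le ht.le]
    exact intervalIntegral.intervalIntegrable_rpow' (by linarith)
  rw [← ofReal_integral_eq_lintegral_ofReal hi]
  · congr 1
    rw [← integral_Ioc_eq_integral_Ioo, ← intervalIntegral.integral_of_le ht.le,
      integral_rpow (Or.inl (by linarith)), Real.zero_rpow (by linarith)]
    rw [sub_zero, show -α + 1 = 1 - α by ring]
  · filter_upwards [ae_restrict_mem measurableSet_Ioo] with s hs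
    exact Real.rpow_nonneg hs.1.le _

theorem lintegral_sub_rpow_neg_Ioo {α t u : ℝ} (hα : α < 1) (hut : u < t) :
    ∫⁻ s in Ioo u t, ENNReal.ofReal ((t - s) ^ (-α)) =
      ENNReal.ofReal ((t - u) ^ (1 - α) / (1 - α)) := by
  rw [← lintegral_rpow_neg_Ioo hα (sub_pos.2 hut)]
  have h := (Measure.measurePreserving_sub_left (volume : Measure ℝ) t).setLIntegral_comp_preimage
    (measurableSet_Ioo (a := 0) (b := t - u)) (f := fun s => ENNReal.ofReal (s ^ (-α)))
    (by fun_prop)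
  rw [← h]
  congr 2
  ext s
  simp only [mem_Ioo, mem_preimage]
  constructor <;> rintro ⟨h1, h2⟩ <;> constructor <;> linarith

/-- The Beta integral, up to a constant. -/
theorem exists_lintegral_sub_rpow_mul_rpow_le {α β : ℝ} (hα0 : 0 ≤ α) (hα : α < 1) (hβ0 : 0 ≤ β)
    (hβ : β < 1) : ∃ C : ℝ≥0, 0 < C ∧ ∀ t : ℝ, 0 < t →
      ∫⁻ s in Ioo 0 t, ENNReal.ofReal ((t - s) ^ (-β) * s ^ (-α)) ≤
        C * ENNReal.ofReal (t ^ (1 - α - β)) := by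
  have hα' : 0 < 1 - α := by linarith
  have hβ' : 0 < 1 - β := by linarith
  refine ⟨Real.toNNReal (2 ^ β / (1 - α) + 2 ^ α / (1 - β)), ?_, fun t ht => ?_⟩
  · rw [Real.toNNReal_pos]; positivity
  -- On each half of the interval one of the two factors is at most its value at t/2. The sum of the
  -- two resulting bounds is valid on all of ]0,t[, so the integral need not be split.
  have hp : ∀ s ∈ Ioo 0 t, (t - s) ^ (-β) * s ^ (-α) ≤
      (t / 2) ^ (-β) * s ^ (-α) + (t / 2) ^ (-α) * (t - s) ^ (-β) := fun s hs => by
    have h1 : 0 < s := hs.1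
    have h2 : 0 < t - s := sub_pos.2 hs.2
    rcases le_total s (t / 2) with h | h
    · have : (t - s) ^ (-β) ≤ (t / 2) ^ (-β) :=
        Real.rpow_le_rpow_of_nonpos (by positivity) (by linarith) (by linarith)
      have h3 : 0 ≤ (t / 2) ^ (-α) * (t - s) ^ (-β) := by positivity
      have h4 : 0 ≤ s ^ (-α) := by positivity
      nlinarith
    · have : s ^ (-α) ≤ (t / 2) ^ (-α) :=
        Real.rpow_le_rpow_of_nonpos (by positivity) (by linarith) (by linarith)
      have h3 : 0 ≤ (t / 2) ^ (-β) * s ^ (-α) := by positivity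
      have h4 : 0 ≤ (t - s) ^ (-β) := by positivity
      nlinarith
  calc ∫⁻ s in Ioo 0 t, ENNReal.ofReal ((t - s) ^ (-β) * s ^ (-α))
      ≤ ∫⁻ s in Ioo 0 t, (ENNReal.ofReal ((t / 2) ^ (-β)) * ENNReal.ofReal (s ^ (-α)) +
          ENNReal.ofReal ((t / 2) ^ (-α)) * ENNReal.ofReal ((t - s) ^ (-β))) := by
        refine setLIntegral_mono' measurableSet_Ioo fun s hs => ?_
        rw [← ENNReal.ofReal_mul (by positivity), ← ENNReal.ofReal_mul (by positivity),
          ← ENNReal.ofReal_add]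
        · exact ENNReal.ofReal_le_ofReal (hp s hs)
        · have := hs.1; positivity
        · have := sub_pos.2 hs.2; positivity
    _ = ENNReal.ofReal ((t / 2) ^ (-β)) * ENNReal.ofReal (t ^ (1 - α) / (1 - α)) +
          ENNReal.ofReal ((t / 2) ^ (-α)) * ENNReal.ofReal (t ^ (1 - β) / (1 - β)) := by
        rw [lintegral_add_left (by fun_prop), lintegral_const_mul _ (by fun_prop),
          lintegral_const_mul _ (by fun_prop), lintegral_rpow_neg_Ioo hα ht,
          lintegral_sub_rpow_neg_Ioo hβ ht, sub_zero]
    _ = _ := by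
        rw [← ENNReal.ofReal_mul (by positivity), ← ENNReal.ofReal_mul (by positivity),
          ← ENNReal.ofReal_add (by positivity) (by positivity)]
        change _ = ENNReal.ofReal _ * _
        rw [← ENNReal.ofReal_mul (by positivity)]
        congr 1
        rw [Real.div_rpow ht.le zero_le_two, Real.div_rpow ht.le zero_le_two,
          Real.rpow_neg zero_le_two, Real.rpow_neg zero_le_two]
        have e1 : t ^ (1 - α - β) = t ^ (-β) * t ^ (1 - α) := by
          rw [← Real.rpow_add ht]; congr 1; ring
        have e2 : t ^ (-α) * t ^ (1 - β) = t ^ (-β) * t ^ (1 - α) := by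
          rw [← Real.rpow_add ht, ← Real.rpow_add ht]; congr 1; ring
        rw [e1]
        calc _ = 2 ^ β / (1 - α) * (t ^ (-β) * t ^ (1 - α)) +
              2 ^ α / (1 - β) * (t ^ (-α) * t ^ (1 - β)) := by field_simp
          _ = _ := by rw [e2]; ring

theorem measurable_uncurry_lconv {k f : ℝ → E3 → ℝ≥0∞} (hk : Measurable (Function.uncurry k))
    (hf : Measurable (Function.uncurry f)) :
    Measurable (Function.uncurry fun s x => lconv (k s) (f s) x) := by
  have : Measurable (Function.uncurry fun (z : ℝ × E3) (y : E3) => k z.1 (z.2 - y) * f z.1 y) := by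
    refine Measurable.mul ?_ ?_
    · exact hk.comp (((measurable_fst.comp measurable_fst)).prodMk
        ((measurable_snd.comp measurable_fst).sub measurable_snd))
    · exact hf.comp ((measurable_fst.comp measurable_fst).prodMk measurable_snd)
  exact this.lintegral_prod_right

theorem lnorm_lintegral_le {μ : Measure ℝ} [SFinite μ] {g : ℝ → E3 → ℝ≥0∞}
    (hg : Measurable (Function.uncurry g)) {a : ℝ → ℝ≥0∞} (ha : Measurable a) {r : ℝ} (hr : 1 ≤ r)
    (ha0 : ∀ᵐ s ∂μ, a s ≠ 0) (ha1 : ∀ᵐ s ∂μ, a s ≠ ⊤) (h : ∀ᵐ s ∂μ, lnorm r (g s) ≤ a s) :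
    lnorm r (fun x => ∫⁻ s, g s x ∂μ) ≤ ∫⁻ s, a s ∂μ := by
  have hr0 : 0 < r := by linarith
  rw [lnorm, one_div, ENNReal.rpow_inv_le_iff hr0]
  refine lintegral_lintegral_rpow_le hg ha hr ha0 ha1 ?_
  filter_upwards [h] with s hs
  rw [← lnorm_rpow hr0]
  gcongr

/-- The `L^q → L^r` estimate for the parabolic potential with a kernel of the scaling of
`S(t) ℙ div`. -/
theorem exists_lnorm_potential_le {q r α : ℝ} (hq : 1 ≤ q) (hqr : q ≤ r)
    (hδ : 1 / q - 1 / r < 1 / 3) (hα0 : 0 ≤ α) (hα : α < 1) :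
    ∃ C : ℝ≥0, ∀ (B M : ℝ≥0) (_ : 0 < B) (_ : 0 < M) (κ f : ℝ → E3 → ℝ≥0∞)
      (_ : Measurable (Function.uncurry κ)) (_ : Measurable (Function.uncurry f))
      (_ : ∀ τ, 0 < τ → ∫⁻ z, κ τ z ≤ B * ENNReal.ofReal (τ ^ (-(1 / 2 : ℝ))))
      (_ : ∀ τ, 0 < τ → ∀ z, κ τ z ≤ B * ENNReal.ofReal (τ ^ (-2 : ℝ)))
      (t : ℝ) (_ : 0 < t)
      (_ : ∀ᵐ s ∂volume.restrict (Ioo 0 t), lnorm q (f s) ≤ M * ENNReal.ofReal (s ^ (-α))),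
      lnorm r (fun x => ∫⁻ s in Ioo 0 t, lconv (κ (t - s)) (f s) x) ≤
        C * B * M * ENNReal.ofReal (t ^ (1 / 2 - 3 / 2 * (1 / q - 1 / r) - α)) := by
  have hq0 : 0 < q := by linarith
  have hd : 0 ≤ 1 / q - 1 / r := sub_nonneg.2 (one_div_le_one_div_of_le hq0 hqr)
  set δ := 1 / q - 1 / r with hδdef
  -- Young's inequality raises τ^{-1/2} to the power 1 - δ and τ^{-2} to the power δ, hence β = (1 -
  -- δ)/2 + 2δ. The hypothesis δ < 1/3 is exactly β < 1.
  set β := 1 / 2 + 3 / 2 * δ with hβ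
  obtain ⟨C, -, hC⟩ := exists_lintegral_sub_rpow_mul_rpow_le hα0 hα (β := β) (by positivity)
    (by rw [hβ]; linarith)
  refine ⟨C, fun B M hB hM κ f hκ hf h1 h2 t ht h3 => ?_⟩
  have hm : Measurable (Function.uncurry fun s => κ (t - s)) :=
    hκ.comp ((measurable_const.sub measurable_fst).prodMk measurable_snd)
  -- Positivity of `B` and `M` keeps the majorant `a` away from zero, as the form of Minkowski's
  -- inequality used here requires.
  have key := lnorm_lintegral_le (μ := volume.restrict (Ioo 0 t)) (r := r)
    (g := fun s x => lconv (κ (t - s)) (f s) x)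
    (a := fun s => B * M * ENNReal.ofReal ((t - s) ^ (-β) * s ^ (-α)))
    (measurable_uncurry_lconv hm hf) (by fun_prop) (by linarith) ?_ ?_ ?_
  · refine key.trans ?_
    rw [lintegral_const_mul _ (by fun_prop)]
    calc _ ≤ (B : ℝ≥0∞) * M * (C * ENNReal.ofReal (t ^ (1 - α - β))) := by gcongr; exact hC t ht
      _ = _ := by
        rw [show 1 - α - β = 1 / 2 - 3 / 2 * δ - α by rw [hβ]; ring]; ring
  · filter_upwards [ae_restrict_mem measurableSet_Ioo] with s hs
    have h4 : 0 < s := hs.1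
    have h5 : 0 < t - s := sub_pos.2 hs.2
    have h6 : 0 < (t - s) ^ (-β) * s ^ (-α) := by positivity
    simp [hB.ne', hM.ne', h6]
  · filter_upwards with s
    exact ENNReal.mul_ne_top (ENNReal.mul_ne_top ENNReal.coe_ne_top ENNReal.coe_ne_top)
      ENNReal.ofReal_ne_top
  · filter_upwards [ae_restrict_mem measurableSet_Ioo, h3] with s hs h3
    have h4 : 0 < s := hs.1
    have h5 : 0 < t - s := sub_pos.2 hs.2
    refine (lnorm_lconv_le hm.of_uncurry_left hf.of_uncurry_left (h1 _ h5) (h2 _ h5) hq hqr).trans ?_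
    rw [← hδdef]
    have hδ1 : 0 ≤ 1 - δ := by linarith
    calc _ ≤ (B * ENNReal.ofReal ((t - s) ^ (-(1 / 2 : ℝ)))) ^ (1 - δ) *
          (B * ENNReal.ofReal ((t - s) ^ (-2 : ℝ))) ^ δ * (M * ENNReal.ofReal (s ^ (-α))) := by
          gcongr
      _ = (B ^ (1 - δ) * B ^ δ) * M * (ENNReal.ofReal ((t - s) ^ (-(1 / 2 : ℝ))) ^ (1 - δ) *
          ENNReal.ofReal ((t - s) ^ (-2 : ℝ)) ^ δ * ENNReal.ofReal (s ^ (-α))) := by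
          rw [ENNReal.mul_rpow_of_nonneg _ _ hδ1, ENNReal.mul_rpow_of_nonneg _ _ hd]; ring
      _ = _ := by
          rw [← ENNReal.rpow_add_of_nonneg _ _ hδ1 hd, sub_add_cancel, ENNReal.rpow_one,
            ENNReal.ofReal_rpow_of_pos (by positivity), ENNReal.ofReal_rpow_of_pos (by positivity),
            ← ENNReal.ofReal_mul (by positivity), ← ENNReal.ofReal_mul (by positivity),
            ← Real.rpow_mul h5.le, ← Real.rpow_mul h5.le, ← Real.rpow_add h5]
          congr 4
          rw [hβ]; ring

/-! ### The gradient of the Oseen kernel -/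

theorem lintegral_comp_smul_E3 {R : ℝ} (hR : 0 < R) (f : E3 → ℝ≥0∞) (hf : Measurable f) :
    ∫⁻ x, f (R • x) = ENNReal.ofReal ((R ^ 3)⁻¹) * ∫⁻ x, f x := by
  have h := Measure.map_addHaar_smul (volume : Measure E3) hR.ne'
  rw [← lintegral_map hf (measurable_const_smul R), h, lintegral_smul_measure]
  simp [abs_of_pos hR]

theorem integral_comp_smul_E3 {F : Type*} [NormedAddCommGroup F] [NormedSpace ℝ F] {R : ℝ}
    (hR : 0 < R) (f : E3 → F) : ∫ x, f (R • x) = (R ^ 3)⁻¹ • ∫ x, f x := by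
  rw [Measure.integral_comp_smul]
  simp [abs_of_pos hR]

theorem fourierInv_comp_smul {F : Type*} [NormedAddCommGroup F] [NormedSpace ℂ F] {R : ℝ}
    (hR : 0 < R) (f : E3 → F) (x : E3) :
    𝓕⁻ (fun ξ => f (R • ξ)) x = (R ^ 3)⁻¹ • 𝓕⁻ f (R⁻¹ • x) := by
  rw [Real.fourierInv_eq', Real.fourierInv_eq', ← integral_comp_smul_E3 hR]
  congr 1
  ext v
  rw [real_inner_smul_left, real_inner_smul_right]
  field_simp

/-- The homogeneous cubic polynomial `ξₖ (δᵢⱼ |ξ|² - ξᵢ ξⱼ)`. -/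
noncomputable def cubicPoly (i j k : Fin 3) (ξ : E3) : ℝ :=
  ξ k * ((if i = j then ‖ξ‖ ^ 2 else 0) - ξ i * ξ j)

/-- The symbol of `∂ₖ (δᵢⱼ (-Δ) + ∂ᵢ ∂ⱼ) S(σ)`. -/
noncomputable def cubicSymbol (i j k : Fin 3) (σ : ℝ) (ξ : E3) : ℂ :=
  ((2 * Real.pi) ^ 3 * cubicPoly i j k ξ : ℝ) * Complex.I *
    Real.exp (-(4 * Real.pi ^ 2 * (σ * ‖ξ‖ ^ 2)))

/-- The symbol of `∂ₖ S(τ) ℙ`. -/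
noncomputable def gradOseenSymbol (i j k : Fin 3) (τ : ℝ) (ξ : E3) : ℂ :=
  (2 * Real.pi * ξ k * ((if i = j then 1 else 0) - ξ i * ξ j / ‖ξ‖ ^ 2) : ℝ) * Complex.I *
    Real.exp (-(4 * Real.pi ^ 2 * (τ * ‖ξ‖ ^ 2)))

theorem hasTemperateGrowth_coord (k : Fin 3) : Function.HasTemperateGrowth (fun ξ : E3 => ξ k) := by
  have h := Function.hasTemperateGrowth_inner_left (EuclideanSpace.single k (1 : ℝ) : E3)
  have h2 : (fun ξ : E3 => ξ k) = fun x => inner ℝ x (EuclideanSpace.single k (1 : ℝ)) := by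
    ext ξ; simp [EuclideanSpace.inner_single_right]
  rwa [h2]

theorem hasTemperateGrowth_cubicPoly (i j k : Fin 3) :
    Function.HasTemperateGrowth (cubicPoly i j k) := by
  refine (hasTemperateGrowth_coord k).mul (Function.HasTemperateGrowth.sub ?_
    ((hasTemperateGrowth_coord i).mul (hasTemperateGrowth_coord j)))
  split_ifs
  · exact Function.hasTemperateGrowth_norm_sq E3
  · exact Function.HasTemperateGrowth.const 0

theorem hasTemperateGrowth_cubicFactor (i j k : Fin 3) : Function.HasTemperateGrowth
    (fun ξ : E3 => (((2 * Real.pi) ^ 3 * cubicPoly i j k ξ : ℝ) : ℂ) * Complex.I) := by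
  have h := hasTemperateGrowth_cubicPoly i j k
  exact (Function.Complex.hasTemperateGrowth_ofReal.comp
    ((Function.HasTemperateGrowth.const ((2 * Real.pi) ^ 3)).mul h)).mul
    (Function.HasTemperateGrowth.const Complex.I)

/-- The symbol `cubicSymbol` at time one as a Schwartz function. -/
noncomputable def cubicSchwartz (i j k : Fin 3) : 𝓢(E3, ℂ) :=
  SchwartzMap.smulLeftCLM ℂ
    (fun ξ : E3 => (((2 * Real.pi) ^ 3 * cubicPoly i j k ξ : ℝ) : ℂ) * Complex.I)
    (SchwartzMap.postcompCLM Complex.ofRealCLM (gaussianSchwartz (4 * Real.pi ^ 2) (by positivity)))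

theorem cubicSchwartz_apply (i j k : Fin 3) (ξ : E3) :
    cubicSchwartz i j k ξ = cubicSymbol i j k 1 ξ := by
  rw [cubicSchwartz, SchwartzMap.smulLeftCLM_apply_apply (hasTemperateGrowth_cubicFactor i j k),
    cubicSymbol, one_mul, smul_eq_mul]
  rfl

theorem cubicPoly_smul (i j k : Fin 3) (R : ℝ) (ξ : E3) :
    cubicPoly i j k (R • ξ) = R ^ 3 * cubicPoly i j k ξ := by
  simp only [cubicPoly, norm_smul, mul_pow, Real.norm_eq_abs, sq_abs, PiLp.smul_apply, smul_eq_mul]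
  split_ifs <;> ring

theorem cubicSymbol_eq_smul (i j k : Fin 3) {σ : ℝ} (hσ : 0 < σ) (ξ : E3) :
    cubicSymbol i j k σ ξ = ((Real.sqrt σ ^ 3)⁻¹ : ℝ) • cubicSchwartz i j k (Real.sqrt σ • ξ) := by
  rw [cubicSchwartz_apply, cubicSymbol, cubicSymbol, cubicPoly_smul, norm_smul,
    mul_pow _ ‖ξ‖, Real.norm_eq_abs, sq_abs, Real.sq_sqrt hσ.le, one_mul, Complex.real_smul]
  push_cast
  have h' : (Real.sqrt σ : ℂ) ≠ 0 := by exact_mod_cast (Real.sqrt_pos.2 hσ).ne'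
  field_simp

/-- The Schwartz function whose rescalings integrate to the gradient of the Oseen kernel. -/
noncomputable def cubicKernel (i j k : Fin 3) : 𝓢(E3, ℂ) := 𝓕⁻ (cubicSchwartz i j k)

theorem fourierInv_cubicSymbol (i j k : Fin 3) {σ : ℝ} (hσ : 0 < σ) (x : E3) :
    𝓕⁻ (cubicSymbol i j k σ) x = ((σ ^ 3)⁻¹ : ℝ) • cubicKernel i j k ((Real.sqrt σ)⁻¹ • x) := by
  have hs : 0 < Real.sqrt σ := Real.sqrt_pos.2 hσ
  have h : cubicSymbol i j k σ = fun ξ => ((Real.sqrt σ ^ 3)⁻¹ : ℝ) •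
      cubicSchwartz i j k (Real.sqrt σ • ξ) := funext (cubicSymbol_eq_smul i j k hσ)
  rw [h, cubicKernel, SchwartzMap.fourierInv_coe]
  have h2 := fourierInv_comp_smul hs
    (fun ξ => ((Real.sqrt σ ^ 3)⁻¹ : ℝ) • cubicSchwartz i j k ξ) x
  rw [h2, Real.fourierInv_eq', Real.fourierInv_eq', ← integral_smul, ← integral_smul]
  congr 1
  ext v
  rw [smul_comm (Complex.exp _), smul_smul]
  congr 1
  rw [← mul_inv, ← pow_add, show 3 + 3 = 2 * 3 by rfl, pow_mul, Real.sq_sqrt hσ.le]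

/-- Since ∫_τ^∞ 4π²|ξ|² exp(-4π²σ|ξ|²) dσ = exp(-4π²τ|ξ|²), integration over the scales σ > τ
produces the factor 1/|ξ|² of the Leray projector. A symbol that is not smooth at the origin becomes
a superposition of rescaled Schwartz symbols. -/
theorem gradOseenSymbol_eq_integral (i j k : Fin 3) (τ : ℝ) (ξ : E3) :
    gradOseenSymbol i j k τ ξ = ∫ σ in Ioi τ, cubicSymbol i j k σ ξ := by
  by_cases hξ : ξ = 0
  · simp [hξ, gradOseenSymbol, cubicSymbol, cubicPoly]
  have hn : 0 < ‖ξ‖ := norm_pos_iff.2 hξ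
  have h := integral_exp_mul_Ioi (a := -(4 * Real.pi ^ 2 * ‖ξ‖ ^ 2))
    (by have := Real.pi_pos; simp; positivity) τ
  unfold cubicSymbol
  rw [integral_const_mul, integral_complex_ofReal]
  have h2 : ∀ σ : ℝ, -(4 * Real.pi ^ 2 * (σ * ‖ξ‖ ^ 2)) = -(4 * Real.pi ^ 2 * ‖ξ‖ ^ 2) * σ :=
    fun σ => by ring
  simp only [h2, h, gradOseenSymbol, cubicPoly]
  have hpi : (Real.pi : ℂ) ≠ 0 := by exact_mod_cast Real.pi_ne_zero
  have hn' : (‖ξ‖ : ℂ) ≠ 0 := by exact_mod_cast hn.ne'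
  push_cast
  split_ifs <;> (push_cast; field_simp; try ring)

theorem continuous_cubicSymbol (i j k : Fin 3) :
    Continuous (Function.uncurry (cubicSymbol i j k)) := by
  have h := (hasTemperateGrowth_cubicFactor i j k).1.continuous
  refine (h.comp continuous_snd).mul ?_
  fun_prop

/-- By scaling, the L¹ norm of `cubicSymbol i j k σ` is a multiple of σ^{-3}, integrable on σ > τ.
This justifies exchanging the integral over scales with the inverse Fourier transform. -/
theorem integrable_cubicSymbol_prod (i j k : Fin 3) {τ : ℝ} (hτ : 0 < τ) :
    Integrable (Function.uncurry (cubicSymbol i j k)) ((volume.restrict (Ioi τ)).prod volume) := by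
  rw [integrable_prod_iff (continuous_cubicSymbol i j k).aestronglyMeasurable]
  constructor
  · filter_upwards [ae_restrict_mem measurableSet_Ioi] with σ hσ
    have hs : 0 < σ := hτ.trans hσ
    have := ((cubicSchwartz i j k).integrable (μ := volume)).comp_smul (Real.sqrt_pos.2 hs).ne'
    refine (this.smul ((Real.sqrt σ ^ 3)⁻¹ : ℝ)).congr (ae_of_all _ fun ξ => ?_)
    exact (cubicSymbol_eq_smul i j k hs ξ).symm
  · have h : IntegrableOn (fun σ : ℝ => σ ^ (-3 : ℝ) * ∫ ξ, ‖cubicSchwartz i j k ξ‖) (Ioi τ) :=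
      (integrableOn_Ioi_rpow_of_lt (by norm_num) hτ).mul_const _
    refine h.congr_fun (fun σ hσ => ?_) measurableSet_Ioi
    have hs : 0 < σ := hτ.trans hσ
    simp only [Function.uncurry, cubicSymbol_eq_smul i j k hs, norm_smul]
    rw [integral_const_mul, integral_comp_smul_E3 (Real.sqrt_pos.2 hs)
      (fun ξ => ‖cubicSchwartz i j k ξ‖), smul_eq_mul, ← mul_assoc]
    congr 1
    rw [norm_inv, Real.norm_of_nonneg (by positivity), ← mul_inv, ← pow_add,
      show 3 + 3 = 2 * 3 by rfl, pow_mul, Real.sq_sqrt hs.le, Real.rpow_neg hs.le]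
    norm_cast

theorem integrable_gradOseenSymbol (i j k : Fin 3) {τ : ℝ} (hτ : 0 < τ) :
    Integrable (gradOseenSymbol i j k τ) := by
  refine (integrable_cubicSymbol_prod i j k hτ).integral_prod_right.congr (ae_of_all _ fun ξ => ?_)
  exact (gradOseenSymbol_eq_integral i j k τ ξ).symm

/-- The complex form of the kernel of `∂ₖ S(τ) ℙ`. -/
noncomputable def gradOseenC (i j k : Fin 3) (τ : ℝ) (x : E3) : ℂ :=
  ∫ σ in Ioi τ, ((σ ^ 3)⁻¹ : ℝ) • cubicKernel i j k ((Real.sqrt σ)⁻¹ • x)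

theorem fourierInv_gradOseenSymbol (i j k : Fin 3) {τ : ℝ} (hτ : 0 < τ) (x : E3) :
    𝓕⁻ (gradOseenSymbol i j k τ) x = gradOseenC i j k τ x := by
  have hi := integrable_cubicSymbol_prod i j k hτ
  have h1 : gradOseenC i j k τ x = ∫ σ in Ioi τ, 𝓕⁻ (cubicSymbol i j k σ) x := by
    refine setIntegral_congr_fun measurableSet_Ioi fun σ hσ => ?_
    exact (fourierInv_cubicSymbol i j k (hτ.trans hσ) x).symm
  rw [h1]
  simp only [Real.fourierInv_eq', gradOseenSymbol_eq_integral]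
  rw [integral_integral_swap]
  · refine integral_congr_ae (ae_of_all _ fun ξ => ?_)
    exact (integral_smul _ _).symm
  · refine hi.mono ?_ (ae_of_all _ fun z => ?_)
    · refine Continuous.aestronglyMeasurable ?_
      have hc : Continuous fun z : ℝ × E3 =>
          Complex.exp (((2 * Real.pi * inner ℝ z.2 x : ℝ) : ℂ) * Complex.I) := by fun_prop
      exact hc.smul (continuous_cubicSymbol i j k)
    · simp only [Function.uncurry, norm_smul, Complex.norm_exp_ofReal_mul_I, one_mul, le_refl]

theorem norm_oseenSymbol_le (i j : Fin 3) (ξ : E3) :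
    |oseenSymbol i j ξ| ≤ 2 * Real.exp (-‖ξ‖ ^ 2) := by
  rw [oseenSymbol, abs_mul, abs_of_pos (Real.exp_pos _), mul_comm]
  gcongr
  have h1 : |ξ i * ξ j / ‖ξ‖ ^ 2| ≤ 1 := by
    rw [abs_div, abs_mul, abs_of_nonneg (sq_nonneg ‖ξ‖), sq]
    refine div_le_one_of_le₀ ?_ (by positivity)
    exact mul_le_mul (PiLp.norm_apply_le ξ i) (PiLp.norm_apply_le ξ j) (abs_nonneg _) (norm_nonneg _)
  have h2 : |(if i = j then (1 : ℝ) else 0)| ≤ 1 := by split_ifs <;> simp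
  exact (abs_sub _ _).trans (by linarith)

theorem norm_gradOseenSymbol_le (i j k : Fin 3) (τ : ℝ) (ξ : E3) :
    ‖gradOseenSymbol i j k τ ξ‖ ≤
      2 * (2 * Real.pi * ‖ξ‖) * Real.exp (-(4 * Real.pi ^ 2 * (τ * ‖ξ‖ ^ 2))) := by
  rw [gradOseenSymbol, norm_mul, norm_mul, Complex.norm_I, mul_one, Complex.norm_real,
    Complex.norm_real, Real.norm_of_nonneg (Real.exp_pos _).le]
  gcongr
  have h1 : |ξ i * ξ j / ‖ξ‖ ^ 2| ≤ 1 := by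
    rw [abs_div, abs_mul, abs_of_nonneg (sq_nonneg ‖ξ‖), sq]
    refine div_le_one_of_le₀ ?_ (by positivity)
    exact mul_le_mul (PiLp.norm_apply_le ξ i) (PiLp.norm_apply_le ξ j) (abs_nonneg _) (norm_nonneg _)
  have h2 : |(if i = j then (1 : ℝ) else 0)| ≤ 1 := by split_ifs <;> simp
  have h3 : |(if i = j then (1 : ℝ) else 0) - ξ i * ξ j / ‖ξ‖ ^ 2| ≤ 2 :=
    (abs_sub _ _).trans (by linarith)
  rw [Real.norm_eq_abs, abs_mul, abs_mul, abs_of_pos (by positivity : (0 : ℝ) < 2 * Real.pi)]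
  have h4 : |ξ k| ≤ ‖ξ‖ := PiLp.norm_apply_le ξ k
  calc _ ≤ 2 * Real.pi * ‖ξ‖ * 2 := by gcongr
    _ = _ := by ring

theorem measurable_oseenSymbol (i j : Fin 3) : Measurable (oseenSymbol i j) := by
  unfold oseenSymbol; fun_prop

/-- Differentiation under the Fourier integral brings down a factor 2πi ξ_k. The Gaussian makes the
symbol and its first moment integrable, and no smoothness of the symbol at the origin is needed. -/
theorem fderiv_oseenKernel (i j k : Fin 3) (x : E3) :
    fderiv ℝ (oseenKernel i j) x (e k) = (gradOseenC i j k 1 x).re := by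
  set g : E3 → ℂ := fun ξ : E3 => ((oseenSymbol i j ((2 * Real.pi) • ξ) : ℝ) : ℂ) with hg
  have hgm : AEStronglyMeasurable g :=
    (Complex.measurable_ofReal.comp ((measurable_oseenSymbol i j).comp
      (measurable_const_smul _))).aestronglyMeasurable
  set G := gaussianSchwartz (4 * Real.pi ^ 2) (by positivity) with hG
  have hgb : ∀ ξ, ‖g ξ‖ ≤ 2 * ‖G ξ‖ := fun ξ => by
    rw [hg, Complex.norm_real]
    refine (norm_oseenSymbol_le i j _).trans ?_
    rw [Real.norm_eq_abs]
    refine mul_le_mul_of_nonneg_left (le_trans (le_of_eq ?_) (le_abs_self _)) zero_le_two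
    change _ = Real.exp _
    rw [norm_smul, mul_pow, Real.norm_of_nonneg (by positivity)]
    congr 1; ring
  have hgi : Integrable g := by
    refine Integrable.mono' (g := fun ξ => 2 * ‖G ξ‖) (G.integrable.norm.const_mul 2) hgm
      (ae_of_all _ hgb)
  have hgi' : Integrable fun ξ => ‖ξ‖ * ‖g ξ‖ := by
    refine Integrable.mono' (g := fun ξ => 2 * (‖ξ‖ ^ 1 * ‖G ξ‖))
      ((SchwartzMap.integrable_pow_mul volume G 1).const_mul 2)
      (continuous_norm.aestronglyMeasurable.mul hgm.norm) (ae_of_all _ fun ξ => ?_)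
    rw [Real.norm_of_nonneg (by positivity), pow_one]
    nlinarith [hgb ξ, norm_nonneg ξ]
  -- Evenness turns `𝓕⁻ g` into `𝓕 g`, to which the derivative formula for the Fourier integral
  -- applies.
  have heven : ∀ ξ, g (-ξ) = g ξ := fun ξ => by simp [hg, oseenSymbol]
  have h1 : 𝓕⁻ g = 𝓕 g := by rw [Real.fourierInv_eq_fourier_comp_neg]; simp only [heven]
  have hO : oseenKernel i j = Complex.reCLM ∘ 𝓕 g := by
    ext x; rw [oseenKernel, ← hg, h1]; rfl
  have hd := (Complex.reCLM.hasFDerivAt (x := 𝓕 g x)).comp x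
    (Real.hasFDerivAt_fourier hgi hgi' x)
  have hInt : Integrable (VectorFourier.fourierSMulRight (innerSL ℝ) g) :=
    (hgi'.const_mul (2 * Real.pi * ‖innerSL ℝ (E := E3)‖)).mono'
      (hgm.fourierSMulRight (L := innerSL ℝ)) (ae_of_all _ fun v =>
        (VectorFourier.norm_fourierSMulRight_le (innerSL ℝ) g v).trans (by rw [mul_assoc]))
  rw [hO, hd.fderiv, ← fourierInv_gradOseenSymbol i j k one_pos]
  simp only [ContinuousLinearMap.comp_apply, Complex.reCLM_apply]
  congr 1
  rw [Real.fourier_continuousLinearMap_apply hInt, Real.fourierInv_eq_fourier_comp_neg]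
  refine congrFun (congrArg 𝓕 (funext fun ξ => ?_)) x
  rw [VectorFourier.fourierSMulRight_apply, hg, gradOseenSymbol]
  have hin : innerSL ℝ ξ (EuclideanSpace.single k 1) = ξ k := by
    change inner ℝ ξ _ = _
    simp [EuclideanSpace.inner_single_right]
  simp only [oseenSymbol, e, hin, norm_smul, mul_pow,
    Real.norm_eq_abs, sq_abs, PiLp.smul_apply, smul_eq_mul, norm_neg, PiLp.neg_apply]
  have hr : 2 * Real.pi * ξ i * (2 * Real.pi * ξ j) / (2 ^ 2 * Real.pi ^ 2 * ‖ξ‖ ^ 2) =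
      ξ i * ξ j / ‖ξ‖ ^ 2 := by
    have := Real.pi_ne_zero
    field_simp
  rw [hr]
  have hE : -(2 ^ 2 * Real.pi ^ 2 * ‖ξ‖ ^ 2) = -(4 * Real.pi ^ 2 * (1 * ‖ξ‖ ^ 2)) := by ring
  rw [hE]
  simp
  ring

/-- Substitution σ ↦ τσ in the integral over scales: σ^{-3} dσ contributes the factor τ^{-2}. -/
theorem gradOseenC_scaling (i j k : Fin 3) {τ : ℝ} (hτ : 0 < τ) (x : E3) :
    ((τ ^ 2)⁻¹ : ℝ) • gradOseenC i j k 1 ((Real.sqrt τ)⁻¹ • x) = gradOseenC i j k τ x := by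
  have h := integral_comp_mul_left_Ioi
    (fun σ : ℝ => ((σ ^ 3)⁻¹ : ℝ) • cubicKernel i j k ((Real.sqrt σ)⁻¹ • x)) 1 hτ
  rw [mul_one] at h
  have h2 : gradOseenC i j k τ x = τ • ∫ σ in Ioi (1 : ℝ), (((τ * σ) ^ 3)⁻¹ : ℝ) •
      cubicKernel i j k ((Real.sqrt (τ * σ))⁻¹ • x) := by
    rw [h, smul_smul, mul_inv_cancel₀ hτ.ne', one_smul]; rfl
  rw [h2, gradOseenC, ← integral_smul, ← integral_smul]
  refine integral_congr_ae (ae_of_all _ fun σ => ?_)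
  simp only
  rw [Real.sqrt_mul hτ.le, mul_inv, smul_smul, smul_smul, smul_smul, mul_comm (Real.sqrt σ)⁻¹]
  congr 1
  by_cases hσ : σ = 0
  · simp [hσ]
  field_simp

/-- The kernel of `S(τ) ℙ div`. -/
noncomputable def gradOseen (i j k : Fin 3) (τ : ℝ) (x : E3) : ℝ :=
  (τ ^ 2)⁻¹ * fderiv ℝ (oseenKernel i j) ((Real.sqrt τ)⁻¹ • x) (e k)

theorem gradOseen_eq (i j k : Fin 3) {τ : ℝ} (hτ : 0 < τ) (x : E3) :
    gradOseen i j k τ x = (gradOseenC i j k τ x).re := by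
  rw [gradOseen, fderiv_oseenKernel, ← gradOseenC_scaling i j k hτ, Complex.smul_re, smul_eq_mul]

theorem measurable_gradOseen (i j k : Fin 3) :
    Measurable (Function.uncurry (gradOseen i j k)) := by
  refine Measurable.mul (by fun_prop) ?_
  exact (measurable_fderiv_apply_const ℝ (oseenKernel i j) (e k)).comp
    (by fun_prop)

/-! ### Estimates for the gradient of the Oseen kernel -/

/-- The integrand of `gradOseenC`. -/
noncomputable def cubicKernelAt (i j k : Fin 3) (σ : ℝ) (x : E3) : ℂ :=
  ((σ ^ 3)⁻¹ : ℝ) • cubicKernel i j k ((Real.sqrt σ)⁻¹ • x)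

theorem measurable_cubicKernelAt (i j k : Fin 3) :
    Measurable (Function.uncurry (cubicKernelAt i j k)) := by
  have h : Measurable fun z : ℝ × E3 => ((z.1 ^ 3)⁻¹ : ℝ) := by fun_prop
  exact h.smul ((cubicKernel i j k).continuous.measurable.comp (by fun_prop))

theorem lintegral_cubicKernelAt (i j k : Fin 3) {σ : ℝ} (hσ : 0 < σ) :
    ∫⁻ x, ‖cubicKernelAt i j k σ x‖ₑ =
      ENNReal.ofReal (σ ^ (-(3 / 2) : ℝ)) * ∫⁻ x, ‖cubicKernel i j k x‖ₑ := by
  have hs : 0 < (Real.sqrt σ)⁻¹ := by positivity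
  simp only [cubicKernelAt, enorm_smul]
  rw [lintegral_const_mul' _ _ (by simp), lintegral_comp_smul_E3 hs
    (fun x => ‖cubicKernel i j k x‖ₑ) (cubicKernel i j k).continuous.measurable.enorm, ← mul_assoc]
  congr 1
  rw [Real.enorm_eq_ofReal (by positivity), ← ENNReal.ofReal_mul (by positivity)]
  congr 1
  rw [inv_pow, inv_inv, Real.sqrt_eq_rpow, ← Real.rpow_natCast, ← Real.rpow_natCast,
    ← Real.rpow_neg hσ.le, ← Real.rpow_mul hσ.le, ← Real.rpow_add hσ]
  norm_num

theorem lintegral_setLIntegral_cubicKernelAt (i j k : Fin 3) {s : Set ℝ} (hs : MeasurableSet s)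
    (hs0 : s ⊆ Ioi 0) :
    ∫⁻ x, ∫⁻ σ in s, ‖cubicKernelAt i j k σ x‖ₑ =
      (∫⁻ σ in s, ENNReal.ofReal (σ ^ (-(3 / 2) : ℝ))) * ∫⁻ x, ‖cubicKernel i j k x‖ₑ := by
  rw [lintegral_lintegral_swap, ← lintegral_mul_const _ (by fun_prop)]
  · exact setLIntegral_congr_fun hs fun σ hσ => lintegral_cubicKernelAt i j k (hs0 hσ)
  · exact ((measurable_cubicKernelAt i j k).comp measurable_swap).enorm.aemeasurable

theorem exists_norm_cubicKernel_le (i j k : Fin 3) : ∃ B : ℝ, 0 < B ∧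
    ∀ x, ‖cubicKernel i j k x‖ ≤ B := by
  obtain ⟨B, hB, h⟩ := (cubicKernel i j k).decay 0 0
  refine ⟨B, hB, fun x => ?_⟩
  simpa using h x

theorem lintegral_cubicKernel_lt_top (i j k : Fin 3) : ∫⁻ x, ‖cubicKernel i j k x‖ₑ < ⊤ :=
  ((cubicKernel i j k).integrable (μ := volume)).2

theorem norm_cubicKernelAt_le {i j k : Fin 3} {B : ℝ} (hB : ∀ x, ‖cubicKernel i j k x‖ ≤ B)
    {σ : ℝ} (hσ : 0 < σ) (x : E3) : ‖cubicKernelAt i j k σ x‖ ≤ σ ^ (-3 : ℝ) * B := by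
  rw [cubicKernelAt, norm_smul, Real.norm_of_nonneg (by positivity), Real.rpow_neg hσ.le]
  have : σ ^ (3 : ℝ) = σ ^ 3 := by norm_cast
  rw [this]
  gcongr
  exact hB _

theorem integrableOn_cubicKernelAt (i j k : Fin 3) {τ : ℝ} (hτ : 0 < τ) (x : E3) :
    IntegrableOn (fun σ => cubicKernelAt i j k σ x) (Ioi τ) := by
  obtain ⟨B, -, hB⟩ := exists_norm_cubicKernel_le i j k
  refine Integrable.mono' ((integrableOn_Ioi_rpow_of_lt (a := -3) (by norm_num) hτ).mul_const B)
    (measurable_cubicKernelAt i j k).of_uncurry_right.aestronglyMeasurable ?_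
  filter_upwards [ae_restrict_mem measurableSet_Ioi] with σ hσ
  exact norm_cubicKernelAt_le hB (hτ.trans hσ) x

theorem gradOseenC_eq (i j k : Fin 3) (τ : ℝ) (x : E3) :
    gradOseenC i j k τ x = ∫ σ in Ioi τ, cubicKernelAt i j k σ x := rfl

theorem stronglyMeasurable_gradOseenC (i j k : Fin 3) (τ : ℝ) :
    StronglyMeasurable (gradOseenC i j k τ) :=
  ((measurable_cubicKernelAt i j k).comp measurable_swap).stronglyMeasurable.integral_prod_right'
    (ν := volume.restrict (Ioi τ))

theorem lintegral_Ioi_rpow {τ : ℝ} (hτ : 0 < τ) :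
    ∫⁻ σ in Ioi τ, ENNReal.ofReal (σ ^ (-(3 / 2) : ℝ)) =
      ENNReal.ofReal (2 * τ ^ (-(1 / 2) : ℝ)) := by
  rw [← ofReal_integral_eq_lintegral_ofReal (integrableOn_Ioi_rpow_of_lt (by norm_num) hτ),
    integral_Ioi_rpow_of_lt (by norm_num) hτ]
  · congr 1
    norm_num
    ring
  · filter_upwards [ae_restrict_mem measurableSet_Ioi] with σ hσ
    exact Real.rpow_nonneg (hτ.trans hσ).le _

/-- The `L¹` norm, the supremum and the time modulus of continuity of the kernel of
`S(τ) ℙ div`. -/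
theorem exists_gradOseenC_le : ∃ B : ℝ≥0, 0 < B ∧ ∀ i j k : Fin 3, ∀ τ : ℝ, 0 < τ →
    (∫⁻ x, ‖gradOseenC i j k τ x‖ₑ ≤ B * ENNReal.ofReal (τ ^ (-(1 / 2) : ℝ))) ∧
    (∀ x, ‖gradOseenC i j k τ x‖ₑ ≤ B * ENNReal.ofReal (τ ^ (-2 : ℝ))) ∧
    ∀ h : ℝ, 0 < h → ∫⁻ x, ‖gradOseenC i j k (τ + h) x - gradOseenC i j k τ x‖ₑ ≤
      B * ENNReal.ofReal (h ^ (1 / 4 : ℝ) * τ ^ (-(3 / 4) : ℝ)) := by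
  choose S hS0 hS using exists_norm_cubicKernel_le
  set N : Fin 3 → Fin 3 → Fin 3 → ℝ := fun i j k => (∫⁻ x, ‖cubicKernel i j k x‖ₑ).toReal with hN
  have hN' : ∀ i j k, ∫⁻ x, ‖cubicKernel i j k x‖ₑ = ENNReal.ofReal (N i j k) := fun i j k =>
    (ENNReal.ofReal_toReal (lintegral_cubicKernel_lt_top i j k).ne).symm
  have hN0 : ∀ i j k, 0 ≤ N i j k := fun i j k => ENNReal.toReal_nonneg
  -- Summing over all index triples gives one constant for all entries. The factor 2 is that of
  -- ∫_τ^∞ σ^{-3/2} dσ = 2 τ^{-1/2}.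
  set B : ℝ := ∑ i, ∑ j, ∑ k, (S i j k + 2 * N i j k) with hB
  have hpos : ∀ i j k, 0 < S i j k + 2 * N i j k := fun i j k => by
    have := hS0 i j k; have := hN0 i j k; positivity
  have hle : ∀ i j k, S i j k + 2 * N i j k ≤ B := fun i j k => by
    calc _ ≤ ∑ k, (S i j k + 2 * N i j k) :=
          Finset.single_le_sum (f := fun k => S i j k + 2 * N i j k)
            (fun k _ => (hpos i j k).le) (Finset.mem_univ k)
      _ ≤ ∑ j, ∑ k, (S i j k + 2 * N i j k) :=
          Finset.single_le_sum (f := fun j => ∑ k, (S i j k + 2 * N i j k))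
            (fun j _ => Finset.sum_nonneg fun k _ => (hpos i j k).le) (Finset.mem_univ j)
      _ ≤ B := Finset.single_le_sum (f := fun i => ∑ j, ∑ k, (S i j k + 2 * N i j k))
            (fun i _ => Finset.sum_nonneg fun j _ => Finset.sum_nonneg fun k _ => (hpos i j k).le)
            (Finset.mem_univ i)
  have hB0 : 0 < B := (hpos 0 0 0).trans_le (hle 0 0 0)
  clear_value B N
  refine ⟨B.toNNReal, Real.toNNReal_pos.2 hB0, fun i j k τ hτ => ?_⟩
  have hBc : (B.toNNReal : ℝ≥0∞) = ENNReal.ofReal B := rfl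
  have hSB : S i j k ≤ B := by linarith [hle i j k, hN0 i j k]
  have hNB : 2 * N i j k ≤ B := by linarith [hle i j k, hS0 i j k]
  have hL1 : ∀ h : ℝ, 0 ≤ h → ∫⁻ x, ∫⁻ σ in Ioi (τ + h), ‖cubicKernelAt i j k σ x‖ₑ ≤
      ENNReal.ofReal (B * τ ^ (-(1 / 2) : ℝ)) := fun h hh => by
    have hτh : 0 < τ + h := by linarith
    rw [lintegral_setLIntegral_cubicKernelAt i j k measurableSet_Ioi
      (Ioi_subset_Ioi hτh.le), lintegral_Ioi_rpow hτh, hN',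
      ← ENNReal.ofReal_mul (by positivity)]
    refine ENNReal.ofReal_le_ofReal ?_
    have : (τ + h) ^ (-(1 / 2) : ℝ) ≤ τ ^ (-(1 / 2) : ℝ) :=
      Real.rpow_le_rpow_of_nonpos hτ (by linarith) (by norm_num)
    calc _ = (2 * N i j k) * (τ + h) ^ (-(1 / 2) : ℝ) := by ring
      _ ≤ _ := by gcongr
  rw [hBc]
  refine ⟨?_, fun x => ?_, fun h hh => ?_⟩
  · rw [← ENNReal.ofReal_mul hB0.le]
    have := hL1 0 le_rfl
    rw [add_zero] at this
    exact (lintegral_mono fun x => enorm_integral_le_lintegral_enorm _).trans this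
  · rw [← ENNReal.ofReal_mul hB0.le, ← ofReal_norm]
    refine ENNReal.ofReal_le_ofReal ?_
    have h1 := norm_integral_le_of_norm_le
      ((integrableOn_Ioi_rpow_of_lt (a := -3) (by norm_num) hτ).mul_const (S i j k))
      (f := fun σ => cubicKernelAt i j k σ x) (by
        filter_upwards [ae_restrict_mem measurableSet_Ioi] with σ hσ
        exact norm_cubicKernelAt_le (hS i j k) (hτ.trans hσ) x)
    rw [integral_mul_const, integral_Ioi_rpow_of_lt (by norm_num) hτ] at h1
    norm_num at h1
    refine h1.trans ?_
    have h2 : τ ^ (-2 : ℝ) = (τ ^ 2)⁻¹ := by rw [Real.rpow_neg hτ.le]; norm_cast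
    have h3 : 0 ≤ (τ ^ 2)⁻¹ := by positivity
    rw [h2]
    nlinarith [hS0 i j k]
  -- Only the scales τ < σ ≤ τ + h distinguish the kernels at the two times.
  · have hd : ∀ x, gradOseenC i j k (τ + h) x - gradOseenC i j k τ x =
        -∫ σ in Ioc τ (τ + h), cubicKernelAt i j k σ x := fun x => by
      have hu : Ioc τ (τ + h) ∪ Ioi (τ + h) = Ioi τ := Ioc_union_Ioi_eq_Ioi (by linarith)
      have hi := integrableOn_cubicKernelAt i j k hτ x
      rw [gradOseenC_eq, gradOseenC_eq, ← hu, setIntegral_union]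
      · ring
      · exact (Ioc_disjoint_Ioi le_rfl)
      · exact measurableSet_Ioi
      · exact hi.mono_set Ioc_subset_Ioi_self
      · exact hi.mono_set (Ioi_subset_Ioi (by linarith))
    generalize hD : ∫⁻ x, ‖gradOseenC i j k (τ + h) x - gradOseenC i j k τ x‖ₑ = D
    have hD1 : D ≤ ∫⁻ x, ∫⁻ σ in Ioc τ (τ + h), ‖cubicKernelAt i j k σ x‖ₑ := by
      rw [← hD]
      refine lintegral_mono fun x => ?_
      rw [hd, enorm_neg]
      exact enorm_integral_le_lintegral_enorm _
    have hD2 : D ≤ ENNReal.ofReal (B * τ ^ (-(1 / 2) : ℝ)) := by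
      refine hD1.trans (le_trans (lintegral_mono fun x => ?_) (hL1 0 le_rfl))
      rw [add_zero]
      exact lintegral_mono_set Ioc_subset_Ioi_self
    have hD3 : D ≤ ENNReal.ofReal (B * (h * τ ^ (-(3 / 2) : ℝ))) := by
      refine hD1.trans ?_
      rw [lintegral_setLIntegral_cubicKernelAt i j k measurableSet_Ioc
        (fun σ hσ => hτ.trans hσ.1), hN']
      have : ∫⁻ σ in Ioc τ (τ + h), ENNReal.ofReal (σ ^ (-(3 / 2) : ℝ)) ≤
          ENNReal.ofReal (h * τ ^ (-(3 / 2) : ℝ)) := by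
        calc _ ≤ ∫⁻ σ in Ioc τ (τ + h), ENNReal.ofReal (τ ^ (-(3 / 2) : ℝ)) := by
              refine setLIntegral_mono' measurableSet_Ioc fun σ hσ => ENNReal.ofReal_le_ofReal ?_
              exact Real.rpow_le_rpow_of_nonpos hτ hσ.1.le (by norm_num)
          _ = _ := by
              rw [setLIntegral_const, Real.volume_Ioc, mul_comm, ← ENNReal.ofReal_mul (by linarith)]
              congr 2; ring
      calc _ ≤ ENNReal.ofReal (h * τ ^ (-(3 / 2) : ℝ)) * ENNReal.ofReal (N i j k) := by gcongr
        _ = ENNReal.ofReal (N i j k * (h * τ ^ (-(3 / 2) : ℝ))) := by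
            rw [mul_comm, ← ENNReal.ofReal_mul (hN0 _ _ _)]
        _ ≤ _ := by
            refine ENNReal.ofReal_le_ofReal ?_
            gcongr
            linarith [hN0 i j k]
    -- The bound h τ^{-3/2} is not integrable at τ = 0. Its geometric mean with τ^{-1/2}, with
    -- weights 1/4 and 3/4, is h^{1/4} τ^{-3/4}, which is.
    calc D = D ^ (3 / 4 : ℝ) * D ^ (1 / 4 : ℝ) := by
          rw [← ENNReal.rpow_add_of_nonneg _ _ (by norm_num) (by norm_num)]; norm_num
      _ ≤ ENNReal.ofReal (B * τ ^ (-(1 / 2) : ℝ)) ^ (3 / 4 : ℝ) *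
          ENNReal.ofReal (B * (h * τ ^ (-(3 / 2) : ℝ))) ^ (1 / 4 : ℝ) :=
          mul_le_mul' (ENNReal.rpow_le_rpow hD2 (by norm_num))
            (ENNReal.rpow_le_rpow hD3 (by norm_num))
      _ = _ := by
          rw [ENNReal.ofReal_rpow_of_pos (by positivity), ENNReal.ofReal_rpow_of_pos (by positivity),
            ← ENNReal.ofReal_mul (by positivity), ← ENNReal.ofReal_mul (by positivity)]
          congr 1
          rw [Real.mul_rpow hB0.le (by positivity), Real.mul_rpow hB0.le (by positivity),
            Real.mul_rpow hh.le (by positivity), ← Real.rpow_mul hτ.le, ← Real.rpow_mul hτ.le]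
          calc _ = (B ^ (3 / 4 : ℝ) * B ^ (1 / 4 : ℝ)) * (h ^ (1 / 4 : ℝ) *
                (τ ^ (-(1 / 2) * (3 / 4) : ℝ) * τ ^ (-(3 / 2) * (1 / 4) : ℝ))) := by ring
            _ = _ := by
                rw [← Real.rpow_add hB0, ← Real.rpow_add hτ]; norm_num

theorem integrable_gradOseenC (i j k : Fin 3) {τ : ℝ} (hτ : 0 < τ) :
    Integrable (gradOseenC i j k τ) := by
  obtain ⟨B, -, hB⟩ := exists_gradOseenC_le
  exact ⟨(stronglyMeasurable_gradOseenC i j k τ).aestronglyMeasurable,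
    (hB i j k τ hτ).1.trans_lt (ENNReal.mul_lt_top ENNReal.coe_lt_top ENNReal.ofReal_lt_top)⟩

/-- Fourier inversion at a point of continuity of the symbol. Away from the origin continuity is
immediate, and a single point does not matter in Plancherel's theorem. -/
theorem fourier_gradOseenC (i j k : Fin 3) {τ : ℝ} (hτ : 0 < τ) {ξ : E3} (hξ : ξ ≠ 0) :
    𝓕 (gradOseenC i j k τ) ξ = gradOseenSymbol i j k τ ξ := by
  have h1 : gradOseenC i j k τ = 𝓕⁻ (gradOseenSymbol i j k τ) :=
    funext fun x => (fourierInv_gradOseenSymbol i j k hτ x).symm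
  rw [h1]
  refine (integrable_gradOseenSymbol i j k hτ).fourier_fourierInv_eq ?_ ?_
  · have h2 : 𝓕 (gradOseenSymbol i j k τ) = fun x => gradOseenC i j k τ (-x) := by
      ext x
      rw [h1, Real.fourierInv_eq_fourier_neg, neg_neg]
    rw [h2]
    exact (integrable_gradOseenC i j k hτ).comp_neg
  · have hn : ‖ξ‖ ^ 2 ≠ 0 := by simpa using hξ
    unfold gradOseenSymbol
    fun_prop (disch := exact hn)

/-! ### The Duhamel operator and its majorant -/

/-- A scalar majorant of the kernel of `S(τ) ℙ div`. -/
noncomputable def oseenMajorant (τ : ℝ) (z : E3) : ℝ≥0∞ := ∑ i, ∑ j, ∑ k, ‖gradOseen i j k τ z‖ₑ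

/-- The majorant of the Duhamel operator, acting on nonnegative functions. -/
noncomputable def potential (f : ℝ → E3 → ℝ≥0∞) (t : ℝ) (x : E3) : ℝ≥0∞ :=
  ∫⁻ s in Ioo 0 t, lconv (oseenMajorant (t - s)) (f s) x

theorem measurable_oseenMajorant : Measurable (Function.uncurry oseenMajorant) := by
  have h : Function.uncurry oseenMajorant =
      fun z => ∑ i, ∑ j, ∑ k, ‖Function.uncurry (gradOseen i j k) z‖ₑ := rfl
  rw [h]
  refine Finset.measurable_fun_sum _ fun i _ => Finset.measurable_fun_sum _ fun j _ =>
    Finset.measurable_fun_sum _ fun k _ => (measurable_gradOseen i j k).enorm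

theorem enorm_gradOseen_le (i j k : Fin 3) {τ : ℝ} (hτ : 0 < τ) (x : E3) :
    ‖gradOseen i j k τ x‖ₑ ≤ ‖gradOseenC i j k τ x‖ₑ := by
  rw [gradOseen_eq i j k hτ, ← ofReal_norm, ← ofReal_norm]
  exact ENNReal.ofReal_le_ofReal (Complex.abs_re_le_norm _)

theorem exists_oseenMajorant_le : ∃ B : ℝ≥0, 0 < B ∧ ∀ τ : ℝ, 0 < τ →
    (∫⁻ z, oseenMajorant τ z ≤ B * ENNReal.ofReal (τ ^ (-(1 / 2 : ℝ)))) ∧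
    ∀ z, oseenMajorant τ z ≤ B * ENNReal.ofReal (τ ^ (-2 : ℝ)) := by
  obtain ⟨B, hB0, hB⟩ := exists_gradOseenC_le
  -- There are 27 = 3³ index triples, each contributing the same bound.
  have h27 : ∀ c : ℝ≥0∞, ∑ _i : Fin 3, ∑ _j : Fin 3, ∑ _k : Fin 3, (B : ℝ≥0∞) * c =
      ((27 * B : ℝ≥0) : ℝ≥0∞) * c := fun c => by
    simp only [Finset.sum_const, Finset.card_univ, Fintype.card_fin, nsmul_eq_mul]
    push_cast
    ring
  refine ⟨27 * B, by positivity, fun τ hτ => ⟨?_, fun z => ?_⟩⟩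
  · have hm : ∀ i j k, Measurable fun z => ‖gradOseen i j k τ z‖ₑ := fun i j k =>
      (measurable_gradOseen i j k).of_uncurry_left.enorm
    unfold oseenMajorant
    rw [lintegral_finsetSum _ fun i _ => Finset.measurable_fun_sum _ fun j _ =>
      Finset.measurable_fun_sum _ fun k _ => hm i j k, ← h27]
    refine Finset.sum_le_sum fun i _ => ?_
    rw [lintegral_finsetSum _ fun j _ => Finset.measurable_fun_sum _ fun k _ => hm i j k]
    refine Finset.sum_le_sum fun j _ => ?_
    rw [lintegral_finsetSum _ fun k _ => hm i j k]
    refine Finset.sum_le_sum fun k _ => ?_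
    exact (lintegral_mono fun z => enorm_gradOseen_le i j k hτ z).trans (hB i j k τ hτ).1
  · rw [← h27]
    refine Finset.sum_le_sum fun i _ => Finset.sum_le_sum fun j _ => Finset.sum_le_sum fun k _ => ?_
    exact (enorm_gradOseen_le i j k hτ z).trans ((hB i j k τ hτ).2.1 z)

theorem heatLerayDiv_apply (t : ℝ) (F : E3 → M33) (x : E3) (i : Fin 3) :
    heatLerayDiv t F x i = ∑ j, ∑ k, ∫ y, gradOseen i j k t (x - y) * F y (j, k) := rfl

theorem enorm_le_sum_E3 (v : E3) : ‖v‖ₑ ≤ ∑ i, ‖v i‖ₑ := by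
  have h : ‖v‖ ≤ ∑ i, ‖v i‖ := by
    rw [EuclideanSpace.norm_eq]
    refine Real.sqrt_le_iff.2 ⟨by positivity, ?_⟩
    exact Finset.sum_sq_le_sq_sum_of_nonneg fun i _ => norm_nonneg _
  rw [← ofReal_norm]
  refine (ENNReal.ofReal_le_ofReal h).trans ?_
  rw [ENNReal.ofReal_sum_of_nonneg fun i _ => norm_nonneg _]
  simp only [ofReal_norm, le_refl]

theorem enorm_apply_le {ι : Type*} [Fintype ι] (v : EuclideanSpace ℝ ι) (i : ι) :
    ‖v i‖ₑ ≤ ‖v‖ₑ := by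
  rw [← ofReal_norm, ← ofReal_norm]
  exact ENNReal.ofReal_le_ofReal (PiLp.norm_apply_le v i)

theorem measurable_gradOseen_sub (i j k : Fin 3) (τ : ℝ) (x : E3) :
    Measurable fun y => gradOseen i j k τ (x - y) :=
  (measurable_gradOseen i j k).of_uncurry_left.comp (measurable_const.sub measurable_id)

theorem measurable_coord_M33 (jk : Fin 3 × Fin 3) : Measurable fun A : M33 => A jk := by fun_prop

/-- The sum over `i` stays on the left because `oseenMajorant` already sums over all triples;
bounding each component separately would count it three times. -/
theorem sum_enorm_heatLerayDiv_le {F : E3 → M33} (hF : Measurable F) (τ : ℝ) (x : E3) :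
    ∑ i, ‖heatLerayDiv τ F x i‖ₑ ≤ lconv (oseenMajorant τ) (fun y => ‖F y‖ₑ) x := by
  have hm : ∀ i j k, Measurable fun y => ‖gradOseen i j k τ (x - y)‖ₑ * ‖F y‖ₑ := fun i j k =>
    (measurable_gradOseen_sub i j k τ x).enorm.mul hF.enorm
  simp only [lconv, oseenMajorant, Finset.sum_mul]
  rw [lintegral_finsetSum _ fun i _ => Finset.measurable_fun_sum _ fun j _ =>
      Finset.measurable_fun_sum _ fun k _ => hm i j k]
  refine Finset.sum_le_sum fun i _ => ?_
  rw [lintegral_finsetSum _ fun j _ => Finset.measurable_fun_sum _ fun k _ => hm i j k,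
    heatLerayDiv_apply]
  refine (enorm_sum_le _ _).trans (Finset.sum_le_sum fun j _ => ?_)
  rw [lintegral_finsetSum _ fun k _ => hm i j k]
  refine (enorm_sum_le _ _).trans (Finset.sum_le_sum fun k _ => ?_)
  refine (enorm_integral_le_lintegral_enorm _).trans (lintegral_mono fun y => ?_)
  rw [enorm_mul]
  gcongr
  exact enorm_apply_le _ _

theorem enorm_heatLerayDiv_le {F : E3 → M33} (hF : Measurable F) (τ : ℝ) (x : E3) (i : Fin 3) :
    ‖heatLerayDiv τ F x i‖ₑ ≤ lconv (oseenMajorant τ) (fun y => ‖F y‖ₑ) x :=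
  (Finset.single_le_sum (f := fun i => ‖heatLerayDiv τ F x i‖ₑ) (fun _ _ => zero_le)
    (Finset.mem_univ i)).trans (sum_enorm_heatLerayDiv_le hF τ x)

theorem integrable_gradOseen_mul {F : E3 → M33} (hF : Measurable F) {τ : ℝ} {x : E3}
    (h : lconv (oseenMajorant τ) (fun y => ‖F y‖ₑ) x < ⊤) (i j k : Fin 3) :
    Integrable fun y => gradOseen i j k τ (x - y) * F y (j, k) := by
  refine ⟨((measurable_gradOseen_sub i j k τ x).mul
    ((measurable_coord_M33 (j, k)).comp hF)).aestronglyMeasurable, lt_of_le_of_lt ?_ h⟩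
  refine lintegral_mono fun y => ?_
  rw [enorm_mul]
  gcongr
  · unfold oseenMajorant
    refine le_trans ?_ (Finset.single_le_sum (fun _ _ => zero_le) (Finset.mem_univ i))
    refine le_trans ?_ (Finset.single_le_sum (fun _ _ => zero_le) (Finset.mem_univ j))
    exact Finset.single_le_sum (f := fun k => ‖gradOseen i j k τ (x - y)‖ₑ)
      (fun _ _ => zero_le) (Finset.mem_univ k)
  · exact enorm_apply_le _ _

theorem measurable_heatLerayDiv {F : ℝ → E3 → M33} (hF : Measurable (Function.uncurry F))
    (i : Fin 3) :
    Measurable fun z : (ℝ × E3) × ℝ => heatLerayDiv (z.1.1 - z.2) (F z.2) z.1.2 i := by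
  simp only [heatLerayDiv_apply]
  refine Finset.measurable_fun_sum _ fun j _ => Finset.measurable_fun_sum _ fun k _ => ?_
  have h : Measurable fun w : ((ℝ × E3) × ℝ) × E3 =>
      gradOseen i j k (w.1.1.1 - w.1.2) (w.1.1.2 - w.2) * F w.1.2 w.2 (j, k) := by
    refine Measurable.mul ?_ ?_
    · exact (measurable_gradOseen i j k).comp
        (g := Function.uncurry (gradOseen i j k))
        (f := fun w : ((ℝ × E3) × ℝ) × E3 => (w.1.1.1 - w.1.2, w.1.1.2 - w.2)) (by fun_prop)
    · exact (measurable_coord_M33 (j, k)).comp (hF.comp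
        (f := fun w : ((ℝ × E3) × ℝ) × E3 => (w.1.2, w.2)) (by fun_prop))
  exact (h.stronglyMeasurable.integral_prod_right' (ν := volume)).measurable

theorem measurable_duhamel {F : ℝ → E3 → M33} (hF : Measurable (Function.uncurry F)) :
    Measurable (Function.uncurry (duhamel F)) := by
  have hc : ∀ i, Measurable fun z : ℝ × E3 =>
      ∫ s in (0 : ℝ)..z.1, heatLerayDiv (z.1 - s) (F s) z.2 i := fun i => by
    simp only [intervalIntegral]
    have hm := measurable_heatLerayDiv hF i
    -- The interval of integration moves with `z`. Viewed as a section of a measurable set it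
    -- becomes an indicator inside an integral over all of ℝ, to which measurability of parametric
    -- integrals applies.
    have aux : ∀ S : Set ((ℝ × E3) × ℝ), MeasurableSet S → Measurable fun z : ℝ × E3 =>
        ∫ s in {s | (z, s) ∈ S}, heatLerayDiv (z.1 - s) (F s) z.2 i := fun S hS => by
      have h := ((hm.indicator hS).stronglyMeasurable.integral_prod_right'
        (ν := volume)).measurable
      convert h using 2 with z
      exact (integral_indicator (measurable_prodMk_left hS)).symm
    refine Measurable.sub ?_ ?_
    · exact aux {w | 0 < w.2 ∧ w.2 ≤ w.1.1} (by measurability)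
    · exact aux {w | w.1.1 < w.2 ∧ w.2 ≤ 0} (by measurability)
  exact (WithLp.measurable_toLp 2 _).comp (measurable_pi_iff.2 hc)

theorem duhamel_apply_of_nonneg (F : ℝ → E3 → M33) {t : ℝ} (ht : 0 ≤ t) (x : E3) (i : Fin 3) :
    duhamel F t x i = ∫ s in Ioo 0 t, heatLerayDiv (t - s) (F s) x i := by
  rw [← integral_Ioc_eq_integral_Ioo, ← intervalIntegral.integral_of_le ht]
  rfl

theorem measurable_heatLerayDiv_time {F : ℝ → E3 → M33} (hF : Measurable (Function.uncurry F))
    (t : ℝ) (x : E3) (i : Fin 3) : Measurable fun s => heatLerayDiv (t - s) (F s) x i :=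
  (measurable_heatLerayDiv hF i).comp (f := fun s : ℝ => ((t, x), s)) (by fun_prop)

theorem enorm_duhamel_le {F : ℝ → E3 → M33} (hF : Measurable (Function.uncurry F)) {t : ℝ}
    (ht : 0 ≤ t) (x : E3) : ‖duhamel F t x‖ₑ ≤ potential (fun s y => ‖F s y‖ₑ) t x := by
  refine (enorm_le_sum_E3 _).trans ?_
  calc _ ≤ ∑ i, ∫⁻ s in Ioo 0 t, ‖heatLerayDiv (t - s) (F s) x i‖ₑ := by
        refine Finset.sum_le_sum fun i _ => ?_
        rw [duhamel_apply_of_nonneg F ht]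
        exact enorm_integral_le_lintegral_enorm _
    _ = ∫⁻ s in Ioo 0 t, ∑ i, ‖heatLerayDiv (t - s) (F s) x i‖ₑ := by
        rw [lintegral_finsetSum _ fun i _ => (measurable_heatLerayDiv_time hF t x i).enorm]
    _ ≤ _ := lintegral_mono fun s => sum_enorm_heatLerayDiv_le hF.of_uncurry_left _ _

theorem measurable_uncurry_lconv_oseenMajorant {f : ℝ → E3 → ℝ≥0∞}
    (hf : Measurable (Function.uncurry f)) (t : ℝ) :
    Measurable (Function.uncurry fun s x => lconv (oseenMajorant (t - s)) (f s) x) :=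
  measurable_uncurry_lconv (k := fun s => oseenMajorant (t - s))
    (measurable_oseenMajorant.comp (f := fun z : ℝ × E3 => (t - z.1, z.2)) (by fun_prop)) hf

theorem measurable_potential {f : ℝ → E3 → ℝ≥0∞} (hf : Measurable (Function.uncurry f)) (t : ℝ) :
    Measurable (potential f t) :=
  (measurable_uncurry_lconv_oseenMajorant hf t).lintegral_prod_left

theorem integrableOn_heatLerayDiv {F : ℝ → E3 → M33} (hF : Measurable (Function.uncurry F))
    {t : ℝ} {x : E3} (h : potential (fun s y => ‖F s y‖ₑ) t x < ⊤) (i : Fin 3) :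
    IntegrableOn (fun s => heatLerayDiv (t - s) (F s) x i) (Ioo 0 t) :=
  ⟨(measurable_heatLerayDiv_time hF t x i).aestronglyMeasurable, lt_of_le_of_lt
    (lintegral_mono fun _ => enorm_heatLerayDiv_le hF.of_uncurry_left _ _ _) h⟩

theorem ae_lconv_lt_top_of_potential {F : ℝ → E3 → M33} (hF : Measurable (Function.uncurry F))
    {t : ℝ} {x : E3} (h : potential (fun s y => ‖F s y‖ₑ) t x < ⊤) :
    ∀ᵐ s ∂volume.restrict (Ioo 0 t), lconv (oseenMajorant (t - s)) (fun y => ‖F s y‖ₑ) x < ⊤ :=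
  ae_lt_top (measurable_uncurry_lconv_oseenMajorant (f := fun s y => ‖F s y‖ₑ) hF.enorm t).of_uncurry_right h.ne

/-- Bochner integrals are additive only for integrable integrands. Finiteness of the two potentials
provides this both in time and, for almost every `s`, in space; in the applications it holds for
almost every `x`. -/
theorem duhamel_sub {F G : ℝ → E3 → M33} (hF : Measurable (Function.uncurry F))
    (hG : Measurable (Function.uncurry G)) {t : ℝ} (ht : 0 ≤ t) {x : E3}
    (h1 : potential (fun s y => ‖F s y‖ₑ) t x < ⊤) (h2 : potential (fun s y => ‖G s y‖ₑ) t x < ⊤) :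
    duhamel (F - G) t x = duhamel F t x - duhamel G t x := by
  ext i
  rw [PiLp.sub_apply, duhamel_apply_of_nonneg _ ht, duhamel_apply_of_nonneg _ ht,
    duhamel_apply_of_nonneg _ ht, ← integral_sub (integrableOn_heatLerayDiv hF h1 i)
      (integrableOn_heatLerayDiv hG h2 i)]
  refine integral_congr_ae ?_
  filter_upwards [ae_lconv_lt_top_of_potential hF h1, ae_lconv_lt_top_of_potential hG h2]
    with s h3 h4
  simp only [heatLerayDiv_apply, ← Finset.sum_sub_distrib]
  refine Finset.sum_congr rfl fun j _ => Finset.sum_congr rfl fun k _ => ?_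
  rw [← integral_sub (integrable_gradOseen_mul hF.of_uncurry_left h3 i j k)
    (integrable_gradOseen_mul hG.of_uncurry_left h4 i j k)]
  refine integral_congr_ae (ae_of_all _ fun y => ?_)
  simp only [Pi.sub_apply, PiLp.sub_apply]
  ring

theorem duhamel_zero : duhamel 0 = 0 := by
  ext t x i
  simp [duhamel, heatLerayDiv]

/-- The Duhamel operator maps `ℱ_q` to `𝒦_r`. -/
theorem exists_lnorm_potential_kato_le {q r : ℝ} (hq : 3 / 2 ≤ q) (hqr : q ≤ r)
    (hδ : 1 / q - 1 / r < 1 / 3) : ∃ C : ℝ≥0, 0 < C ∧ ∀ (M : ℝ≥0) (_ : 0 < M)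
      (f : ℝ → E3 → ℝ≥0∞) (_ : Measurable (Function.uncurry f)) (T : ℝ)
      (_ : ∀ᵐ s ∂volume.restrict (Ioo 0 T),
        lnorm q (f s) ≤ M * ENNReal.ofReal (s ^ (-(1 - 3 / (2 * q))))),
      ∀ t, 0 < t → t ≤ T →
        lnorm r (potential f t) ≤ C * M * ENNReal.ofReal (t ^ (-(1 / 2 - 3 / (2 * r)))) := by
  have hq0 : 0 < q := by linarith
  obtain ⟨B, hB0, hB⟩ := exists_oseenMajorant_le
  -- The assumption q ≥ 3/2 makes the decay rate 1 - 3/(2q) nonnegative; it is below 1 in any case.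
  have hα : 3 / (2 * q) ≤ 1 := by rw [div_le_one (by positivity)]; linarith
  have hα' : 0 < 3 / (2 * q) := by positivity
  obtain ⟨C, hC⟩ := exists_lnorm_potential_le (q := q) (r := r) (α := 1 - 3 / (2 * q))
    (by linarith) hqr hδ (by linarith) (by linarith)
  -- The `+ 1` only secures positivity of the constant.
  refine ⟨(C + 1) * B, by positivity, fun M hM f hf T h t ht htT => ?_⟩
  have h' := ae_restrict_of_ae_restrict_of_subset (Ioo_subset_Ioo_right htT) h
  refine (hC B M hB0 hM oseenMajorant f measurable_oseenMajorant hf (fun τ hτ => (hB τ hτ).1)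
    (fun τ hτ => (hB τ hτ).2) t ht h').trans ?_
  have he : 1 / 2 - 3 / 2 * (1 / q - 1 / r) - (1 - 3 / (2 * q)) = -(1 / 2 - 3 / (2 * r)) := by
    have : 0 < r := by linarith
    field_simp
    ring
  rw [he]
  push_cast
  gcongr
  exact le_self_add

/-! ### Picard iterates in Kato spaces -/

section Bounds

variable {V : Type*} [NormedAddCommGroup V]

/-- The bound `‖u(t)‖_{L^q} ≤ M t^{-α}`, `1/q = a`, for almost every `t ∈ ]0,T[`. -/
def DecayBound (a α : ℝ) (M : ℝ≥0) (T : ℝ) (u : ℝ → E3 → V) : Prop :=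
  ∀ᵐ s ∂volume.restrict (Ioo 0 T),
    lnorm (1 / a) (fun x => ‖u s x‖ₑ) ≤ M * ENNReal.ofReal (s ^ (-α))

/-- The bound of `𝒦_q`, `1/q = a`. -/
abbrev KBound (a : ℝ) (M : ℝ≥0) (T : ℝ) (u : ℝ → E3 → V) : Prop :=
  DecayBound a (1 / 2 - 3 / 2 * a) M T u

/-- The bound of `ℱ_q`, `1/q = a`. -/
abbrev FBound (a : ℝ) (M : ℝ≥0) (T : ℝ) (u : ℝ → E3 → V) : Prop :=
  DecayBound a (1 - 3 / 2 * a) M T u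

theorem DecayBound.mono {a α : ℝ} {M N : ℝ≥0} {T : ℝ} {u : ℝ → E3 → V} (h : DecayBound a α M T u)
    (hMN : M ≤ N) : DecayBound a α N T u := by
  filter_upwards [h] with s hs
  refine hs.trans ?_
  gcongr

theorem DecayBound.of_le {W : Type*} [NormedAddCommGroup W] {a α : ℝ} (ha : 0 < a) {M : ℝ≥0} {T : ℝ}
    {u : ℝ → E3 → V} {v : ℝ → E3 → W} (h : DecayBound a α M T u)
    (hle : ∀ᵐ s ∂volume.restrict (Ioo 0 T), ∀ᵐ x, ‖v s x‖ₑ ≤ ‖u s x‖ₑ) :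
    DecayBound a α M T v := by
  filter_upwards [h, hle] with s hs hs'
  exact (lnorm_mono (by positivity) hs').trans hs

theorem DecayBound.add {a α : ℝ} (ha : 0 < a) (ha1 : a ≤ 1) {M N : ℝ≥0} {T : ℝ}
    [MeasurableSpace V] [BorelSpace V]
    {u v : ℝ → E3 → V} (hu : Measurable (Function.uncurry u))
    (hv : Measurable (Function.uncurry v))
    (h1 : DecayBound a α M T u) (h2 : DecayBound a α N T v) : DecayBound a α (M + N) T (u + v) := by
  filter_upwards [h1, h2] with s hs hs'
  calc _ ≤ lnorm (1 / a) ((fun x => ‖u s x‖ₑ) + fun x => ‖v s x‖ₑ) :=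
        lnorm_mono (by positivity) (ae_of_all _ fun x => enorm_add_le _ _)
    _ ≤ _ := lnorm_add_le (by rwa [le_div_iff₀ ha, one_mul]) hu.of_uncurry_left.enorm
        hv.of_uncurry_left.enorm
    _ ≤ _ := add_le_add hs hs'
    _ = _ := by push_cast; ring

theorem DecayBound.neg {a α : ℝ} {M : ℝ≥0} {T : ℝ} {u : ℝ → E3 → V} (h : DecayBound a α M T u) :
    DecayBound a α M T (-u) := by
  simpa [DecayBound] using h

theorem DecayBound.zero {a α : ℝ} (ha : 0 < a) (M : ℝ≥0) (T : ℝ) :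
    DecayBound a α M T (0 : ℝ → E3 → V) := by
  refine ae_of_all _ fun s => ?_
  have : lnorm (1 / a) (fun x => ‖(0 : ℝ → E3 → V) s x‖ₑ) = 0 := by
    simp [lnorm, ha]
  rw [this]
  exact zero_le

end Bounds

theorem norm_tensor (U V : ℝ → E3 → E3) (t : ℝ) (x : E3) :
    ‖tensor U V t x‖ = ‖U t x‖ * ‖V t x‖ := by
  rw [EuclideanSpace.norm_eq, EuclideanSpace.norm_eq, EuclideanSpace.norm_eq,
    ← Real.sqrt_mul (by positivity)]
  congr 1
  rw [Finset.sum_mul_sum, ← Finset.univ_product_univ, Finset.sum_product]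
  simp [tensor, mul_pow]

theorem enorm_tensor (U V : ℝ → E3 → E3) (t : ℝ) (x : E3) :
    ‖tensor U V t x‖ₑ = ‖U t x‖ₑ * ‖V t x‖ₑ := by
  rw [← ofReal_norm, norm_tensor, ENNReal.ofReal_mul (norm_nonneg _), ofReal_norm, ofReal_norm]

theorem measurable_tensor {U V : ℝ → E3 → E3} (hU : Measurable (Function.uncurry U))
    (hV : Measurable (Function.uncurry V)) : Measurable (Function.uncurry (tensor U V)) := by
  refine (WithLp.measurable_toLp 2 _).comp (measurable_pi_iff.2 fun ij => ?_)
  have h1 : ∀ i, Measurable fun v : E3 => v i := fun i => by fun_prop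
  exact ((h1 ij.1).comp hU).mul ((h1 ij.2).comp hV)

/-- Hölder's inequality in terms of reciprocal exponents, which simply add. This is the reason for
indexing the bounds by a = 1/q. -/
theorem lnorm_mul_le {a b : ℝ} (ha : 0 < a) (hb : 0 < b) {f g : E3 → ℝ≥0∞} (hf : Measurable f)
    (hg : Measurable g) :
    lnorm (1 / (a + b)) (fun x => f x * g x) ≤ lnorm (1 / a) f * lnorm (1 / b) g := by
  refine ENNReal.lintegral_Lp_mul_le_Lq_mul_Lr (p := 1 / (a + b)) (q := 1 / a) (r := 1 / b)
    (by positivity) ?_ (by simp) volume hf.aemeasurable hg.aemeasurable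
  exact one_div_lt_one_div_of_lt ha (by linarith)

/-- The decay rates are compatible with Hölder's inequality: (1/2 - 3a/2) + (1/2 - 3b/2) = 1 - 3(a +
b)/2. -/
theorem FBound_tensor {a b : ℝ} (ha : 0 < a) (hb : 0 < b) {M N : ℝ≥0} {T : ℝ}
    {U V : ℝ → E3 → E3} (hU : Measurable (Function.uncurry U))
    (hV : Measurable (Function.uncurry V)) (h1 : KBound a M T U) (h2 : KBound b N T V) :
    FBound (a + b) (M * N) T (tensor U V) := by
  filter_upwards [h1, h2, ae_restrict_mem measurableSet_Ioo] with s hs hs' hs0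
  have hs0 : 0 < s := hs0.1
  simp only [enorm_tensor]
  refine (lnorm_mul_le ha hb hU.of_uncurry_left.enorm hV.of_uncurry_left.enorm).trans ?_
  refine (mul_le_mul' hs hs').trans (le_of_eq ?_)
  have : ENNReal.ofReal (s ^ (-(1 - 3 / 2 * (a + b)))) =
      ENNReal.ofReal (s ^ (-(1 / 2 - 3 / 2 * a))) * ENNReal.ofReal (s ^ (-(1 / 2 - 3 / 2 * b))) := by
    rw [← ENNReal.ofReal_mul (by positivity), ← Real.rpow_add hs0]
    congr 2
    ring
  rw [this]
  push_cast
  ring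

/-- `L` maps `ℱ_{1/b}` to `𝒦_{1/b'}`. -/
theorem exists_lnorm_potential_le_of_FBound {b b' : ℝ} (hb' : 0 < b') (hbb : b' ≤ b)
    (hb : b ≤ 2 / 3) (hδ : b - b' < 1 / 3) : ∃ C : ℝ≥0, 0 < C ∧ ∀ (M : ℝ≥0) (_ : 0 < M)
      (F : ℝ → E3 → M33) (_ : Measurable (Function.uncurry F)) (T : ℝ) (_ : FBound b M T F),
      ∀ t, 0 < t → t ≤ T → lnorm (1 / b') (potential (fun s y => ‖F s y‖ₑ) t) ≤
        (C * M : ℝ≥0) * ENNReal.ofReal (t ^ (-(1 / 2 - 3 / 2 * b'))) := by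
  have hb0 : 0 < b := hb'.trans_le hbb
  obtain ⟨C, hC0, hC⟩ := exists_lnorm_potential_kato_le (q := 1 / b) (r := 1 / b')
    (by rw [le_div_iff₀ hb0]; linarith) (one_div_le_one_div_of_le hb' hbb)
    (by rwa [one_div_one_div, one_div_one_div])
  refine ⟨C, hC0, fun M hM F hF T h t ht htT => ?_⟩
  have e1 : ∀ c : ℝ, 3 / (2 * (1 / c)) = 3 / 2 * c := fun c => by
    rw [mul_one_div, div_div_eq_mul_div]; ring
  simp only [e1] at hC
  push_cast
  exact hC M hM (fun s y => ‖F s y‖ₑ) hF.enorm T h t ht htT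

theorem measurable_bilinearTerm {U V : ℝ → E3 → E3} (hU : Measurable (Function.uncurry U))
    (hV : Measurable (Function.uncurry V)) : Measurable (Function.uncurry (bilinearTerm U V)) :=
  measurable_duhamel (measurable_tensor hU hV)

theorem measurable_picard {P₀ : ℝ → E3 → E3} (h : Measurable (Function.uncurry P₀)) (k : ℕ) :
    Measurable (Function.uncurry (picard P₀ k)) := by
  induction k with
  | zero => exact h
  | succ k ih => exact h.sub (measurable_bilinearTerm ih ih)

theorem measurable_picardPred {P₀ : ℝ → E3 → E3} (h : Measurable (Function.uncurry P₀)) (k : ℕ) :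
    Measurable (Function.uncurry (picardPred P₀ k)) := by
  cases k with
  | zero => exact measurable_const
  | succ k => exact measurable_picard h k

theorem measurable_picardForcing {P₀ : ℝ → E3 → E3} (h : Measurable (Function.uncurry P₀))
    (k : ℕ) : Measurable (Function.uncurry (picardForcing P₀ k)) :=
  (measurable_tensor (measurable_picard h k) (measurable_picard h k)).sub
    (measurable_tensor (measurable_picardPred h k) (measurable_picardPred h k))

theorem tensor_zero : tensor 0 0 = 0 := by
  ext t x i
  simp [tensor]

/-- The common term P₀ cancels. The convention P_{-1} = 0 makes the formula valid for k = 0 as well.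
-/
theorem picard_succ_sub (P₀ : ℝ → E3 → E3) (k : ℕ) :
    picard P₀ (k + 1) - picard P₀ k =
      duhamel (tensor (picardPred P₀ k) (picardPred P₀ k)) -
        duhamel (tensor (picard P₀ k) (picard P₀ k)) := by
  cases k with
  | zero =>
    simp only [picard, picardPred, bilinearTerm, tensor_zero, duhamel_zero]
    abel
  | succ k =>
    simp only [picard, picardPred, bilinearTerm]
    abel

/-- Polarization: every term on the right contains an increment, so the forcing inherits the better
integrability of the increments. -/
theorem picardForcing_eq (P₀ : ℝ → E3 → E3) (k : ℕ) :
    picardForcing P₀ k = tensor (picard P₀ k - picardPred P₀ k) (picard P₀ k) +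
      tensor (picardPred P₀ k) (picard P₀ k - picardPred P₀ k) := by
  ext t x ij
  simp only [picardForcing, tensor, Pi.sub_apply, Pi.add_apply, PiLp.sub_apply, PiLp.add_apply]
  ring

theorem ae_lt_top_of_lnorm {q : ℝ} (hq : 0 < q) {f : E3 → ℝ≥0∞} (hf : Measurable f)
    (h : lnorm q f < ⊤) : ∀ᵐ x, f x < ⊤ := by
  have h1 : ∫⁻ x, f x ^ q < ⊤ := by
    rw [← lnorm_rpow hq]
    exact ENNReal.rpow_lt_top_of_nonneg hq.le h.ne
  filter_upwards [ae_lt_top (hf.pow_const q) h1.ne] with x hx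
  exact (ENNReal.rpow_lt_top_iff_of_pos hq).1 hx

/-- L takes index 2/p to index 1/p, so the majorant of L(U ⊗ U) is in L^p at every time. Its
finiteness almost everywhere is what allows Duhamel integrals to be subtracted. -/
theorem ae_potential_tensor_lt_top {p : ℝ} (hp : 4 ≤ p) {U : ℝ → E3 → E3}
    (hU : Measurable (Function.uncurry U)) {C : ℝ≥0} {T : ℝ} (h : KBound (1 / p) C T U) {t : ℝ}
    (ht : 0 < t) (htT : t ≤ T) : ∀ᵐ x, potential (fun s y => ‖tensor U U s y‖ₑ) t x < ⊤ := by
  have hp0 : 0 < 1 / p := by positivity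
  have hp4 : 1 / p ≤ 1 / 4 := one_div_le_one_div_of_le (by norm_num) hp
  obtain ⟨B, -, hB⟩ := exists_lnorm_potential_le_of_FBound (b := 1 / p + 1 / p) (b' := 1 / p)
    hp0 (by linarith) (by linarith) (by linarith)
  have h' := h.mono (N := C + 1) (by simp)
  have := hB ((C + 1) * (C + 1)) (by positivity) _ (measurable_tensor hU hU) T
    (FBound_tensor hp0 hp0 hU hU h' h') t ht htT
  refine ae_lt_top_of_lnorm (by positivity)
    (measurable_potential (f := fun s y => ‖tensor U U s y‖ₑ) (measurable_tensor hU hU).enorm t)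
    (this.trans_lt ?_)
  exact ENNReal.mul_lt_top ENNReal.coe_lt_top ENNReal.ofReal_lt_top

/-- The increments of the Picard iteration solve the Stokes system with forcing `- div F_k`. -/
theorem picard_succ_sub_ae {p : ℝ} (hp : 4 ≤ p) {P₀ : ℝ → E3 → E3}
    (h : Measurable (Function.uncurry P₀)) {k : ℕ} {C : ℝ≥0} {T : ℝ}
    (h1 : KBound (1 / p) C T (picard P₀ k)) (h2 : KBound (1 / p) C T (picardPred P₀ k)) {t : ℝ}
    (ht : 0 < t) (htT : t ≤ T) :
    ∀ᵐ x, (picard P₀ (k + 1) - picard P₀ k) t x = -duhamel (picardForcing P₀ k) t x := by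
  have m1 := measurable_picard h k
  have m2 := measurable_picardPred h k
  filter_upwards [ae_potential_tensor_lt_top hp m1 h1 ht htT,
    ae_potential_tensor_lt_top hp m2 h2 ht htT] with x hx1 hx2
  rw [picardForcing, duhamel_sub (measurable_tensor m1 m1) (measurable_tensor m2 m2) ht.le hx1 hx2,
    picard_succ_sub]
  simp

/-! ### The gain of integrability along the iteration. -/

/-- The integrability exponents of the increments. -/
noncomputable def incrementExponent (p : ℝ) (k : ℕ) : ℝ := min ((k + 1) / p) (1 / 2 - 1 / p)

/-- The cap 1/2 - 1/p is at least 1/p exactly when p ≥ 4. This is why smaller exponents are first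
raised to 4. -/
theorem one_div_le_incrementExponent {p : ℝ} (hp : 4 ≤ p) (k : ℕ) :
    1 / p ≤ incrementExponent p k := by
  have hp4 : 1 / p ≤ 1 / 4 := one_div_le_one_div_of_le (by norm_num) hp
  refine le_min ?_ (by linarith)
  gcongr
  simp

/-- Hölder's inequality in the two terms of `picardForcing_eq`, each the product of an increment and
an iterate. The cap in `incrementExponent` keeps the resulting index at most 1/2. -/
theorem FBound_picardForcing {p : ℝ} (hp : 4 ≤ p) {P₀ : ℝ → E3 → E3}
    (h : Measurable (Function.uncurry P₀)) {k : ℕ} {C : ℝ≥0} {T : ℝ}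
    (h1 : KBound (1 / p) C T (picard P₀ k)) (h2 : KBound (1 / p) C T (picardPred P₀ k))
    (h3 : KBound (incrementExponent p k) C T (picard P₀ k - picardPred P₀ k)) :
    FBound (incrementExponent p k + 1 / p) (C * C + C * C) T (picardForcing P₀ k) := by
  have hp0 : 0 < 1 / p := by positivity
  have ha := one_div_le_incrementExponent hp k
  have ha1 : incrementExponent p k ≤ 1 / 2 - 1 / p := min_le_right _ _
  have m1 := measurable_picard h k
  have m2 := measurable_picardPred h k
  have m3 : Measurable (Function.uncurry (picard P₀ k - picardPred P₀ k)) := m1.sub m2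
  have h4 := FBound_tensor (by linarith) hp0 m3 m1 h3 h1
  have h5 := FBound_tensor hp0 (by linarith) m2 m3 h2 h3
  rw [add_comm (1 / p)] at h5
  rw [picardForcing_eq]
  exact h4.add (by linarith) (by linarith) (measurable_tensor m3 m1) (measurable_tensor m2 m3) h5

/-- Induction on k with two uses of L: on P_k ⊗ P_k, from index 2/p to 1/p, which keeps the iterates
in 𝒦_p, and on F_k, which moves the increment to its next index. Scale invariance makes the constant
independent of T. -/
theorem exists_picard_bounds {p : ℝ} (hp : 4 ≤ p) (M : ℝ≥0) (k : ℕ) : ∃ C : ℝ≥0, 0 < C ∧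
    ∀ (T : ℝ) (P₀ : ℝ → E3 → E3), Measurable (Function.uncurry P₀) → KBound (1 / p) M T P₀ →
      KBound (1 / p) C T (picard P₀ k) ∧ KBound (1 / p) C T (picardPred P₀ k) ∧
      KBound (incrementExponent p k) C T (picard P₀ k - picardPred P₀ k) := by
  have hp0 : 0 < 1 / p := by positivity
  have hp4 : 1 / p ≤ 1 / 4 := one_div_le_one_div_of_le (by norm_num) hp
  induction k with
  | zero =>
    refine ⟨M + 1, by positivity, fun T P₀ hm h => ?_⟩
    have h' := h.mono (N := M + 1) (by simp)
    refine ⟨h', DecayBound.zero hp0 _ _, ?_⟩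
    have he : incrementExponent p 0 = 1 / p := by
      rw [incrementExponent, min_eq_left (by simp at *; linarith)]; simp
    rw [he]
    have h0 : picard P₀ 0 - picardPred P₀ 0 = P₀ := sub_zero P₀
    rwa [h0]
  | succ k ih =>
    obtain ⟨C, hC0, hC⟩ := ih
    have ha := one_div_le_incrementExponent hp k
    have ha' := one_div_le_incrementExponent hp (k + 1)
    have ha1 : incrementExponent p k ≤ 1 / 2 - 1 / p := min_le_right _ _
    -- L may only lower the index, hence this upper bound. Monotonicity of the exponent in k, shown
    -- next, limits the loss to at most 1/p ≤ 1/4, below the admissible 1/3.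
    have hstep : incrementExponent p (k + 1) ≤ incrementExponent p k + 1 / p := by
      simp only [incrementExponent, ← min_add_add_right]
      refine min_le_min (le_of_eq ?_) (by linarith)
      push_cast
      ring
    have hstep' : incrementExponent p k ≤ incrementExponent p (k + 1) := by
      refine min_le_min ?_ le_rfl
      gcongr
      simp
    obtain ⟨B, hB0, hB⟩ := exists_lnorm_potential_le_of_FBound (b := 1 / p + 1 / p) (b' := 1 / p)
      hp0 (by linarith) (by linarith) (by linarith)
    obtain ⟨A, hA0, hA⟩ := exists_lnorm_potential_le_of_FBound
      (b := incrementExponent p k + 1 / p) (b' := incrementExponent p (k + 1))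
      (by linarith) hstep (by linarith) (by linarith)
    set C' : ℝ≥0 := C + (M + B * (C * C)) + A * (C * C + C * C) with hC'
    refine ⟨C', by positivity, fun T P₀ hm h => ?_⟩
    obtain ⟨h1, h2, h3⟩ := hC T P₀ hm h
    have m1 := measurable_picard hm k
    refine ⟨?_, h1.mono ?_, ?_⟩
    · have hB' : KBound (1 / p) (B * (C * C)) T (bilinearTerm (picard P₀ k) (picard P₀ k)) := by
        filter_upwards [ae_restrict_mem measurableSet_Ioo] with t ht
        refine (lnorm_mono (by positivity) (ae_of_all _ fun x =>
          enorm_duhamel_le (measurable_tensor m1 m1) ht.1.le x)).trans ?_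
        exact hB (C * C) (by positivity) _ (measurable_tensor m1 m1) T
          (FBound_tensor hp0 hp0 m1 m1 h1 h1) t ht.1 ht.2.le
      have := h.add (v := -bilinearTerm (picard P₀ k) (picard P₀ k)) hp0 (by linarith) hm
        (measurable_bilinearTerm m1 m1).neg hB'.neg
      rw [← sub_eq_add_neg] at this
      refine this.mono ?_
      rw [hC']
      calc M + B * (C * C) ≤ C + (M + B * (C * C)) := le_add_self
        _ ≤ _ := le_self_add
    · rw [hC', add_assoc]
      exact le_self_add
    · have hF := FBound_picardForcing hp hm h1 h2 h3
      have : KBound (incrementExponent p (k + 1)) (A * (C * C + C * C)) T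
          (picard P₀ (k + 1) - picardPred P₀ (k + 1)) := by
        filter_upwards [ae_restrict_mem measurableSet_Ioo] with t ht
        refine le_trans (lnorm_mono (by have : 0 < incrementExponent p (k + 1) := by linarith
                                        positivity) ?_)
          (hA _ (by positivity) _ (measurable_picardForcing hm k) T hF t ht.1 ht.2.le)
        filter_upwards [picard_succ_sub_ae hp hm h1 h2 ht.1 ht.2.le] with x hx
        change ‖(picard P₀ (k + 1) - picard P₀ k) t x‖ₑ ≤ _
        rw [hx, enorm_neg]
        exact enorm_duhamel_le (measurable_picardForcing hm k) ht.1.le x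
      exact this.mono le_add_self

/-! ### Continuity of the Duhamel term with values in `L²` -/

theorem lnorm_lconv_le_mul {k f : E3 → ℝ≥0∞} (hk : Measurable k) (hf : Measurable f)
    {A : ℝ≥0∞} (hA : ∫⁻ x, k x ≤ A) {q : ℝ} (hq : 1 ≤ q) : lnorm q (lconv k f) ≤ A * lnorm q f := by
  have hq0 : 0 < q := by linarith
  refine (ENNReal.rpow_le_rpow (lintegral_lconv_rpow_le hk hf hA hq)
    (by positivity : 0 ≤ 1 / q)).trans (le_of_eq ?_)
  rw [ENNReal.mul_rpow_of_nonneg _ _ (by positivity), ← ENNReal.rpow_mul,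
    mul_one_div_cancel hq0.ne', ENNReal.rpow_one, lnorm]

/-- The majorant of the increment of the Duhamel kernel between the times `t < t'`. -/
noncomputable def incrementKernel (t t' s : ℝ) (z : E3) : ℝ≥0∞ :=
  ∑ i, ∑ j, ∑ k, ‖gradOseen i j k (t' - s) z - (Iio t).indicator (fun _ => gradOseen i j k (t - s) z) s‖ₑ

theorem measurable_incrementKernel_entry (i j k : Fin 3) (t t' : ℝ) :
    Measurable (Function.uncurry fun (s : ℝ) (z : E3) => gradOseen i j k (t' - s) z -
      (Iio t).indicator (fun _ => gradOseen i j k (t - s) z) s) := by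
  have h : ∀ c : ℝ, Measurable fun z : ℝ × E3 => gradOseen i j k (c - z.1) z.2 := fun c =>
    (measurable_gradOseen i j k).comp (f := fun z : ℝ × E3 => (c - z.1, z.2)) (by fun_prop)
  refine (h t').sub ?_
  have h2 := (h t).indicator (s := {z : ℝ × E3 | z.1 < t})
    (measurableSet_lt measurable_fst measurable_const)
  exact h2

theorem measurable_incrementKernel (t t' : ℝ) :
    Measurable (Function.uncurry (incrementKernel t t')) := by
  have h : Function.uncurry (incrementKernel t t') = fun z => ∑ i, ∑ j, ∑ k,
      ‖Function.uncurry (fun (s : ℝ) (z : E3) => gradOseen i j k (t' - s) z -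
        (Iio t).indicator (fun _ => gradOseen i j k (t - s) z) s) z‖ₑ := rfl
  rw [h]
  exact Finset.measurable_fun_sum _ fun i _ => Finset.measurable_fun_sum _ fun j _ =>
    Finset.measurable_fun_sum _ fun k _ => (measurable_incrementKernel_entry i j k t t').enorm

/-- For s < t both kernels are present and the time modulus of continuity applies with step t' - t.
For s ≥ t only the later kernel remains and its L¹ norm is enough. -/
theorem exists_lintegral_incrementKernel_le : ∃ B : ℝ≥0, 0 < B ∧ ∀ t t' s : ℝ, t < t' → s < t' →
    ∫⁻ z, incrementKernel t t' s z ≤ B * if s < t then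
      ENNReal.ofReal ((t' - t) ^ (1 / 4 : ℝ) * (t - s) ^ (-(3 / 4) : ℝ))
      else ENNReal.ofReal ((t' - s) ^ (-(1 / 2) : ℝ)) := by
  obtain ⟨B, hB0, hB⟩ := exists_gradOseenC_le
  have h27 : ∀ c : ℝ≥0∞, ∑ _i : Fin 3, ∑ _j : Fin 3, ∑ _k : Fin 3, (B : ℝ≥0∞) * c =
      ((27 * B : ℝ≥0) : ℝ≥0∞) * c := fun c => by
    simp only [Finset.sum_const, Finset.card_univ, Fintype.card_fin, nsmul_eq_mul]
    push_cast
    ring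
  refine ⟨27 * B, by positivity, fun t t' s htt hs => ?_⟩
  have hm : ∀ i j k, Measurable fun z => ‖gradOseen i j k (t' - s) z -
      (Iio t).indicator (fun _ => gradOseen i j k (t - s) z) s‖ₑ := fun i j k =>
    (measurable_incrementKernel_entry i j k t t').of_uncurry_left.enorm
  unfold incrementKernel
  rw [lintegral_finsetSum _ fun i _ => Finset.measurable_fun_sum _ fun j _ =>
    Finset.measurable_fun_sum _ fun k _ => hm i j k, ← h27]
  refine Finset.sum_le_sum fun i _ => ?_
  rw [lintegral_finsetSum _ fun j _ => Finset.measurable_fun_sum _ fun k _ => hm i j k]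
  refine Finset.sum_le_sum fun j _ => ?_
  rw [lintegral_finsetSum _ fun k _ => hm i j k]
  refine Finset.sum_le_sum fun k _ => ?_
  split_ifs with hst
  · have h1 : 0 < t - s := sub_pos.2 hst
    have h2 := (hB i j k (t - s) h1).2.2 (t' - t) (sub_pos.2 htt)
    rw [show t - s + (t' - t) = t' - s by ring] at h2
    refine le_trans (lintegral_mono fun z => ?_) h2
    rw [indicator_of_mem (mem_Iio.2 hst), gradOseen_eq i j k (sub_pos.2 hs),
      gradOseen_eq i j k h1, ← Complex.sub_re, ← ofReal_norm, ← ofReal_norm]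
    exact ENNReal.ofReal_le_ofReal (Complex.abs_re_le_norm _)
  · refine le_trans (lintegral_mono fun z => ?_) (hB i j k (t' - s) (sub_pos.2 hs)).1
    rw [indicator_of_notMem (by simpa using hst), sub_zero]
    exact enorm_gradOseen_le i j k (sub_pos.2 hs) z

/-- Extending the kernel at time t by zero to s ≥ t puts both Duhamel integrals on ]0,t'[. The
finite potentials then permit subtraction under the integral signs. -/
theorem enorm_duhamel_sub_le {F : ℝ → E3 → M33} (hF : Measurable (Function.uncurry F)) {t t' : ℝ}
    (ht : 0 ≤ t) (htt : t < t') {x : E3} (h1 : potential (fun s y => ‖F s y‖ₑ) t x < ⊤)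
    (h2 : potential (fun s y => ‖F s y‖ₑ) t' x < ⊤) :
    ‖duhamel F t' x - duhamel F t x‖ₑ ≤
      ∫⁻ s in Ioo 0 t', lconv (incrementKernel t t' s) (fun y => ‖F s y‖ₑ) x := by
  have hset : Ioo 0 t' ∩ Iio t = Ioo 0 t := by
    ext s; simp only [mem_inter_iff, mem_Ioo, mem_Iio]
    exact ⟨fun h => ⟨h.1.1, h.2⟩, fun h => ⟨⟨h.1, h.2.trans htt⟩, h.2⟩⟩
  have hcomp : ∀ i, (duhamel F t' x - duhamel F t x) i = ∫ s in Ioo 0 t',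
      (heatLerayDiv (t' - s) (F s) x i -
        (Iio t).indicator (fun s => heatLerayDiv (t - s) (F s) x i) s) := fun i => by
    rw [integral_sub (integrableOn_heatLerayDiv hF h2 i), setIntegral_indicator measurableSet_Iio,
      hset, PiLp.sub_apply, duhamel_apply_of_nonneg F (ht.trans htt.le),
      duhamel_apply_of_nonneg F ht]
    rw [integrable_indicator_iff measurableSet_Iio, IntegrableOn, Measure.restrict_restrict
      measurableSet_Iio, inter_comm, hset]
    exact integrableOn_heatLerayDiv hF h1 i
  have hae : ∀ᵐ s ∂volume.restrict (Ioo 0 t'), s < t →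
      lconv (oseenMajorant (t - s)) (fun y => ‖F s y‖ₑ) x < ⊤ := by
    have h3 := ae_lconv_lt_top_of_potential hF h1
    rw [← hset, inter_comm, ← Measure.restrict_restrict measurableSet_Iio,
      ae_restrict_iff' measurableSet_Iio] at h3
    exact h3
  have hm0 : ∀ i, Measurable fun s => (heatLerayDiv (t' - s) (F s) x i -
        (Iio t).indicator (fun s => heatLerayDiv (t - s) (F s) x i) s) := fun i =>
    (measurable_heatLerayDiv_time hF t' x i).sub
      ((measurable_heatLerayDiv_time hF t x i).indicator measurableSet_Iio)
  refine (enorm_le_sum_E3 _).trans ?_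
  calc _ ≤ ∑ i, ∫⁻ s in Ioo 0 t', ‖heatLerayDiv (t' - s) (F s) x i -
        (Iio t).indicator (fun s => heatLerayDiv (t - s) (F s) x i) s‖ₑ := by
        refine Finset.sum_le_sum fun i _ => ?_
        rw [hcomp]
        exact enorm_integral_le_lintegral_enorm _
    _ = ∫⁻ s in Ioo 0 t', ∑ i, ‖heatLerayDiv (t' - s) (F s) x i -
        (Iio t).indicator (fun s => heatLerayDiv (t - s) (F s) x i) s‖ₑ := by
        rw [lintegral_finsetSum _ fun i _ => (hm0 i).enorm]
    _ ≤ _ := by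
        refine lintegral_mono_ae ?_
        filter_upwards [ae_lconv_lt_top_of_potential hF h2, hae] with s h3 h4
        have hFs : Measurable (F s) := hF.of_uncurry_left
        have hm : ∀ i j k, Measurable fun y => ‖gradOseen i j k (t' - s) (x - y) -
            (Iio t).indicator (fun _ => gradOseen i j k (t - s) (x - y)) s‖ₑ * ‖F s y‖ₑ :=
          fun i j k => ((measurable_incrementKernel_entry i j k t t').of_uncurry_left.comp
            (measurable_const.sub measurable_id)).enorm.mul hFs.enorm
        simp only [lconv, incrementKernel, Finset.sum_mul]
        rw [lintegral_finsetSum _ fun i _ => Finset.measurable_fun_sum _ fun j _ =>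
          Finset.measurable_fun_sum _ fun k _ => hm i j k]
        refine Finset.sum_le_sum fun i _ => ?_
        rw [lintegral_finsetSum _ fun j _ => Finset.measurable_fun_sum _ fun k _ => hm i j k]
        have heq : heatLerayDiv (t' - s) (F s) x i -
            (Iio t).indicator (fun s => heatLerayDiv (t - s) (F s) x i) s =
            ∑ j, ∑ k, ∫ y, (gradOseen i j k (t' - s) (x - y) -
              (Iio t).indicator (fun _ => gradOseen i j k (t - s) (x - y)) s) * F s y (j, k) := by
          by_cases hst : s < t
          · simp only [indicator_of_mem (mem_Iio.2 hst), heatLerayDiv_apply,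
              ← Finset.sum_sub_distrib]
            refine Finset.sum_congr rfl fun j _ => Finset.sum_congr rfl fun k _ => ?_
            rw [← integral_sub (integrable_gradOseen_mul hFs h3 i j k)
              (integrable_gradOseen_mul hFs (h4 hst) i j k)]
            simp only [sub_mul]
          · have hst' : s ∉ Iio t := by simpa using hst
            simp only [indicator_of_notMem hst', sub_zero, heatLerayDiv_apply]
        rw [heq]
        refine (enorm_sum_le _ _).trans (Finset.sum_le_sum fun j _ => ?_)
        rw [lintegral_finsetSum _ fun k _ => hm i j k]
        refine (enorm_sum_le _ _).trans (Finset.sum_le_sum fun k _ => ?_)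
        refine (enorm_integral_le_lintegral_enorm _).trans (lintegral_mono fun y => ?_)
        rw [enorm_mul]
        gcongr
        exact enorm_apply_le _ _

/-- Hölder continuity in time of the Duhamel term. -/
theorem exists_lnorm_duhamel_sub_le : ∃ C : ℝ≥0, 0 < C ∧ ∀ (M : ℝ≥0) (_ : 0 < M)
    (F : ℝ → E3 → M33) (_ : Measurable (Function.uncurry F)) (T : ℝ) (_ : FBound (1 / 2) M T F)
    (t t' : ℝ), 0 ≤ t → t < t' → t' ≤ T →
      lnorm 2 (fun x => ‖duhamel F t' x - duhamel F t x‖ₑ) ≤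
        C * M * ENNReal.ofReal ((t' - t) ^ (1 / 4 : ℝ)) := by
  obtain ⟨B, hB0, hB⟩ := exists_lintegral_incrementKernel_le
  obtain ⟨A, hA0, hA⟩ := exists_lnorm_potential_le_of_FBound (b := 1 / 2) (b' := 1 / 2)
    (by norm_num) le_rfl (by norm_num) (by norm_num)
  -- Here α = 1/4 is the decay rate of ℱ_2. With β = 3/4 the Beta integral has total exponent 0, so
  -- times before t contribute (t' - t)^{1/4} and nothing more; with β = 1/2 the total exponent 1/4
  -- serves the times in ]t,t'[.
  obtain ⟨C₁, -, hC₁⟩ := exists_lintegral_sub_rpow_mul_rpow_le (α := 1 / 4) (β := 3 / 4)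
    (by norm_num) (by norm_num) (by norm_num) (by norm_num)
  obtain ⟨C₂, -, hC₂⟩ := exists_lintegral_sub_rpow_mul_rpow_le (α := 1 / 4) (β := 1 / 2)
    (by norm_num) (by norm_num) (by norm_num) (by norm_num)
  refine ⟨B * (C₁ + C₂ + 1), by positivity, fun M hM F hF T h t t' ht htt htT => ?_⟩
  have ht' : 0 < t' := ht.trans_lt htt
  have hd : 0 < t' - t := sub_pos.2 htt
  have hpot : ∀ r, 0 ≤ r → r ≤ T → ∀ᵐ x, potential (fun s y => ‖F s y‖ₑ) r x < ⊤ :=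
    fun r hr hrT => by
      rcases hr.eq_or_lt with rfl | hr
      · simp [potential]
      · exact ae_lt_top_of_lnorm (by norm_num)
          (measurable_potential (f := fun s y => ‖F s y‖ₑ) hF.enorm r)
          ((hA M hM F hF T h r hr hrT).trans_lt
            (ENNReal.mul_lt_top ENNReal.coe_lt_top ENNReal.ofReal_lt_top))
  have h1 : lnorm 2 (fun x => ‖duhamel F t' x - duhamel F t x‖ₑ) ≤
      lnorm 2 (fun x => ∫⁻ s in Ioo 0 t', lconv (incrementKernel t t' s) (fun y => ‖F s y‖ₑ) x) := by
    refine lnorm_mono (by norm_num) ?_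
    filter_upwards [hpot t ht (htt.le.trans htT), hpot t' ht'.le htT] with x hx1 hx2
    exact enorm_duhamel_sub_le hF ht htt hx1 hx2
  set a : ℝ → ℝ≥0∞ := fun s => B * M * if s < t then
      ENNReal.ofReal ((t' - t) ^ (1 / 4 : ℝ)) * ENNReal.ofReal ((t - s) ^ (-(3 / 4) : ℝ) * s ^ (-(1 / 4) : ℝ))
      else ENNReal.ofReal ((t' - s) ^ (-(1 / 2) : ℝ) * s ^ (-(1 / 4) : ℝ)) with ha
  have ham : Measurable a := by
    refine Measurable.const_mul (Measurable.ite measurableSet_Iio ?_ ?_) _ <;> fun_prop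
  have h2 : lnorm 2 (fun x => ∫⁻ s in Ioo 0 t', lconv (incrementKernel t t' s)
      (fun y => ‖F s y‖ₑ) x) ≤ ∫⁻ s in Ioo 0 t', a s := by
    refine lnorm_lintegral_le (g := fun s => lconv (incrementKernel t t' s) (fun y => ‖F s y‖ₑ))
      (measurable_uncurry_lconv (f := fun s y => ‖F s y‖ₑ) (measurable_incrementKernel t t')
        hF.enorm) ham one_le_two ?_ ?_ ?_
    · filter_upwards [ae_restrict_mem measurableSet_Ioo] with s hs
      have h3 : 0 < s := hs.1
      have h4 : 0 < t' - s := sub_pos.2 hs.2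
      refine mul_ne_zero (by simp [hB0.ne', hM.ne']) ?_
      split_ifs with hst
      · have h5 : 0 < t - s := sub_pos.2 hst
        refine mul_ne_zero ?_ ?_ <;> · rw [Ne, ENNReal.ofReal_eq_zero, not_le]; positivity
      · rw [Ne, ENNReal.ofReal_eq_zero, not_le]; positivity
    · refine ae_of_all _ fun s => ENNReal.mul_ne_top (by simp [ENNReal.mul_eq_top]) ?_
      split_ifs
      · exact ENNReal.mul_ne_top ENNReal.ofReal_ne_top ENNReal.ofReal_ne_top
      · exact ENNReal.ofReal_ne_top
    · filter_upwards [ae_restrict_mem measurableSet_Ioo,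
        ae_restrict_of_ae_restrict_of_subset (Ioo_subset_Ioo_right htT) h] with s hs h3
      have hs0 : 0 < s := hs.1
      refine (lnorm_lconv_le_mul (measurable_incrementKernel t t').of_uncurry_left
        hF.of_uncurry_left.enorm (hB t t' s htt hs.2) one_le_two).trans ?_
      rw [show (1 : ℝ) / (1 / 2) = 2 by norm_num,
        show -(1 - 3 / 2 * (1 / 2 : ℝ)) = -(1 / 4) by norm_num] at h3
      refine (mul_le_mul_right h3 _).trans (le_of_eq ?_)
      rw [ha]
      simp only
      split_ifs with hst
      · have h5 : 0 < t - s := sub_pos.2 hst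
        rw [ENNReal.ofReal_mul (by positivity), ENNReal.ofReal_mul (p := (t - s) ^ (-(3 / 4) : ℝ))
          (by positivity)]
        ring
      · have h5 : 0 < t' - s := sub_pos.2 hs.2
        rw [ENNReal.ofReal_mul (by positivity)]
        ring
  refine (h1.trans h2).trans ?_
  rw [ha, lintegral_const_mul _ (by
    refine Measurable.ite measurableSet_Iio ?_ ?_ <;> fun_prop)]
  have h6 : ∫⁻ s in Ioo 0 t', (if s < t then
      ENNReal.ofReal ((t' - t) ^ (1 / 4 : ℝ)) * ENNReal.ofReal ((t - s) ^ (-(3 / 4) : ℝ) * s ^ (-(1 / 4) : ℝ))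
      else ENNReal.ofReal ((t' - s) ^ (-(1 / 2) : ℝ) * s ^ (-(1 / 4) : ℝ))) ≤
      (C₁ + C₂) * ENNReal.ofReal ((t' - t) ^ (1 / 4 : ℝ)) := by
    have hsub : Ioo 0 t' ⊆ Ioo 0 t ∪ Ico t t' := fun s hs => by
      rcases lt_or_ge s t with h | h
      · exact Or.inl ⟨hs.1, h⟩
      · exact Or.inr ⟨h, hs.2⟩
    refine (lintegral_mono_set hsub).trans ((lintegral_union_le _ _ _).trans ?_)
    rw [add_mul]
    refine add_le_add ?_ ?_
    · rw [setLIntegral_congr_fun (g := fun s => ENNReal.ofReal ((t' - t) ^ (1 / 4 : ℝ)) *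
        ENNReal.ofReal ((t - s) ^ (-(3 / 4) : ℝ) * s ^ (-(1 / 4) : ℝ))) measurableSet_Ioo
        (fun s hs => by simp [hs.2]), lintegral_const_mul _ (by fun_prop), mul_comm]
      gcongr
      rcases ht.eq_or_lt with rfl | ht0
      · simp
      · refine (hC₁ t ht0).trans (le_of_eq ?_)
        norm_num
    · rw [setLIntegral_congr_fun (g := fun s =>
        ENNReal.ofReal ((t' - s) ^ (-(1 / 2) : ℝ) * s ^ (-(1 / 4) : ℝ))) measurableSet_Ico
        (fun s hs => by simp [not_lt.2 hs.1]), setLIntegral_congr Ioo_ae_eq_Ico.symm]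
      have h7 := (measurePreserving_sub_right (volume : Measure ℝ) t).setLIntegral_comp_preimage
        (measurableSet_Ioo (a := 0) (b := t' - t))
        (f := fun s => ENNReal.ofReal ((t' - t - s) ^ (-(1 / 2) : ℝ) * s ^ (-(1 / 4) : ℝ)))
        (by fun_prop)
      have h8 : (fun s => s - t) ⁻¹' Ioo 0 (t' - t) = Ioo t t' := by
        ext s; simp
      rw [h8] at h7
      have h9 := hC₂ (t' - t) hd
      rw [← h7] at h9
      rw [show (1 : ℝ) - 1 / 4 - 1 / 2 = 1 / 4 by norm_num] at h9
      refine le_trans (setLIntegral_mono' measurableSet_Ioo fun s hs => ?_) h9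
      refine ENNReal.ofReal_le_ofReal ?_
      have h10 : 0 < s - t := sub_pos.2 hs.1
      have h11 : 0 < t' - s := sub_pos.2 hs.2
      -- Replacing s by the smaller s - t leaves a Beta integral over ]0,t' - t[.
      have h12 : s ^ (-(1 / 4) : ℝ) ≤ (s - t) ^ (-(1 / 4) : ℝ) :=
        Real.rpow_le_rpow_of_nonpos h10 (by linarith) (by norm_num)
      rw [show t' - t - (s - t) = t' - s by ring]
      gcongr
  calc _ ≤ (B : ℝ≥0∞) * M * ((C₁ + C₂) * ENNReal.ofReal ((t' - t) ^ (1 / 4 : ℝ))) := by gcongr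
    _ = (B * (C₁ + C₂)) * M * ENNReal.ofReal ((t' - t) ^ (1 / 4 : ℝ)) := by ring
    _ ≤ _ := by
      push_cast
      exact mul_le_mul' (mul_le_mul' (mul_le_mul' le_rfl le_self_add) le_rfl) le_rfl

theorem lnorm_two_eq_eLpNorm {V : Type*} [NormedAddCommGroup V] (f : E3 → V) :
    lnorm 2 (fun x => ‖f x‖ₑ) = eLpNorm f 2 volume := by
  rw [← eLpNorm_eq_lnorm two_pos]; norm_num

theorem duhamel_at_zero (F : ℝ → E3 → M33) : duhamel F 0 = 0 := by
  ext x i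
  simp [duhamel]

/-- Hölder continuity of exponent 1/4. Membership of each slice in L² comes from the same estimate,
comparing with time 0, where the Duhamel term vanishes. -/
theorem continuousInL2_duhamel {F : ℝ → E3 → M33} (hF : Measurable (Function.uncurry F)) {M : ℝ≥0}
    (hM : 0 < M) {T : ℝ} (h : FBound (1 / 2) M T F) : ContinuousInL2 T (duhamel F) := by
  obtain ⟨C, -, hC⟩ := exists_lnorm_duhamel_sub_le
  have hC' := hC M hM F hF T h
  have hmem : ∀ t ∈ Icc 0 T, MemLp (duhamel F t) 2 volume := fun t ht => by
    refine ⟨(measurable_duhamel hF).of_uncurry_left.aestronglyMeasurable, ?_⟩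
    rcases ht.1.eq_or_lt with rfl | ht0
    · simp [duhamel_at_zero]
    · have := hC' 0 t le_rfl ht0 ht.2
      simp only [duhamel_at_zero, Pi.zero_apply, sub_zero] at this
      rw [lnorm_two_eq_eLpNorm] at this
      exact this.trans_lt (ENNReal.mul_lt_top (ENNReal.mul_lt_top ENNReal.coe_lt_top
        ENNReal.coe_lt_top) ENNReal.ofReal_lt_top)
  classical
  refine ⟨fun t => if ht : t ∈ Icc 0 T then (hmem t ht).toLp _ else 0, ?_, fun t ht => ?_⟩
  · have hH : HolderOnWith (C * M) (1 / 4)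
        (fun t => if ht : t ∈ Icc 0 T then (hmem t ht).toLp _ else 0) (Icc 0 T) := by
      have aux : ∀ t ∈ Icc 0 T, ∀ t' ∈ Icc 0 T, t < t' →
          eLpNorm (duhamel F t' - duhamel F t) 2 volume ≤
            ((C * M : ℝ≥0) : ℝ≥0∞) * edist t t' ^ (((1 / 4 : ℝ≥0)) : ℝ) := fun t ht t' ht' htt => by
        have := hC' t t' ht.1 htt ht'.2
        rw [lnorm_two_eq_eLpNorm (fun x => duhamel F t' x - duhamel F t x)] at this
        refine this.trans (le_of_eq ?_)
        have hd : 0 < t' - t := sub_pos.2 htt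
        rw [edist_comm, edist_dist, Real.dist_eq, abs_of_pos hd, ENNReal.ofReal_rpow_of_pos hd]
        push_cast
        norm_num
      intro t ht t' ht'
      simp only [dif_pos ht, dif_pos ht', Lp.edist_toLp_toLp]
      rcases lt_trichotomy t t' with h1 | h1 | h1
      · rw [eLpNorm_sub_comm]
        exact aux t ht t' ht' h1
      · subst h1
        simp
      · rw [edist_comm]
        exact aux t' ht' t ht h1
    exact hH.continuousOn (by norm_num)
  · simp only [dif_pos ht]
    exact (hmem t ht).coeFn_toLp.symm

/-! ### Plancherel's theorem and Riesz representation -/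

theorem integral_fourier_mul_eq {f g : E3 → ℂ} (hf : Integrable f) (hg : Integrable g) :
    ∫ ξ, 𝓕 f ξ • g ξ = ∫ x, f x • 𝓕 g x := by
  have := VectorFourier.integral_fourierIntegral_smul_eq_flip (L := innerₗ E3) (μ := volume)
    (ν := volume) Real.continuous_fourierChar continuous_inner hf hg
  rwa [flip_innerₗ] at this

/-- The `L²` Fourier transform of an integrable function is given by the Fourier integral. -/
theorem coeFn_fourier_toLp {f : E3 → ℂ} (hf : Integrable f) (hf2 : MemLp f 2 volume) :
    (𝓕 (hf2.toLp f) : Lp ℂ 2 (volume : Measure E3)) =ᵐ[volume] 𝓕 f := by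
  have hc : Continuous (𝓕 f) := VectorFourier.fourierIntegral_continuous Real.continuous_fourierChar continuous_inner hf
  -- Both sides are locally integrable, so it suffices to pair them with test functions. Each
  -- pairing moves the Fourier transform onto the test function: on the left by the definition for
  -- distributions, on the right by Fubini.
  refine ae_eq_of_integral_contDiff_smul_eq
    ((Lp.memLp _).locallyIntegrable one_le_two) hc.locallyIntegrable fun g hg hgc => ?_
  have hgc' : HasCompactSupport fun x => (g x : ℂ) := hgc.comp_left (g := ((↑) : ℝ → ℂ)) rfl
  set G : 𝓢(E3, ℂ) := hgc'.toSchwartzMap (Complex.ofRealCLM.contDiff.comp hg) with hG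
  have hGa : ∀ x, G x = (g x : ℂ) := fun x => rfl
  have h1 : ∫ x, g x • (𝓕 (hf2.toLp f) : Lp ℂ 2 (volume : Measure E3)) x =
      ((𝓕 (hf2.toLp f) : Lp ℂ 2 (volume : Measure E3)) : 𝓢'(E3, ℂ)) G := by
    rw [Lp.toTemperedDistribution_apply]
    rfl
  have h2 : ((𝓕 (hf2.toLp f) : Lp ℂ 2 (volume : Measure E3)) : 𝓢'(E3, ℂ)) G =
      ∫ x, 𝓕 (G : E3 → ℂ) x • f x := by
    rw [← Lp.fourier_toTemperedDistribution_eq, TemperedDistribution.fourier_apply,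
      Lp.toTemperedDistribution_apply, SchwartzMap.fourier_coe]
    refine integral_congr_ae ?_
    filter_upwards [hf2.coeFn_toLp] with x hx
    rw [hx]
  rw [h1, h2, integral_fourier_mul_eq G.integrable hf]
  rfl

theorem lintegral_enorm_fourier_sq {f : E3 → ℂ} (hf : Integrable f) (hf2 : MemLp f 2 volume) :
    ∫⁻ ξ, ‖𝓕 f ξ‖ₑ ^ (2 : ℝ) = ∫⁻ x, ‖f x‖ₑ ^ (2 : ℝ) := by
  have h1 : eLpNorm (𝓕 f) 2 volume = eLpNorm f 2 volume := by
    rw [← eLpNorm_congr_ae (coeFn_fourier_toLp hf hf2), ← Lp.enorm_def,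
      ← ofReal_norm, Lp.norm_fourier_eq, ofReal_norm, Lp.enorm_toLp]
  rw [← lnorm_two_eq_eLpNorm, ← lnorm_two_eq_eLpNorm] at h1
  have h2 := congrArg (fun c : ℝ≥0∞ => c ^ (2 : ℝ)) h1
  simpa only [lnorm_rpow two_pos] using h2

/-- A linear form that is bounded by a Hilbert space norm is represented by a vector. -/
theorem exists_inner_eq_of_abs_le {V H : Type*} [AddCommGroup V] [Module ℝ V]
    [NormedAddCommGroup H] [InnerProductSpace ℝ H] [CompleteSpace H] (ι : V →ₗ[ℝ] H)
    (l : V →ₗ[ℝ] ℝ) (C : ℝ) (h : ∀ v, |l v| ≤ C * ‖ι v‖) :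
    ∃ g : H, ∀ v, l v = inner ℝ g (ι v) := by
  -- Through a linear section `r` of `ι` the form becomes a bounded functional on the range of `ι`;
  -- Hahn-Banach extends it and Riesz represents it.
  obtain ⟨r, hr⟩ := ι.rangeRestrict.exists_rightInverse_of_surjective ι.range_rangeRestrict
  have hr' : ∀ w : LinearMap.range ι, ι (r w) = w := fun w => by
    have := congrArg (fun f => ((f w : LinearMap.range ι) : H)) hr
    simpa using this
  have hb : ∀ w : LinearMap.range ι, ‖(l.comp r) w‖ ≤ C * ‖w‖ := fun w => by
    have := h (r w)
    rw [hr'] at this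
    exact this
  obtain ⟨G, hG, -⟩ := exists_extension_norm_eq (LinearMap.range ι)
    ((l.comp r).mkContinuous C hb)
  refine ⟨(InnerProductSpace.toDual ℝ H).symm G, fun v => ?_⟩
  rw [InnerProductSpace.toDual_symm_apply]
  have h1 := hG ⟨ι v, LinearMap.mem_range_self ι v⟩
  simp only [LinearMap.mkContinuous_apply, LinearMap.comp_apply] at h1
  rw [h1]
  -- `ι` need not be injective, but the bound forces `l` to vanish on its kernel, so the choice of
  -- section is immaterial.
  have h2 := h (v - r ⟨ι v, LinearMap.mem_range_self ι v⟩)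
  rw [map_sub, map_sub, hr', sub_self, norm_zero, mul_zero] at h2
  have h3 := abs_nonpos_iff.1 h2
  linarith

/-- The maximal regularity estimate for a single frequency. -/
theorem lintegral_sq_lintegral_exp_le {c : ℝ} (hc : 0 < c) (T : ℝ) {f : ℝ → ℝ≥0∞}
    (hf : Measurable f) :
    ∫⁻ s in Ioo 0 T, (∫⁻ t in Ioo 0 T, (Ioi s).indicator
        (fun t => ENNReal.ofReal (c * Real.exp (-(c * (t - s))))) t * f t) ^ (2 : ℝ) ≤
      ∫⁻ t in Ioo 0 T, f t ^ (2 : ℝ) := by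
  have hm : Measurable (Function.uncurry fun s t : ℝ => (Ioi s).indicator
      (fun t => ENNReal.ofReal (c * Real.exp (-(c * (t - s))))) t) := by
    have h1 : Measurable fun z : ℝ × ℝ => ENNReal.ofReal (c * Real.exp (-(c * (z.2 - z.1)))) := by
      fun_prop
    exact h1.indicator (s := {z : ℝ × ℝ | z.1 < z.2}) (measurableSet_lt measurable_fst measurable_snd)
  have hexp : ∫⁻ u in Ioi (0 : ℝ), ENNReal.ofReal (c * Real.exp (-(c * u))) = 1 := by
    have hi : IntegrableOn (fun u : ℝ => c * Real.exp (-(c * u))) (Ioi 0) := by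
      have := (integrableOn_exp_mul_Ioi (a := -c) (by linarith) 0).const_mul c
      simp only [neg_mul] at this
      exact this
    rw [← ofReal_integral_eq_lintegral_ofReal hi (ae_of_all _ fun u => by positivity),
      integral_const_mul]
    have := integral_exp_mul_Ioi (a := -c) (by linarith) 0
    simp only [neg_mul] at this
    rw [this]
    simp [hc.ne']
  -- Schur's test: c exp(-c(t - s)) has mass at most 1 in either variable, which makes the estimate
  -- uniform in c, hence in the frequency.
  have key := lintegral_rpow_lintegral_mul_le (μ := volume.restrict (Ioo 0 T))
    (ν := volume.restrict (Ioo 0 T)) hm hf (A := 1) one_le_two (fun s => ?_) fun t => ?_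
  · simpa using key
  · refine (setLIntegral_le_lintegral _ _).trans ?_
    rw [lintegral_indicator measurableSet_Ioi, ← hexp]
    have h7 := (measurePreserving_sub_right (volume : Measure ℝ) s).setLIntegral_comp_preimage
        (measurableSet_Ioi (a := 0)) (f := fun u => ENNReal.ofReal (c * Real.exp (-(c * u))))
        (by fun_prop)
    rw [← h7]
    simp
  · refine (setLIntegral_le_lintegral _ _).trans ?_
    have h8 : ∀ s, (Ioi s).indicator (fun t => ENNReal.ofReal (c * Real.exp (-(c * (t - s))))) t =
        (Iio t).indicator (fun s => ENNReal.ofReal (c * Real.exp (-(c * (t - s))))) s := fun s => by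
      simp [indicator]
    simp only [h8]
    rw [lintegral_indicator measurableSet_Iio, ← hexp]
    have h7 := (Measure.measurePreserving_sub_left (volume : Measure ℝ) t).setLIntegral_comp_preimage
        (measurableSet_Ioi (a := 0)) (f := fun u => ENNReal.ofReal (c * Real.exp (-(c * u))))
        (by fun_prop)
    rw [← h7]
    simp

/-! ### The adjoint of the Duhamel operator in `L²` -/

theorem measurable_gradOseenC (i j k : Fin 3) :
    Measurable (Function.uncurry (gradOseenC i j k)) := by
  have h1 : Measurable fun w : (ℝ × E3) × ℝ => cubicKernelAt i j k w.2 w.1.2 :=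
    (measurable_cubicKernelAt i j k).comp (f := fun w : (ℝ × E3) × ℝ => (w.2, w.1.2)) (by fun_prop)
  have hS : MeasurableSet {w : (ℝ × E3) × ℝ | w.1.1 < w.2} :=
    measurableSet_lt (by fun_prop) (by fun_prop)
  have h2 := ((h1.indicator hS).stronglyMeasurable.integral_prod_right' (ν := volume)).measurable
  convert h2 using 2 with z
  exact (integral_indicator (measurable_prodMk_left hS)).symm

/-- Fourier transform of a superposition of correlations. -/
theorem enorm_fourier_correlation_le {μ : Measure ℝ} [SFinite μ] {K η : ℝ → E3 → ℂ}
    (hK : Measurable (Function.uncurry K)) (hη : Measurable (Function.uncurry η))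
    (hfin : ∫⁻ t, ((∫⁻ x, ‖K t x‖ₑ) * (∫⁻ x, ‖η t x‖ₑ)) ∂μ < ⊤) :
    Integrable (fun y => ∫ z, K z.1 (z.2 - y) * η z.1 z.2 ∂μ.prod volume) ∧
    ∀ ξ, ‖𝓕 (fun y => ∫ z, K z.1 (z.2 - y) * η z.1 z.2 ∂μ.prod volume) ξ‖ₑ ≤
      ∫⁻ t, ‖𝓕 (K t) (-ξ)‖ₑ * ‖𝓕 (η t) ξ‖ₑ ∂μ := by
  have hm : Measurable (Function.uncurry fun (y : E3) (z : ℝ × E3) =>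
      K z.1 (z.2 - y) * η z.1 z.2) := by
    refine Measurable.mul ?_ ?_
    · exact hK.comp (f := fun w : E3 × (ℝ × E3) => (w.2.1, w.2.2 - w.1)) (by fun_prop)
    · exact hη.comp (f := fun w : E3 × (ℝ × E3) => (w.2.1, w.2.2)) (by fun_prop)
  have hInt : Integrable (Function.uncurry fun (y : E3) (z : ℝ × E3) =>
      K z.1 (z.2 - y) * η z.1 z.2) (volume.prod (μ.prod volume)) := by
    refine ⟨hm.aestronglyMeasurable, ?_⟩
    rw [hasFiniteIntegral_iff_enorm, lintegral_prod_symm _ hm.enorm.aemeasurable,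
      lintegral_prod _ hm.enorm.lintegral_prod_left'.aemeasurable]
    refine lt_of_le_of_lt (le_of_eq (lintegral_congr fun t => ?_)) hfin
    simp only [Function.uncurry, enorm_mul]
    rw [← lintegral_const_mul _ (hη.of_uncurry_left.enorm)]
    refine lintegral_congr fun x => ?_
    have h1 : Measurable fun y => ‖K t (x - y)‖ₑ :=
      (hK.of_uncurry_left.comp (measurable_const.sub measurable_id)).enorm
    rw [lintegral_mul_const _ h1, lintegral_sub_left_eq_self (fun y => ‖K t y‖ₑ) x]
  refine ⟨hInt.integral_prod_left, fun ξ => ?_⟩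
  -- The substitution u = z.2 - y. Because this is a correlation and not a convolution, the
  -- transform of `K` is evaluated at -ξ.
  have hinner : ∀ z : ℝ × E3, ∫ y, Complex.exp (((-2 * Real.pi * inner ℝ y ξ : ℝ) : ℂ) * Complex.I) •
      (K z.1 (z.2 - y) * η z.1 z.2) = 𝓕 (K z.1) (-ξ) *
        (Complex.exp (((-2 * Real.pi * inner ℝ z.2 ξ : ℝ) : ℂ) * Complex.I) • η z.1 z.2) := fun z => by
    rw [← integral_sub_left_eq_self _ volume z.2, Real.fourier_eq', ← integral_mul_const]
    refine integral_congr_ae (ae_of_all _ fun u => ?_)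
    simp only [sub_sub_cancel, smul_eq_mul, inner_sub_left, inner_neg_right]
    rw [show (((-2 * Real.pi * (inner ℝ z.2 ξ - inner ℝ u ξ) : ℝ) : ℂ) * Complex.I) =
      (((-2 * Real.pi * -inner ℝ u ξ : ℝ) : ℂ) * Complex.I) +
      (((-2 * Real.pi * inner ℝ z.2 ξ : ℝ) : ℂ) * Complex.I) by push_cast; ring, Complex.exp_add]
    ring
  have hInt' : Integrable (Function.uncurry fun (y : E3) (z : ℝ × E3) =>
      Complex.exp (((-2 * Real.pi * inner ℝ y ξ : ℝ) : ℂ) * Complex.I) •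
        (K z.1 (z.2 - y) * η z.1 z.2)) (volume.prod (μ.prod volume)) := by
    refine hInt.mono ?_ (ae_of_all _ fun w => ?_)
    · have h1 : Measurable fun w : E3 × (ℝ × E3) =>
          Complex.exp (((-2 * Real.pi * inner ℝ w.1 ξ : ℝ) : ℂ) * Complex.I) := by fun_prop
      exact (h1.smul hm).aestronglyMeasurable
    · simp only [Function.uncurry, norm_smul, Complex.norm_exp_ofReal_mul_I, one_mul, le_refl]
  have hF : 𝓕 (fun y => ∫ z, K z.1 (z.2 - y) * η z.1 z.2 ∂μ.prod volume) ξ =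
      ∫ z, 𝓕 (K z.1) (-ξ) * (Complex.exp (((-2 * Real.pi * inner ℝ z.2 ξ : ℝ) : ℂ) * Complex.I) •
        η z.1 z.2) ∂μ.prod volume := by
    rw [Real.fourier_eq']
    simp only [← integral_smul]
    rw [integral_integral_swap hInt']
    simp only [hinner]
  have hint2 : Integrable (fun z : ℝ × E3 => 𝓕 (K z.1) (-ξ) *
      (Complex.exp (((-2 * Real.pi * inner ℝ z.2 ξ : ℝ) : ℂ) * Complex.I) • η z.1 z.2))
      (μ.prod volume) := by
    refine hInt'.integral_prod_right.congr (ae_of_all _ fun z => ?_)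
    exact hinner z
  rw [hF, integral_prod _ hint2]
  refine (enorm_integral_le_lintegral_enorm _).trans (lintegral_mono fun t => ?_)
  simp only
  rw [integral_const_mul, enorm_mul, Real.fourier_eq' (η t)]

/-- The space-time kernel of the Duhamel operator. -/
noncomputable def spaceTimeKernel (i j k : Fin 3) (z z' : ℝ × E3) : ℝ :=
  if z'.1 < z.1 then gradOseen i j k (z.1 - z'.1) (z.2 - z'.2) else 0

theorem measurable_spaceTimeKernel (i j k : Fin 3) :
    Measurable (Function.uncurry (spaceTimeKernel i j k)) := by
  refine Measurable.ite (measurableSet_lt (by fun_prop) (by fun_prop)) ?_ measurable_const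
  exact (measurable_gradOseen i j k).comp
    (f := fun w : (ℝ × E3) × (ℝ × E3) => (w.1.1 - w.2.1, w.1.2 - w.2.2)) (by fun_prop)

/-- Supplies one of the two powers of |ξ| in the maximal regularity estimate; the other one comes
from the Oseen kernel. -/
theorem norm_fourier_fderiv_slice {f : E3 → ℝ} (hf : ContDiff ℝ ∞ f) (hc : HasCompactSupport f)
    (m : Fin 3) (ξ : E3) :
    ‖𝓕 (fun x => ((fderiv ℝ f x (e m) : ℝ) : ℂ)) ξ‖ ≤
      2 * Real.pi * ‖ξ‖ * ‖𝓕 (fun x => (f x : ℂ)) ξ‖ := by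
  set g : E3 → ℂ := fun x => (f x : ℂ) with hg
  have hgd : ContDiff ℝ ∞ g := Complex.ofRealCLM.contDiff.comp hf
  have hgc : HasCompactSupport g := hc.comp_left (g := ((↑) : ℝ → ℂ)) rfl
  have hd : ∀ x, ((fderiv ℝ f x (e m) : ℝ) : ℂ) = fderiv ℝ g x (e m) := fun x => by
    have h1 := (Complex.ofRealCLM.hasFDerivAt (x := f x)).comp x
      ((hf.differentiable (by simp)) x).hasFDerivAt
    have h2 : HasFDerivAt g (Complex.ofRealCLM ∘SL fderiv ℝ f x) x := h1
    rw [h2.fderiv]; rfl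
  have hgi : Integrable g := hgd.continuous.integrable_of_hasCompactSupport hgc
  have hgi' : Integrable (fderiv ℝ g) :=
    (hgd.continuous_fderiv (by simp)).integrable_of_hasCompactSupport (hgc.fderiv ℝ)
  simp only [hd]
  rw [← Real.fourier_continuousLinearMap_apply hgi',
    Real.fourier_fderiv hgi (hgd.differentiable (by simp)) hgi',
    VectorFourier.fourierSMulRight_apply, norm_smul, norm_smul]
  have h1 : ‖(-(2 * Real.pi * Complex.I) : ℂ)‖ = 2 * Real.pi := by
    simp [abs_of_pos Real.pi_pos]
  have h2 : ‖((-innerSL ℝ) ξ : E3 →L[ℝ] ℝ) (e m)‖ ≤ ‖ξ‖ := by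
    change ‖-(inner ℝ ξ (e m))‖ ≤ _
    rw [norm_neg]
    refine (norm_inner_le_norm _ _).trans ?_
    simp [e]
  rw [h1, mul_assoc (2 * Real.pi)]
  gcongr

theorem contDiff_slice {ψ : ℝ × E3 → ℝ} (hψ : ContDiff ℝ ∞ ψ) (t : ℝ) :
    ContDiff ℝ ∞ fun x => ψ (t, x) := hψ.comp (contDiff_prodMk_right t)

theorem hasCompactSupport_slice {ψ : ℝ × E3 → ℝ} (hc : HasCompactSupport ψ) (t : ℝ) :
    HasCompactSupport fun x => ψ (t, x) := by
  refine HasCompactSupport.intro (hc.isCompact.image continuous_snd) fun x hx => ?_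
  by_contra h
  exact hx ⟨(t, x), subset_tsupport _ h, rfl⟩

theorem fderiv_slice {ψ : ℝ × E3 → ℝ} (hψ : ContDiff ℝ ∞ ψ) (t : ℝ) (x v : E3) :
    fderiv ℝ ψ (t, x) (0, v) = fderiv ℝ (fun x => ψ (t, x)) x v := by
  have h1 : HasFDerivAt (fun x => ψ (t, x))
      ((fderiv ℝ ψ (t, x)) ∘SL (ContinuousLinearMap.inr ℝ ℝ E3)) x :=
    HasFDerivAt.comp x ((hψ.differentiable (by simp)) (t, x)).hasFDerivAt
      (hasFDerivAt_prodMk_right t x)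
  rw [h1.fderiv]
  simp

theorem continuous_spatialDeriv {ψ : ℝ × E3 → ℝ} (hψ : ContDiff ℝ ∞ ψ) (m : Fin 3) :
    Continuous fun z => fderiv ℝ ψ z (0, e m) :=
  (hψ.continuous_fderiv (by simp)).clm_apply continuous_const

theorem hasCompactSupport_spatialDeriv {ψ : ℝ × E3 → ℝ} (hc : HasCompactSupport ψ) (m : Fin 3) :
    HasCompactSupport fun z => fderiv ℝ ψ z (0, e m) :=
  (hc.fderiv ℝ).comp_left (g := fun L : ℝ × E3 →L[ℝ] ℝ => L (0, e m)) rfl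

theorem measurable_fourier_slice {ψ : ℝ × E3 → ℝ} (hψ : Continuous ψ) :
    Measurable (Function.uncurry fun (t : ℝ) (ξ : E3) => 𝓕 (fun x => (ψ (t, x) : ℂ)) ξ) := by
  have h : Continuous fun w : (ℝ × E3) × E3 =>
      Complex.exp (((-2 * Real.pi * inner ℝ w.2 w.1.2 : ℝ) : ℂ) * Complex.I) •
        (ψ (w.1.1, w.2) : ℂ) := by fun_prop
  have h2 := (h.stronglyMeasurable.integral_prod_right' (ν := volume)).measurable
  convert h2 using 2 with z
  exact Real.fourier_eq' _ _

/-- The Lebesgue measure on `]0,T[ × ℝ³`. -/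
noncomputable abbrev cylinderMeasure (T : ℝ) : Measure (ℝ × E3) :=
  (volume.restrict (Ioo 0 T)).prod volume

/-- The spatial projection of the support is one compact set that serves all times, so the slices
are bounded in L¹ uniformly in t. -/
theorem lintegral_enorm_slice_le {η : ℝ × E3 → ℝ} (hη : Continuous η) (hc : HasCompactSupport η) :
    ∃ D : ℝ≥0, (∀ z, ‖η z‖ₑ ≤ D) ∧ ∀ t, ∫⁻ x, ‖η (t, x)‖ₑ ≤ D := by
  obtain ⟨S, hS⟩ := hη.bounded_above_of_compact_support hc
  set K := Prod.snd '' tsupport η with hK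
  have hKc : IsCompact K := hc.isCompact.image continuous_snd
  have h1 : ∀ z, ‖η z‖ₑ ≤ ENNReal.ofReal S := fun z => by
    rw [← ofReal_norm]; exact ENNReal.ofReal_le_ofReal (hS z)
  have h2 : ENNReal.ofReal S * volume K < ⊤ :=
    ENNReal.mul_lt_top ENNReal.ofReal_lt_top hKc.measure_lt_top
  lift ENNReal.ofReal S * volume K to ℝ≥0 using h2.ne with D' hD'
  refine ⟨max S.toNNReal D', fun z => (h1 z).trans ?_, fun t => ?_⟩
  · exact ENNReal.coe_le_coe.2 (le_max_left _ _)
  · refine le_trans ?_ (ENNReal.coe_le_coe.2 (le_max_right _ _))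
    rw [hD', ← lintegral_indicator_const hKc.measurableSet]
    refine lintegral_mono fun x => ?_
    by_cases hx : x ∈ K
    · rw [indicator_of_mem hx]; exact h1 _
    · have : η (t, x) = 0 := by
        by_contra h
        exact hx ⟨(t, x), subset_tsupport _ h, rfl⟩
      simp [this]

/-- The slice at time `t` of the kernel of the adjoint Duhamel operator started at `s`. -/
noncomputable def adjointKernel (i j k : Fin 3) (s t : ℝ) (x : E3) : ℂ :=
  if s < t then gradOseenC i j k (t - s) x else 0

theorem measurable_adjointKernel (i j k : Fin 3) :
    Measurable fun w : ℝ × ℝ × E3 => adjointKernel i j k w.1 w.2.1 w.2.2 := by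
  refine Measurable.ite (measurableSet_lt (by fun_prop) (by fun_prop)) ?_ measurable_const
  exact (measurable_gradOseenC i j k).comp
    (f := fun w : ℝ × ℝ × E3 => (w.2.1 - w.1, w.2.2)) (by fun_prop)

/-- The L¹ norm is O((t - s)^{-1/2}), integrable in t. For s > 0 the differences t - s stay in
]0,T[, so the bound does not depend on s. -/
theorem exists_lintegral_adjointKernel_le (i j k : Fin 3) (T : ℝ) : ∃ B : ℝ≥0, ∀ s, 0 < s →
    ∫⁻ t in Ioo 0 T, ∫⁻ x, ‖adjointKernel i j k s t x‖ₑ ≤ B := by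
  obtain ⟨B, -, hB⟩ := exists_gradOseenC_le
  have hfin : (B : ℝ≥0∞) * ∫⁻ u in Ioo 0 T, ENNReal.ofReal (u ^ (-(1 / 2) : ℝ)) < ⊤ := by
    refine ENNReal.mul_lt_top ENNReal.coe_lt_top ?_
    have h := intervalIntegral.intervalIntegrable_rpow' (a := 0) (b := T) (r := -(1 / 2))
      (by norm_num)
    rcases le_or_gt T 0 with hT | hT
    · simp [Ioo_eq_empty_of_le hT]
    · rw [intervalIntegrable_iff_integrableOn_Ioo_of_le hT.le] at h
      exact (lintegral_ofReal_le_lintegral_enorm _).trans_lt h.2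
  lift (B : ℝ≥0∞) * ∫⁻ u in Ioo 0 T, ENNReal.ofReal (u ^ (-(1 / 2) : ℝ)) to ℝ≥0 using hfin.ne
    with C hC
  refine ⟨C, fun s hs => ?_⟩
  rw [hC, ← lintegral_const_mul _ (by fun_prop), ← lintegral_indicator measurableSet_Ioo,
    ← lintegral_indicator measurableSet_Ioo, ← lintegral_sub_right_eq_self
      ((Ioo 0 T).indicator fun u => (B : ℝ≥0∞) * ENNReal.ofReal (u ^ (-(1 / 2) : ℝ))) s]
  refine lintegral_mono fun t => ?_
  by_cases ht : t ∈ Ioo 0 T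
  · rw [indicator_of_mem ht]
    by_cases hst : s < t
    · rw [indicator_of_mem (by constructor <;> linarith [ht.2] : t - s ∈ Ioo 0 T)]
      simp only [adjointKernel, if_pos hst]
      exact (hB i j k _ (sub_pos.2 hst)).1
    · simp [adjointKernel, hst]
  · rw [indicator_of_notMem ht]; exact zero_le

section Adjoint

variable {η : ℝ × E3 → ℝ}

/-- The first bound is the hypothesis of `enorm_fourier_correlation_le`; the second bounds the
adjoint potential uniformly in `y`. -/
theorem lintegral_adjointKernel_mul_le (i j k : Fin 3) (T : ℝ) (hη : Continuous η)
    (hc : HasCompactSupport η) : ∃ D : ℝ≥0, ∀ s, 0 < s →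
    (∫⁻ t in Ioo 0 T, (∫⁻ x, ‖adjointKernel i j k s t x‖ₑ) * (∫⁻ x, ‖(η (t, x) : ℂ)‖ₑ) ≤ D) ∧
    ∀ y, ∫⁻ z, ‖adjointKernel i j k s z.1 (z.2 - y) * (η z : ℂ)‖ₑ ∂cylinderMeasure T ≤ D := by
  obtain ⟨B, hB⟩ := exists_lintegral_adjointKernel_le i j k T
  obtain ⟨D, hD1, hD2⟩ := lintegral_enorm_slice_le hη hc
  have he : ∀ z, ‖(η z : ℂ)‖ₑ = ‖η z‖ₑ := fun z => by
    rw [← ofReal_norm, ← ofReal_norm, Complex.norm_real]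
  have hm : ∀ s, Measurable (Function.uncurry (adjointKernel i j k s)) := fun s =>
    (measurable_adjointKernel i j k).comp (f := fun z : ℝ × E3 => (s, z.1, z.2)) (by fun_prop)
  have hm2 : ∀ s, Measurable fun t => ∫⁻ x, ‖adjointKernel i j k s t x‖ₑ := fun s =>
    (hm s).enorm.lintegral_prod_right'
  refine ⟨B * D, fun s hs => ⟨?_, fun y => ?_⟩⟩
  · push_cast
    refine le_trans ?_ (mul_le_mul_left (hB s hs) (D : ℝ≥0∞))
    rw [← lintegral_mul_const _ (hm2 s)]
    refine lintegral_mono fun t => ?_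
    simp only [he]
    gcongr
    exact hD2 t
  · have hms : Measurable fun z : ℝ × E3 => adjointKernel i j k s z.1 (z.2 - y) :=
      (hm s).comp (f := fun z : ℝ × E3 => (z.1, z.2 - y)) (by fun_prop)
    have hηm : Measurable fun z => (η z : ℂ) := by fun_prop
    have hmm : Measurable fun z : ℝ × E3 => adjointKernel i j k s z.1 (z.2 - y) * (η z : ℂ) :=
      hms.mul hηm
    rw [lintegral_prod _ hmm.enorm.aemeasurable]
    push_cast
    refine le_trans ?_ (mul_le_mul_left (hB s hs) (D : ℝ≥0∞))
    rw [← lintegral_mul_const _ (hm2 s)]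
    refine lintegral_mono fun t => ?_
    rw [← lintegral_sub_right_eq_self (fun x => ‖adjointKernel i j k s t x‖ₑ) y]
    refine le_trans (lintegral_mono fun x => ?_) (le_of_eq (lintegral_mul_const _ ?_))
    · rw [enorm_mul, he]
      gcongr
      exact hD1 _
    · exact (hms.of_uncurry_left (f := fun t x => adjointKernel i j k s t (x - y))).enorm

/-- The adjoint Duhamel operator, at complex level. -/
noncomputable def adjointDuhamel (i j k : Fin 3) (T : ℝ) (η : ℝ × E3 → ℝ) (s : ℝ) (y : E3) : ℂ :=
  ∫ z, adjointKernel i j k s z.1 (z.2 - y) * (η z : ℂ) ∂cylinderMeasure T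

theorem integral_spaceTimeKernel_mul (i j k : Fin 3) (T : ℝ) (hη : Continuous η)
    (hc : HasCompactSupport η) {s : ℝ} (hs : 0 < s) (y : E3) :
    ∫ z, spaceTimeKernel i j k z (s, y) * η z ∂cylinderMeasure T =
      (adjointDuhamel i j k T η s y).re := by
  obtain ⟨D, hD⟩ := lintegral_adjointKernel_mul_le i j k T hη hc
  have hm : Measurable fun z : ℝ × E3 => adjointKernel i j k s z.1 (z.2 - y) * (η z : ℂ) :=
    ((measurable_adjointKernel i j k).comp (f := fun z : ℝ × E3 => (s, z.1, z.2 - y))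
      (by fun_prop)).mul (by fun_prop)
  have hi : Integrable (fun z : ℝ × E3 => adjointKernel i j k s z.1 (z.2 - y) * (η z : ℂ))
      (cylinderMeasure T) :=
    ⟨hm.aestronglyMeasurable, ((hD s hs).2 y).trans_lt ENNReal.coe_lt_top⟩
  have h1 := integral_re hi
  refine Eq.trans ?_ h1
  refine integral_congr_ae (ae_of_all _ fun z => ?_)
  simp only [spaceTimeKernel, adjointKernel]
  split_ifs with h
  · rw [gradOseen_eq i j k (sub_pos.2 h)]; simp
  · simp

/-- Integrable and bounded implies square integrable, so Plancherel's theorem may be used with the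
Fourier transform given by the integral. -/
theorem adjointDuhamel_integrable_memLp (i j k : Fin 3) (T : ℝ) (hη : Continuous η)
    (hc : HasCompactSupport η) {s : ℝ} (hs : 0 < s) :
    Integrable (adjointDuhamel i j k T η s) ∧ MemLp (adjointDuhamel i j k T η s) 2 volume ∧
    ∀ ξ, ‖𝓕 (adjointDuhamel i j k T η s) ξ‖ₑ ≤ ∫⁻ t in Ioo 0 T,
      ‖𝓕 (adjointKernel i j k s t) (-ξ)‖ₑ * ‖𝓕 (fun x => (η (t, x) : ℂ)) ξ‖ₑ := by
  obtain ⟨D, hD⟩ := lintegral_adjointKernel_mul_le i j k T hη hc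
  have hm : Measurable (Function.uncurry (adjointKernel i j k s)) :=
    (measurable_adjointKernel i j k).comp (f := fun z : ℝ × E3 => (s, z.1, z.2)) (by fun_prop)
  have h := enorm_fourier_correlation_le (μ := volume.restrict (Ioo 0 T))
    (K := adjointKernel i j k s) (η := fun t x => (η (t, x) : ℂ)) hm
    (Complex.measurable_ofReal.comp hη.measurable) ((hD s hs).1.trans_lt ENNReal.coe_lt_top)
  have hi : Integrable (adjointDuhamel i j k T η s) := h.1
  refine ⟨hi, ?_, h.2⟩
  have hb : ∀ y, ‖adjointDuhamel i j k T η s y‖ₑ ≤ D := fun y =>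
    (enorm_integral_le_lintegral_enorm _).trans ((hD s hs).2 y)
  rw [memLp_two_iff_integrable_sq_norm hi.aestronglyMeasurable]
  simp only [sq]
  refine hi.norm.bdd_mul (c := D) hi.norm.aestronglyMeasurable (ae_of_all _ fun y => ?_)
  have := hb y
  rw [norm_norm]
  rwa [← ofReal_norm, ENNReal.ofReal_le_coe] at this

end Adjoint

/-- The kernel and the differentiated test function contribute 2π|ξ| each, and the projector entries
at most 2. With c = 4π²|ξ|² the product is the kernel c exp(-c(t - s)) of the single-frequency
estimate. -/
theorem fourier_adjointKernel_le (i j k : Fin 3) {ψ : ℝ × E3 → ℝ} (hψ : ContDiff ℝ ∞ ψ)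
    (hc : HasCompactSupport ψ) (m : Fin 3) (s t : ℝ) {ξ : E3} (hξ : ξ ≠ 0) :
    ‖𝓕 (adjointKernel i j k s t) (-ξ)‖ₑ *
      ‖𝓕 (fun x => ((fderiv ℝ ψ (t, x) (0, e m) : ℝ) : ℂ)) ξ‖ₑ ≤
    (Ioi s).indicator (fun t => ENNReal.ofReal (4 * Real.pi ^ 2 * ‖ξ‖ ^ 2 *
        Real.exp (-(4 * Real.pi ^ 2 * ‖ξ‖ ^ 2 * (t - s))))) t *
      (2 * ‖𝓕 (fun x => (ψ (t, x) : ℂ)) ξ‖ₑ) := by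
  by_cases hst : s < t
  · rw [indicator_of_mem (mem_Ioi.2 hst)]
    have h0 : adjointKernel i j k s t = gradOseenC i j k (t - s) := by
      ext x; simp [adjointKernel, hst]
    have h1 : ‖𝓕 (adjointKernel i j k s t) (-ξ)‖ ≤
        2 * (2 * Real.pi * ‖ξ‖) * Real.exp (-(4 * Real.pi ^ 2 * ((t - s) * ‖ξ‖ ^ 2))) := by
      rw [h0, fourier_gradOseenC i j k (sub_pos.2 hst) (neg_ne_zero.2 hξ)]
      simpa using norm_gradOseenSymbol_le i j k (t - s) (-ξ)
    have h2 := norm_fourier_fderiv_slice (contDiff_slice hψ t) (hasCompactSupport_slice hc t) m ξ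
    simp only [← fderiv_slice hψ] at h2
    have h3 : 2 * ‖𝓕 (fun x => (ψ (t, x) : ℂ)) ξ‖ₑ =
        ENNReal.ofReal (2 * ‖𝓕 (fun x => (ψ (t, x) : ℂ)) ξ‖) := by
      rw [ENNReal.ofReal_mul (by norm_num), ofReal_norm]; simp
    rw [h3, ← ofReal_norm, ← ofReal_norm, ← ENNReal.ofReal_mul (norm_nonneg _),
      ← ENNReal.ofReal_mul (by positivity)]
    refine ENNReal.ofReal_le_ofReal ((mul_le_mul h1 h2 (norm_nonneg _) (by positivity)).trans
      (le_of_eq ?_))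
    rw [show 4 * Real.pi ^ 2 * ‖ξ‖ ^ 2 * (t - s) = 4 * Real.pi ^ 2 * ((t - s) * ‖ξ‖ ^ 2) by ring]
    ring
  · have h0 : adjointKernel i j k s t = fun _ => 0 := by
      ext x; simp [adjointKernel, hst]
    have h1 : 𝓕 (adjointKernel i j k s t) (-ξ) = 0 := by
      rw [h0, Real.fourier_eq']; simp
    rw [h1]
    simp

/-- Plancherel in space, the single-frequency estimate in time, and Plancherel back. The constant 4
is the square of the bound 2 for the projector entries. -/
theorem lintegral_adjointDuhamel_sq_le (i j k : Fin 3) (T : ℝ) {ψ : ℝ × E3 → ℝ}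
    (hψ : ContDiff ℝ ∞ ψ) (hc : HasCompactSupport ψ) (m : Fin 3) :
    ∫⁻ s in Ioo 0 T, ∫⁻ y,
      ‖adjointDuhamel i j k T (fun z => fderiv ℝ ψ z (0, e m)) s y‖ₑ ^ (2 : ℝ) ≤
    4 * ∫⁻ t in Ioo 0 T, ∫⁻ x, ‖ψ (t, x)‖ₑ ^ (2 : ℝ) := by
  set η : ℝ × E3 → ℝ := fun z => fderiv ℝ ψ z (0, e m) with hη
  have hηc : Continuous η := continuous_spatialDeriv hψ m
  have hηs : HasCompactSupport η := hasCompactSupport_spatialDeriv hc m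
  set g : E3 → ℝ → ℝ≥0∞ := fun ξ t => 2 * ‖𝓕 (fun x => (ψ (t, x) : ℂ)) ξ‖ₑ with hg
  set E : E3 → ℝ → ℝ → ℝ≥0∞ := fun ξ s t => (Ioi s).indicator (fun t => ENNReal.ofReal
    (4 * Real.pi ^ 2 * ‖ξ‖ ^ 2 * Real.exp (-(4 * Real.pi ^ 2 * ‖ξ‖ ^ 2 * (t - s))))) t with hE
  have hgm : Measurable (Function.uncurry g) :=
    ((measurable_fourier_slice hψ.continuous).comp
      (f := fun w : E3 × ℝ => (w.2, w.1)) (by fun_prop)).enorm.const_mul 2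
  have hEm : Measurable fun w : (E3 × ℝ) × ℝ => E w.1.1 w.1.2 w.2 := by
    have h1 : Measurable fun w : (E3 × ℝ) × ℝ => ENNReal.ofReal (4 * Real.pi ^ 2 * ‖w.1.1‖ ^ 2 *
      Real.exp (-(4 * Real.pi ^ 2 * ‖w.1.1‖ ^ 2 * (w.2 - w.1.2)))) := by fun_prop
    exact h1.indicator (s := {w : (E3 × ℝ) × ℝ | w.1.2 < w.2})
      (measurableSet_lt (by fun_prop) (by fun_prop))
  have hEg : Measurable fun w : (E3 × ℝ) × ℝ => E w.1.1 w.1.2 w.2 * g w.1.1 w.2 :=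
    hEm.mul (hgm.comp (f := fun w : (E3 × ℝ) × ℝ => (w.1.1, w.2)) (by fun_prop))
  have hI : Measurable (Function.uncurry fun (ξ : E3) (s : ℝ) =>
      (∫⁻ t in Ioo 0 T, E ξ s t * g ξ t) ^ (2 : ℝ)) := by
    have := hEg.lintegral_prod_right' (ν := volume.restrict (Ioo 0 T))
    exact this.pow_const 2
  have hξ0 : ∀ᵐ ξ : E3, ξ ≠ 0 := by
    rw [ae_iff]; simp
  calc _ ≤ ∫⁻ s in Ioo 0 T, ∫⁻ ξ, (∫⁻ t in Ioo 0 T, E ξ s t * g ξ t) ^ (2 : ℝ) := by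
        refine setLIntegral_mono' measurableSet_Ioo fun s hs => ?_
        obtain ⟨h1, h2, h3⟩ := adjointDuhamel_integrable_memLp i j k T hηc hηs hs.1
        rw [← lintegral_enorm_fourier_sq h1 h2]
        refine lintegral_mono_ae ?_
        filter_upwards [hξ0] with ξ hξ
        gcongr
        refine (h3 ξ).trans (lintegral_mono fun t => ?_)
        exact fourier_adjointKernel_le i j k hψ hc m s t hξ
    _ = ∫⁻ ξ, ∫⁻ s in Ioo 0 T, (∫⁻ t in Ioo 0 T, E ξ s t * g ξ t) ^ (2 : ℝ) := by
        rw [lintegral_lintegral_swap]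
        exact (hI.comp measurable_swap).aemeasurable
    _ ≤ ∫⁻ ξ, ∫⁻ t in Ioo 0 T, g ξ t ^ (2 : ℝ) := by
        refine lintegral_mono_ae ?_
        filter_upwards [hξ0] with ξ hξ
        have hpos : 0 < 4 * Real.pi ^ 2 * ‖ξ‖ ^ 2 := by
          have := norm_pos_iff.2 hξ
          have := Real.pi_pos
          positivity
        exact lintegral_sq_lintegral_exp_le hpos T hgm.of_uncurry_left
    _ = ∫⁻ t in Ioo 0 T, ∫⁻ ξ, g ξ t ^ (2 : ℝ) := by
        rw [lintegral_lintegral_swap]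
        exact (hgm.pow_const 2).aemeasurable
    _ = ∫⁻ t in Ioo 0 T, 4 * ∫⁻ x, ‖ψ (t, x)‖ₑ ^ (2 : ℝ) := by
        refine lintegral_congr fun t => ?_
        have hs : Continuous fun x => (ψ (t, x) : ℂ) := by fun_prop
        have hsc : HasCompactSupport fun x => (ψ (t, x) : ℂ) :=
          (hasCompactSupport_slice hc t).comp_left (g := ((↑) : ℝ → ℂ)) rfl
        have h1 := lintegral_enorm_fourier_sq (hs.integrable_of_hasCompactSupport hsc)
          (hs.memLp_of_hasCompactSupport hsc)
        have h2 : ∀ x, ‖(ψ (t, x) : ℂ)‖ₑ = ‖ψ (t, x)‖ₑ := fun x => by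
          rw [← ofReal_norm, ← ofReal_norm, Complex.norm_real]
        simp only [h2] at h1
        rw [← h1, ← lintegral_const_mul]
        · refine lintegral_congr fun ξ => ?_
          simp only [hg]
          rw [ENNReal.mul_rpow_of_nonneg _ _ (by norm_num)]
          norm_num
        · exact ((measurable_fourier_slice hψ.continuous).of_uncurry_left).enorm.pow_const 2
    _ = _ := by
        rw [lintegral_const_mul]
        have : Continuous ψ := hψ.continuous
        exact (Measurable.lintegral_prod_right' (f := fun z : ℝ × E3 => ‖ψ z‖ₑ ^ (2 : ℝ))
          (this.measurable.enorm.pow_const 2))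

/-- The adjoint of the Duhamel operator maps spatial derivatives of `L²` functions to `L²`. -/
theorem lintegral_adjoint_sq_le (i j k : Fin 3) (T : ℝ) {ψ : ℝ × E3 → ℝ}
    (hψ : ContDiff ℝ ∞ ψ) (hc : HasCompactSupport ψ) (m : Fin 3) :
    ∫⁻ z', ‖∫ z, spaceTimeKernel i j k z z' * fderiv ℝ ψ z (0, e m) ∂cylinderMeasure T‖ₑ ^ (2 : ℝ)
        ∂cylinderMeasure T ≤ 4 * ∫⁻ z, ‖ψ z‖ₑ ^ (2 : ℝ) ∂cylinderMeasure T := by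
  have hηc : Continuous fun z => fderiv ℝ ψ z (0, e m) := continuous_spatialDeriv hψ m
  have hηs := hasCompactSupport_spatialDeriv hc m
  have hψc : Continuous ψ := hψ.continuous
  have hm : Measurable fun z' : ℝ × E3 =>
      ∫ z, spaceTimeKernel i j k z z' * fderiv ℝ ψ z (0, e m) ∂cylinderMeasure T := by
    have h : Measurable (Function.uncurry fun z' z : ℝ × E3 =>
        spaceTimeKernel i j k z z' * fderiv ℝ ψ z (0, e m)) :=
      ((measurable_spaceTimeKernel i j k).comp measurable_swap).mul
        (hηc.measurable.comp measurable_snd)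
    exact (h.stronglyMeasurable.integral_prod_right').measurable
  rw [lintegral_prod _ (hm.enorm.pow_const 2).aemeasurable,
    lintegral_prod _ (hψc.measurable.enorm.pow_const 2).aemeasurable]
  refine le_trans ?_ (lintegral_adjointDuhamel_sq_le i j k T hψ hc m)
  refine setLIntegral_mono' measurableSet_Ioo fun s hs => lintegral_mono fun y => ?_
  rw [integral_spaceTimeKernel_mul i j k T hηc hηs hs.1]
  gcongr
  rw [← ofReal_norm, ← ofReal_norm]
  exact ENNReal.ofReal_le_ofReal (Complex.abs_re_le_norm _)

/-! ### The weak gradient of the Duhamel operator -/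

theorem timeInterval_ofReal {T : ℝ} (hT : 0 < T) :
    timeInterval (ENNReal.ofReal T) = Ioo 0 T := by
  ext t
  simp only [timeInterval, mem_ofPred_eq, mem_Ioo, ENNReal.ofReal_lt_ofReal_iff hT]

theorem restrict_Q_eq {T : ℝ} (hT : 0 < T) :
    (volume : Measure (ℝ × E3)).restrict (Q (ENNReal.ofReal T)) = cylinderMeasure T := by
  rw [Q, timeInterval_ofReal hT, Measure.volume_eq_prod, ← Measure.prod_restrict,
    Measure.restrict_univ]

theorem locallyIntegrableOn_of_memLp_two {V : Type*} [NormedAddCommGroup V] {T : ℝ}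
    {f : ℝ × E3 → V} (hf : MemLp f 2 (volume.restrict (Q (ENNReal.ofReal T)))) :
    LocallyIntegrableOn f (Q (ENNReal.ofReal T)) :=
  locallyIntegrableOn_of_locallyIntegrable_restrict (hf.locallyIntegrable one_le_two)

theorem measurable_uncurry_potential {f : ℝ → E3 → ℝ≥0∞} (hf : Measurable (Function.uncurry f)) :
    Measurable (Function.uncurry (potential f)) := by
  have h1 : Measurable fun w : ((ℝ × E3) × ℝ) × E3 =>
      oseenMajorant (w.1.1.1 - w.1.2) (w.1.1.2 - w.2) * f w.1.2 w.2 :=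
    (measurable_oseenMajorant.comp (f := fun w : ((ℝ × E3) × ℝ) × E3 =>
      (w.1.1.1 - w.1.2, w.1.1.2 - w.2)) (by fun_prop)).mul
      (hf.comp (f := fun w : ((ℝ × E3) × ℝ) × E3 => (w.1.2, w.2)) (by fun_prop))
  have h2 := h1.lintegral_prod_right' (ν := volume)
  have hS : MeasurableSet {w : (ℝ × E3) × ℝ | w.2 ∈ Ioo 0 w.1.1} := by
    simp only [mem_Ioo]; measurability
  have h3 := (h2.indicator hS).lintegral_prod_right' (ν := volume)
  convert h3 using 2 with z
  exact (lintegral_indicator (measurable_prodMk_left hS) _).symm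

section Kernel

variable {F : ℝ → E3 → M33} (i j k : Fin 3) {T : ℝ}
  {t : ℝ} (x : E3)

theorem setLIntegral_spaceTimeKernel_le (hF : Measurable (Function.uncurry F)) :
    ∫⁻ z', ‖spaceTimeKernel i j k (t, x) z' * F z'.1 z'.2 (j, k)‖ₑ ∂cylinderMeasure T ≤
      potential (fun s y => ‖F s y‖ₑ) t x := by
  have hm : Measurable fun z' : ℝ × E3 =>
      spaceTimeKernel i j k (t, x) z' * F z'.1 z'.2 (j, k) :=
    (measurable_spaceTimeKernel i j k).of_uncurry_left.mul ((measurable_coord_M33 (j, k)).comp hF)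
  rw [lintegral_prod _ hm.enorm.aemeasurable, potential, ← lintegral_indicator measurableSet_Ioo,
    ← lintegral_indicator measurableSet_Ioo]
  refine lintegral_mono fun s => ?_
  by_cases hs : s ∈ Ioo 0 T
  · rw [indicator_of_mem hs]
    by_cases hst : s < t
    · rw [indicator_of_mem (show s ∈ Ioo 0 t from ⟨hs.1, hst⟩), lconv]
      refine lintegral_mono fun y => ?_
      simp only [spaceTimeKernel, if_pos hst]
      rw [enorm_mul]
      gcongr
      · unfold oseenMajorant
        refine le_trans ?_ (Finset.single_le_sum (fun _ _ => zero_le) (Finset.mem_univ i))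
        refine le_trans ?_ (Finset.single_le_sum (fun _ _ => zero_le) (Finset.mem_univ j))
        exact Finset.single_le_sum (f := fun k => ‖gradOseen i j k (t - s) (x - y)‖ₑ)
          (fun _ _ => zero_le) (Finset.mem_univ k)
      · exact enorm_apply_le _ _
    · simp [spaceTimeKernel, hst]
  · rw [indicator_of_notMem hs]; exact zero_le

theorem integrable_spaceTimeKernel (hF : Measurable (Function.uncurry F))
    (h : potential (fun s y => ‖F s y‖ₑ) t x < ⊤) :
    Integrable (fun z' => spaceTimeKernel i j k (t, x) z' * F z'.1 z'.2 (j, k))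
      (cylinderMeasure T) :=
  ⟨((measurable_spaceTimeKernel i j k).of_uncurry_left.mul
    ((measurable_coord_M33 (j, k)).comp hF)).aestronglyMeasurable,
    (setLIntegral_spaceTimeKernel_le i j k x hF).trans_lt h⟩

/-- Puts the Duhamel formula on a cylinder that does not depend on `t`, which prepares the exchange
of integrals in the duality argument. Fubini applies at the points where the potential is finite. -/
theorem duhamel_eq_integral_spaceTimeKernel (hF : Measurable (Function.uncurry F)) (ht : 0 < t)
    (htT : t ≤ T) (h : potential (fun s y => ‖F s y‖ₑ) t x < ⊤) :
    duhamel F t x i = ∑ j, ∑ k,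
      ∫ z', spaceTimeKernel i j k (t, x) z' * F z'.1 z'.2 (j, k) ∂cylinderMeasure T := by
  have hInt := fun j k => integrable_spaceTimeKernel (T := T) i j k x hF h
  rw [duhamel_apply_of_nonneg F ht.le]
  simp only [heatLerayDiv_apply]
  simp_rw [fun j k => integral_prod _ (hInt j k)]
  have h1 : ∀ s y, ∀ j k, spaceTimeKernel i j k (t, x) (s, y) * F s y (j, k) =
      (Iio t).indicator (fun s => gradOseen i j k (t - s) (x - y) * F s y (j, k)) s :=
    fun s y j k => by
      by_cases hst : s < t
      · simp [spaceTimeKernel, hst]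
      · simp [spaceTimeKernel, hst]
  have h2 : ∀ s, ∀ j k, ∫ y, spaceTimeKernel i j k (t, x) (s, y) * F s y (j, k) =
      (Iio t).indicator (fun s => ∫ y, gradOseen i j k (t - s) (x - y) * F s y (j, k)) s :=
    fun s j k => by
      simp only [h1]
      by_cases hst : s < t
      · simp [hst]
      · simp [hst]
  have hint2 := fun j k => (hInt j k).integral_prod_left
  simp only [h2] at hint2 ⊢
  have h3 : Iio t ∩ Ioo 0 T = Ioo 0 t := by
    ext s; simp only [mem_inter_iff, mem_Iio, mem_Ioo]; constructor
    · rintro ⟨h, h', -⟩; exact ⟨h', h⟩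
    · rintro ⟨h, h'⟩; exact ⟨h', h, h'.trans_le htT⟩
  have hint3 : ∀ j k, IntegrableOn (fun s => ∫ y, gradOseen i j k (t - s) (x - y) * F s y (j, k))
      (Ioo 0 t) := fun j k => by
    have := hint2 j k
    rwa [integrable_indicator_iff measurableSet_Iio, IntegrableOn,
      Measure.restrict_restrict measurableSet_Iio, h3] at this
  rw [integral_finsetSum _ fun j _ => integrable_finsetSum _ fun k _ => hint3 j k]
  refine Finset.sum_congr rfl fun j _ => ?_
  rw [integral_finsetSum _ fun k _ => hint3 j k]
  refine Finset.sum_congr rfl fun k _ => ?_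
  rw [integral_indicator measurableSet_Iio, Measure.restrict_restrict measurableSet_Iio, h3]

end Kernel

theorem eLpNorm_two_eq {α V : Type*} [MeasurableSpace α] [NormedAddCommGroup V] (μ : Measure α)
    (f : α → V) : eLpNorm f 2 μ = (∫⁻ z, ‖f z‖ₑ ^ (2 : ℝ) ∂μ) ^ (1 / 2 : ℝ) := by
  rw [eLpNorm_eq_lintegral_rpow_enorm_toReal (by norm_num) (by norm_num)]
  simp

theorem lintegral_enorm_mul_le_two {α V W : Type*} [MeasurableSpace α] [NormedAddCommGroup V]
    [NormedAddCommGroup W] {μ : Measure α} {f : α → V} {g : α → W}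
    (hf : AEMeasurable (fun z => ‖f z‖ₑ) μ) (hg : AEMeasurable (fun z => ‖g z‖ₑ) μ) :
    ∫⁻ z, ‖f z‖ₑ * ‖g z‖ₑ ∂μ ≤ eLpNorm f 2 μ * eLpNorm g 2 μ := by
  rw [eLpNorm_two_eq, eLpNorm_two_eq]
  exact ENNReal.lintegral_mul_le_Lp_mul_Lq μ Real.HolderConjugate.two_two hf hg

/-! ### Duality with the adjoint operator and the weak derivatives. -/

section Duality

variable {F : ℝ → E3 → M33} {T : ℝ} {η : ℝ × E3 → ℝ}

theorem lintegral_enorm_mul_potential_lt_top (hF : Measurable (Function.uncurry F))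
    (hpot : ∫⁻ z, potential (fun s y => ‖F s y‖ₑ) z.1 z.2 ^ (2 : ℝ) ∂cylinderMeasure T < ⊤)
    (hη : Measurable η) (hη2 : MemLp η 2 (cylinderMeasure T)) :
    ∫⁻ z, ‖η z‖ₑ * potential (fun s y => ‖F s y‖ₑ) z.1 z.2 ∂cylinderMeasure T < ⊤ := by
  have hpm : Measurable fun z : ℝ × E3 => potential (fun s y => ‖F s y‖ₑ) z.1 z.2 :=
    measurable_uncurry_potential (f := fun s y => ‖F s y‖ₑ) hF.enorm
  refine (ENNReal.lintegral_mul_le_Lp_mul_Lq _ Real.HolderConjugate.two_two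
    hη.enorm.aemeasurable hpm.aemeasurable).trans_lt ?_
  rw [← eLpNorm_two_eq]
  exact ENNReal.mul_lt_top hη2.2 (ENNReal.rpow_lt_top_of_nonneg (by norm_num) hpot.ne)

/-- Fubini, with absolute convergence from Cauchy-Schwarz: both the potential and `η` are square
integrable on the cylinder. -/
theorem integral_duhamel_mul_eq (hF : Measurable (Function.uncurry F))
    (hpot : ∫⁻ z, potential (fun s y => ‖F s y‖ₑ) z.1 z.2 ^ (2 : ℝ) ∂cylinderMeasure T < ⊤)
    (hη : Measurable η) (hη2 : MemLp η 2 (cylinderMeasure T)) (i : Fin 3) :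
    ∫ z, duhamel F z.1 z.2 i * η z ∂cylinderMeasure T = ∑ j, ∑ k, ∫ z', F z'.1 z'.2 (j, k) *
      ∫ z, spaceTimeKernel i j k z z' * η z ∂cylinderMeasure T ∂cylinderMeasure T := by
  have hpm : Measurable fun z : ℝ × E3 => potential (fun s y => ‖F s y‖ₑ) z.1 z.2 :=
    measurable_uncurry_potential (f := fun s y => ‖F s y‖ₑ) hF.enorm
  have hmem : ∀ᵐ z ∂cylinderMeasure T, z.1 ∈ Ioo 0 T :=
    (Measure.quasiMeasurePreserving_fst (μ := volume.restrict (Ioo 0 T))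
      (ν := (volume : Measure E3))).ae (ae_restrict_mem measurableSet_Ioo)
  have hfin : ∀ᵐ z ∂cylinderMeasure T, potential (fun s y => ‖F s y‖ₑ) z.1 z.2 < ⊤ := by
    filter_upwards [ae_lt_top (hpm.pow_const 2) hpot.ne] with z hz
    by_contra h
    rw [not_lt_top_iff] at h
    rw [h] at hz
    norm_num at hz
  have hG : ∀ j k, Integrable (Function.uncurry fun z z' : ℝ × E3 =>
      spaceTimeKernel i j k z z' * F z'.1 z'.2 (j, k) * η z)
      ((cylinderMeasure T).prod (cylinderMeasure T)) := fun j k => by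
    have hm : Measurable (Function.uncurry fun z z' : ℝ × E3 =>
        spaceTimeKernel i j k z z' * F z'.1 z'.2 (j, k) * η z) :=
      ((measurable_spaceTimeKernel i j k).mul
        ((measurable_coord_M33 (j, k)).comp (hF.comp measurable_snd))).mul (hη.comp measurable_fst)
    refine ⟨hm.aestronglyMeasurable, ?_⟩
    rw [hasFiniteIntegral_iff_enorm, lintegral_prod _ hm.enorm.aemeasurable]
    refine lt_of_le_of_lt ?_ (lintegral_enorm_mul_potential_lt_top hF hpot hη hη2)
    refine lintegral_mono_ae ?_
    filter_upwards with z
    simp only [Function.uncurry, enorm_mul (_ * _)]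
    rw [lintegral_mul_const]
    · rw [mul_comm]
      gcongr
      exact setLIntegral_spaceTimeKernel_le i j k z.2 hF
    · exact ((measurable_spaceTimeKernel i j k).of_uncurry_left.mul
        ((measurable_coord_M33 (j, k)).comp hF)).enorm
  calc _ = ∫ z, ∑ j, ∑ k, ∫ z', spaceTimeKernel i j k z z' * F z'.1 z'.2 (j, k) * η z
          ∂cylinderMeasure T ∂cylinderMeasure T := by
        refine integral_congr_ae ?_
        filter_upwards [hmem, hfin] with z hz hz'
        rw [duhamel_eq_integral_spaceTimeKernel i z.2 hF hz.1 hz.2.le hz']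
        simp only [Finset.sum_mul, integral_mul_const]
    _ = ∑ j, ∑ k, ∫ z, ∫ z', spaceTimeKernel i j k z z' * F z'.1 z'.2 (j, k) * η z
          ∂cylinderMeasure T ∂cylinderMeasure T := by
        have h1 : ∀ j k, Integrable (fun z => ∫ z', spaceTimeKernel i j k z z' *
            F z'.1 z'.2 (j, k) * η z ∂cylinderMeasure T) (cylinderMeasure T) :=
          fun j k => (hG j k).integral_prod_left
        rw [integral_finsetSum _ fun j _ => integrable_finsetSum _ fun k _ => h1 j k]
        refine Finset.sum_congr rfl fun j _ => ?_
        rw [integral_finsetSum _ fun k _ => h1 j k]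
    _ = _ := by
        refine Finset.sum_congr rfl fun j _ => Finset.sum_congr rfl fun k _ => ?_
        rw [integral_integral_swap (hG j k)]
        refine integral_congr_ae (ae_of_all _ fun z' => ?_)
        simp only [← integral_const_mul]
        refine integral_congr_ae (ae_of_all _ fun z => ?_)
        simp only
        ring

/-- Cauchy-Schwarz after passing to the adjoint. The constant is 18 = 9 · 2: nine index pairs (j,k),
each with the operator bound 2 = √4. -/
theorem enorm_integral_duhamel_mul_deriv_le (hF : Measurable (Function.uncurry F))
    (hpot : ∫⁻ z, potential (fun s y => ‖F s y‖ₑ) z.1 z.2 ^ (2 : ℝ) ∂cylinderMeasure T < ⊤)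
    {ψ : ℝ × E3 → ℝ} (hψ : ContDiff ℝ ∞ ψ) (hc : HasCompactSupport ψ) (i m : Fin 3) :
    ‖∫ z, duhamel F z.1 z.2 i * fderiv ℝ ψ z (0, e m) ∂cylinderMeasure T‖ₑ ≤
      (18 * eLpNorm (Function.uncurry F) 2 (cylinderMeasure T)) *
        eLpNorm ψ 2 (cylinderMeasure T) := by
  have hηc := continuous_spatialDeriv hψ m
  have hηs := hasCompactSupport_spatialDeriv hc m
  rw [integral_duhamel_mul_eq hF hpot hηc.measurable (hηc.memLp_of_hasCompactSupport hηs)]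
  have key : ∀ j k, ‖∫ z', F z'.1 z'.2 (j, k) *
      ∫ z, spaceTimeKernel i j k z z' * fderiv ℝ ψ z (0, e m) ∂cylinderMeasure T
        ∂cylinderMeasure T‖ₑ ≤ eLpNorm (Function.uncurry F) 2 (cylinderMeasure T) *
        (2 * eLpNorm ψ 2 (cylinderMeasure T)) := fun j k => by
    have hm : Measurable fun z' : ℝ × E3 =>
        ∫ z, spaceTimeKernel i j k z z' * fderiv ℝ ψ z (0, e m) ∂cylinderMeasure T := by
      have h : Measurable (Function.uncurry fun z' z : ℝ × E3 =>
          spaceTimeKernel i j k z z' * fderiv ℝ ψ z (0, e m)) :=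
        ((measurable_spaceTimeKernel i j k).comp measurable_swap).mul
          (hηc.measurable.comp measurable_snd)
      exact (h.stronglyMeasurable.integral_prod_right').measurable
    refine (enorm_integral_le_lintegral_enorm _).trans ?_
    calc _ ≤ ∫⁻ z', ‖Function.uncurry F z'‖ₑ * ‖∫ z, spaceTimeKernel i j k z z' *
            fderiv ℝ ψ z (0, e m) ∂cylinderMeasure T‖ₑ ∂cylinderMeasure T := by
          refine lintegral_mono fun z' => ?_
          rw [enorm_mul]
          gcongr
          exact enorm_apply_le _ _
      _ ≤ _ := lintegral_enorm_mul_le_two hF.enorm.aemeasurable hm.enorm.aemeasurable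
      _ ≤ _ := by
          gcongr
          rw [eLpNorm_two_eq, eLpNorm_two_eq]
          refine (ENNReal.rpow_le_rpow (lintegral_adjoint_sq_le i j k T hψ hc m)
            (by norm_num)).trans (le_of_eq ?_)
          rw [ENNReal.mul_rpow_of_nonneg _ _ (by norm_num)]
          congr 1
          rw [show (4 : ℝ≥0∞) = 2 ^ (2 : ℝ) by norm_num, ← ENNReal.rpow_mul]
          norm_num
  calc _ ≤ ∑ j : Fin 3, ∑ k : Fin 3, eLpNorm (Function.uncurry F) 2 (cylinderMeasure T) *
        (2 * eLpNorm ψ 2 (cylinderMeasure T)) := by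
        refine (enorm_sum_le _ _).trans (Finset.sum_le_sum fun j _ => ?_)
        exact (enorm_sum_le _ _).trans (Finset.sum_le_sum fun k _ => key j k)
    _ = _ := by
        simp only [Finset.sum_const, Finset.card_univ, Fintype.card_fin, nsmul_eq_mul]
        push_cast
        ring

/-- Smooth compactly supported functions. -/
def testFunctions : Submodule ℝ (ℝ × E3 → ℝ) where
  carrier := {ψ | ContDiff ℝ ∞ ψ ∧ HasCompactSupport ψ}
  add_mem' h h' := ⟨h.1.add h'.1, h.2.add h'.2⟩
  zero_mem' := ⟨contDiff_const, HasCompactSupport.zero⟩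
  smul_mem' c _ h := ⟨contDiff_const.smul h.1, h.2.smul_left (f := fun _ => c)⟩

theorem memLp_testFunctions (ψ : testFunctions) (μ : Measure (ℝ × E3))
    [IsFiniteMeasureOnCompacts μ] : MemLp (ψ : ℝ × E3 → ℝ) 2 μ :=
  ψ.2.1.continuous.memLp_of_hasCompactSupport ψ.2.2

/-- The distributional derivative is a linear form on test functions that is bounded in the L² norm
of the cylinder, so Riesz representation gives its density. -/
theorem exists_weak_derivative (hF : Measurable (Function.uncurry F))
    (hF2 : MemLp (Function.uncurry F) 2 (cylinderMeasure T))
    (hpot : ∫⁻ z, potential (fun s y => ‖F s y‖ₑ) z.1 z.2 ^ (2 : ℝ) ∂cylinderMeasure T < ⊤)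
    (i m : Fin 3) : ∃ g : ℝ × E3 → ℝ, MemLp g 2 (cylinderMeasure T) ∧
      ∀ ψ : ℝ × E3 → ℝ, ContDiff ℝ ∞ ψ → HasCompactSupport ψ →
        ∫ z, duhamel F z.1 z.2 i * fderiv ℝ ψ z (0, e m) ∂cylinderMeasure T =
          -∫ z, g z * ψ z ∂cylinderMeasure T := by
  have hd : ∀ ψ : testFunctions, Differentiable ℝ (ψ : ℝ × E3 → ℝ) := fun ψ =>
    ψ.2.1.differentiable (by simp)
  have hInt : ∀ ψ : testFunctions, Integrable (fun z : ℝ × E3 => duhamel F z.1 z.2 i *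
      fderiv ℝ (ψ : ℝ × E3 → ℝ) z (0, e m)) (cylinderMeasure T) := fun ψ => by
    have hηc := continuous_spatialDeriv ψ.2.1 m
    have hηs := hasCompactSupport_spatialDeriv ψ.2.2 m
    have hdm : Measurable fun z : ℝ × E3 => duhamel F z.1 z.2 i :=
      (by fun_prop : Measurable fun v : E3 => v i).comp (measurable_duhamel hF)
    refine ⟨(hdm.mul hηc.measurable).aestronglyMeasurable, lt_of_le_of_lt ?_
      (lintegral_enorm_mul_potential_lt_top hF hpot hηc.measurable
        (hηc.memLp_of_hasCompactSupport hηs))⟩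
    have hmem : ∀ᵐ z ∂cylinderMeasure T, z.1 ∈ Ioo 0 T :=
      (Measure.quasiMeasurePreserving_fst (μ := volume.restrict (Ioo 0 T))
        (ν := (volume : Measure E3))).ae (ae_restrict_mem measurableSet_Ioo)
    refine lintegral_mono_ae ?_
    filter_upwards [hmem] with z hz
    rw [enorm_mul, mul_comm]
    gcongr
    exact (enorm_apply_le _ _).trans (enorm_duhamel_le hF hz.1.le z.2)
  set ι : testFunctions →ₗ[ℝ] Lp ℝ 2 (cylinderMeasure T) :=
    { toFun := fun ψ => (memLp_testFunctions ψ _).toLp _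
      map_add' := fun ψ ψ' => MemLp.toLp_add _ _
      map_smul' := fun c ψ => MemLp.toLp_const_smul c _ } with hι
  set l : testFunctions →ₗ[ℝ] ℝ :=
    { toFun := fun ψ => ∫ z, duhamel F z.1 z.2 i * fderiv ℝ (ψ : ℝ × E3 → ℝ) z (0, e m)
        ∂cylinderMeasure T
      map_add' := fun ψ ψ' => by
        rw [← integral_add (hInt ψ) (hInt ψ')]
        refine integral_congr_ae (ae_of_all _ fun z => ?_)
        have h := fderiv_add (hd ψ z) (hd ψ' z)
        have h' : fderiv ℝ ((ψ + ψ' : testFunctions) : ℝ × E3 → ℝ) z =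
          fderiv ℝ (ψ : ℝ × E3 → ℝ) z + fderiv ℝ (ψ' : ℝ × E3 → ℝ) z := h
        simp only [h', _root_.add_apply, mul_add]
      map_smul' := fun c ψ => by
        rw [RingHom.id_apply, smul_eq_mul, ← integral_const_mul]
        refine integral_congr_ae (ae_of_all _ fun z => ?_)
        have h := fderiv_const_smul (hd ψ z) c
        have h' : fderiv ℝ ((c • ψ : testFunctions) : ℝ × E3 → ℝ) z =
          c • fderiv ℝ (ψ : ℝ × E3 → ℝ) z := h
        simp only [h', _root_.smul_apply, smul_eq_mul]
        ring } with hl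
  have hA : 18 * eLpNorm (Function.uncurry F) 2 (cylinderMeasure T) < ⊤ :=
    ENNReal.mul_lt_top (by norm_num) hF2.2
  obtain ⟨g, hg⟩ := exists_inner_eq_of_abs_le ι l
    (18 * eLpNorm (Function.uncurry F) 2 (cylinderMeasure T)).toReal fun ψ => by
      have h := enorm_integral_duhamel_mul_deriv_le hF hpot ψ.2.1 ψ.2.2 i m
      have h2 := ENNReal.toReal_mono (ENNReal.mul_lt_top hA (memLp_testFunctions ψ _).2).ne h
      rw [ENNReal.toReal_mul (b := eLpNorm _ _ _), toReal_enorm, Real.norm_eq_abs] at h2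
      have h3 : ‖ι ψ‖ = (eLpNorm (ψ : ℝ × E3 → ℝ) 2 (cylinderMeasure T)).toReal :=
        Lp.norm_toLp _ (memLp_testFunctions ψ _)
      rw [h3]
      exact h2
  -- The sign is the one of integration by parts.
  refine ⟨fun z => -g z, (Lp.memLp g).neg, fun ψ hψ hc => ?_⟩
  have h1 := hg ⟨ψ, hψ, hc⟩
  have h2 : l ⟨ψ, hψ, hc⟩ =
    ∫ z, duhamel F z.1 z.2 i * fderiv ℝ ψ z (0, e m) ∂cylinderMeasure T := rfl
  rw [← h2, h1, L2.inner_def, ← integral_neg]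
  refine integral_congr_ae ?_
  filter_upwards [(memLp_testFunctions ⟨ψ, hψ, hc⟩ (cylinderMeasure T)).coeFn_toLp] with z hz
  have h3 : (ι ⟨ψ, hψ, hc⟩ : ℝ × E3 → ℝ) z = ψ z := hz
  rw [h3]
  simp [mul_comm]

theorem hasL2Gradient_of_ae_eq_duhamel (hT : 0 < T) (hF : Measurable (Function.uncurry F))
    (hF2 : MemLp (Function.uncurry F) 2 (cylinderMeasure T))
    (hpot : ∫⁻ z, potential (fun s y => ‖F s y‖ₑ) z.1 z.2 ^ (2 : ℝ) ∂cylinderMeasure T < ⊤)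
    {w : ℝ → E3 → E3} (hw : Function.uncurry w =ᵐ[cylinderMeasure T] Function.uncurry (duhamel F))
    (hw2 : MemLp (Function.uncurry w) 2 (cylinderMeasure T)) :
    HasL2Gradient (ENNReal.ofReal T) w := by
  choose g hg hg' using exists_weak_derivative hF hF2 hpot
  refine ⟨locallyIntegrableOn_of_memLp_two (by rwa [restrict_Q_eq hT]),
    fun z => WithLp.toLp 2 fun ij => g ij.1 ij.2 z, ?_, fun i j ψ hψ hc _ => ?_⟩
  · rw [restrict_Q_eq hT]
    exact MemLp.of_eval_piLp fun ij => hg ij.1 ij.2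
  · rw [restrict_Q_eq hT]
    refine Eq.trans (integral_congr_ae ?_) (hg' i j ψ hψ hc)
    filter_upwards [hw] with z hz
    have : w z.1 z.2 = duhamel F z.1 z.2 := hz
    rw [this]

end Duality

/-! ### Finite energy forcing for measurable fields -/

/-! ### Independence of the almost everywhere representative of P₀. -/

section Congruence

/-- The Duhamel integral sees only the almost everywhere class of the forcing on the cylinder, so
equality holds at every point. This lets P₀, which in the forced case is only almost everywhere
strongly measurable, be replaced by a measurable representative. -/
theorem duhamel_congr {F G : ℝ → E3 → M33} {T : ℝ}
    (h : Function.uncurry F =ᵐ[cylinderMeasure T] Function.uncurry G) {t : ℝ}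
    (ht : t ∈ Icc 0 T) (x : E3) : duhamel F t x = duhamel G t x := by
  have h1 := ae_restrict_of_ae_restrict_of_subset (Ioo_subset_Ioo_right ht.2)
    (Measure.ae_ae_of_ae_prod h)
  ext i
  rw [duhamel_apply_of_nonneg F ht.1, duhamel_apply_of_nonneg G ht.1]
  refine integral_congr_ae ?_
  filter_upwards [h1] with s hs
  simp only [heatLerayDiv_apply]
  refine Finset.sum_congr rfl fun j _ => Finset.sum_congr rfl fun k _ => integral_congr_ae ?_
  filter_upwards [hs] with y hy
  have : F s y = G s y := hy
  rw [this]

theorem tensor_congr {U V U' V' : ℝ → E3 → E3} {μ : Measure (ℝ × E3)}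
    (hU : Function.uncurry U =ᵐ[μ] Function.uncurry U')
    (hV : Function.uncurry V =ᵐ[μ] Function.uncurry V') :
    Function.uncurry (tensor U V) =ᵐ[μ] Function.uncurry (tensor U' V') := by
  filter_upwards [hU, hV] with z h1 h2
  have h1' : U z.1 z.2 = U' z.1 z.2 := h1
  have h2' : V z.1 z.2 = V' z.1 z.2 := h2
  simp only [Function.uncurry, tensor, h1', h2']

theorem ae_mem_Ioo_cylinderMeasure (T : ℝ) : ∀ᵐ z ∂cylinderMeasure T, z.1 ∈ Ioo 0 T :=
  (Measure.quasiMeasurePreserving_fst (μ := volume.restrict (Ioo 0 T))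
    (ν := (volume : Measure E3))).ae (ae_restrict_mem measurableSet_Ioo)

variable {P₀ P₀' : ℝ → E3 → E3} {T : ℝ}

theorem picard_congr (h : Function.uncurry P₀ =ᵐ[cylinderMeasure T] Function.uncurry P₀') (k : ℕ) :
    Function.uncurry (picard P₀ k) =ᵐ[cylinderMeasure T] Function.uncurry (picard P₀' k) := by
  induction k with
  | zero => exact h
  | succ k ih =>
    filter_upwards [h, ae_mem_Ioo_cylinderMeasure T] with z hz hzT
    have hz' : P₀ z.1 z.2 = P₀' z.1 z.2 := hz
    simp only [Function.uncurry, picard, Pi.sub_apply, hz', bilinearTerm,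
      duhamel_congr (tensor_congr ih ih) (Ioo_subset_Icc_self hzT)]

theorem picardPred_congr (h : Function.uncurry P₀ =ᵐ[cylinderMeasure T] Function.uncurry P₀')
    (k : ℕ) :
    Function.uncurry (picardPred P₀ k) =ᵐ[cylinderMeasure T] Function.uncurry (picardPred P₀' k) := by
  cases k with
  | zero => rfl
  | succ k => exact picard_congr h k

theorem picardForcing_congr (h : Function.uncurry P₀ =ᵐ[cylinderMeasure T] Function.uncurry P₀')
    (k : ℕ) : Function.uncurry (picardForcing P₀ k) =ᵐ[cylinderMeasure T]
      Function.uncurry (picardForcing P₀' k) :=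
  (tensor_congr (picard_congr h k) (picard_congr h k)).sub
    (tensor_congr (picardPred_congr h k) (picardPred_congr h k))

theorem picard_succ_sub_congr (h : Function.uncurry P₀ =ᵐ[cylinderMeasure T] Function.uncurry P₀')
    (k : ℕ) {t : ℝ} (ht : t ∈ Icc 0 T) :
    (picard P₀ (k + 1) - picard P₀ k) t = (picard P₀' (k + 1) - picard P₀' k) t := by
  ext1 x
  rw [picard_succ_sub, picard_succ_sub, Pi.sub_apply, Pi.sub_apply, Pi.sub_apply, Pi.sub_apply,
    duhamel_congr (tensor_congr (picard_congr h k) (picard_congr h k)) ht,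
    duhamel_congr (tensor_congr (picardPred_congr h k) (picardPred_congr h k)) ht]

end Congruence

theorem duhamel_neg (F : ℝ → E3 → M33) : duhamel (-F) = -duhamel F := by
  ext t x i
  simp [duhamel, heatLerayDiv, integral_neg]

theorem lintegral_sq_cylinderMeasure_le {T : ℝ} {f : ℝ → E3 → ℝ≥0∞}
    (hf : Measurable (Function.uncurry f)) {K : ℝ≥0∞} (h : ∀ t ∈ Ioo 0 T, lnorm 2 (f t) ≤ K) :
    ∫⁻ z, f z.1 z.2 ^ (2 : ℝ) ∂cylinderMeasure T ≤ K ^ (2 : ℝ) * ENNReal.ofReal T := by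
  have hm : Measurable fun z : ℝ × E3 => f z.1 z.2 ^ (2 : ℝ) := hf.pow_const 2
  rw [lintegral_prod _ hm.aemeasurable]
  calc _ ≤ ∫⁻ _ in Ioo 0 T, K ^ (2 : ℝ) := by
        refine setLIntegral_mono' measurableSet_Ioo fun t ht => ?_
        rw [← lnorm_rpow two_pos]
        exact ENNReal.rpow_le_rpow (h t ht) (by norm_num)
    _ = _ := by simp

/-- The square of t^{-1/4} has integral 2 T^{1/2} over ]0,T[. Taking the root gives T^{1/4}, and the
2 in the constant absorbs √2. -/
theorem eLpNorm_two_le_of_FBound {F : ℝ → E3 → M33} (hF : Measurable (Function.uncurry F))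
    {T : ℝ} (hT : 0 < T) {N : ℝ≥0} (h : FBound (1 / 2) N T F) :
    eLpNorm (Function.uncurry F) 2 (cylinderMeasure T) ≤
      ENNReal.ofReal (T ^ (1 / 4 : ℝ)) * (2 * N : ℝ≥0) := by
  have hm : Measurable fun z : ℝ × E3 => ‖Function.uncurry F z‖ₑ ^ (2 : ℝ) := hF.enorm.pow_const 2
  rw [eLpNorm_two_eq, lintegral_prod _ hm.aemeasurable]
  have h1 : ∫⁻ s in Ioo 0 T, ∫⁻ x, ‖Function.uncurry F (s, x)‖ₑ ^ (2 : ℝ) ≤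
      (N : ℝ≥0∞) ^ (2 : ℝ) * ENNReal.ofReal (2 * T ^ (1 / 2 : ℝ)) := by
    have h2 : ∫⁻ s in Ioo 0 T, ENNReal.ofReal (s ^ (-(1 / 2) : ℝ)) =
        ENNReal.ofReal (2 * T ^ (1 / 2 : ℝ)) := by
      rw [lintegral_rpow_neg_Ioo (by norm_num) hT]
      congr 1
      norm_num
      ring
    rw [← h2, ← lintegral_const_mul _ (by fun_prop)]
    refine lintegral_mono_ae ?_
    filter_upwards [h, ae_restrict_mem measurableSet_Ioo] with s hs hs'
    change ∫⁻ x, ‖F s x‖ₑ ^ (2 : ℝ) ≤ _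
    norm_num only at hs
    rw [← lnorm_rpow two_pos (f := fun x => ‖F s x‖ₑ)]
    refine (ENNReal.rpow_le_rpow hs (by norm_num)).trans (le_of_eq ?_)
    rw [ENNReal.mul_rpow_of_nonneg _ _ (by norm_num),
      ENNReal.ofReal_rpow_of_pos (Real.rpow_pos_of_pos hs'.1 _), ← Real.rpow_mul hs'.1.le]
    norm_num
  refine (ENNReal.rpow_le_rpow h1 (by norm_num)).trans ?_
  rw [ENNReal.mul_rpow_of_nonneg _ _ (by norm_num), ← ENNReal.rpow_mul,
    ENNReal.ofReal_rpow_of_nonneg (by positivity) (by norm_num),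
    Real.mul_rpow (by norm_num) (by positivity), ← Real.rpow_mul hT.le]
  have h3 : (2 : ℝ) ^ (1 / 2 : ℝ) ≤ 2 := by
    calc (2 : ℝ) ^ (1 / 2 : ℝ) ≤ 2 ^ (1 : ℝ) :=
          Real.rpow_le_rpow_of_exponent_le (by norm_num) (by norm_num)
      _ = 2 := Real.rpow_one 2
  calc _ ≤ (N : ℝ≥0∞) * ENNReal.ofReal (2 * T ^ (1 / 4 : ℝ)) := by
        norm_num only
        rw [ENNReal.rpow_one]
        gcongr
    _ = _ := by
        rw [ENNReal.ofReal_mul (by norm_num)]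
        push_cast
        simp only [ENNReal.ofReal_ofNat]
        ring

theorem katoNorm_le {V : Type*} [NormedAddCommGroup V] {s : ℝ} {p : ℝ≥0∞} {T : ℝ} (hT : 0 < T)
    {u : ℝ → E3 → V} {C : ℝ≥0∞} (h : ∀ᵐ t ∂volume.restrict (Ioo 0 T),
      ENNReal.ofReal (t ^ (-s / 2)) * eLpNorm (u t) p volume ≤ C) :
    katoNorm s p (ENNReal.ofReal T) u ≤ C := by
  rw [katoNorm, timeInterval_ofReal hT]
  exact essSup_le_of_ae_le _ h

/-- Finite energy forcing, for an initial iterate that agrees almost everywhere with a measurable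
field in `𝒦_p`, `p ≥ 4`. -/
theorem exists_finiteEnergyForcing_of_KBound {p : ℝ} (hp : 4 ≤ p) (M : ℝ≥0) {k : ℕ}
    (hk : p / 2 - 2 ≤ k) : ∃ C : ℝ≥0, ∀ (T : ℝ) (P₀ P₀' : ℝ → E3 → E3), 0 < T →
      Function.uncurry P₀ =ᵐ[cylinderMeasure T] Function.uncurry P₀' →
      Measurable (Function.uncurry P₀') → KBound (1 / p) M T P₀' →
      FiniteEnergyForcing P₀ k T C := by
  obtain ⟨C, hC0, hC⟩ := exists_picard_bounds hp M k
  obtain ⟨A, hA0, hA⟩ := exists_lnorm_potential_le_of_FBound (b := 1 / 2) (b' := 1 / 2)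
    (by norm_num) le_rfl (by norm_num) (by norm_num)
  set N : ℝ≥0 := C * C + C * C with hN
  have hN0 : 0 < N := by positivity
  -- The condition p/2 - 2 ≤ k is equivalent to 1/2 - 1/p ≤ (k + 1)/p: the cap has been reached and
  -- the forcing has index exactly 1/2.
  have hexp : incrementExponent p k + 1 / p = 1 / 2 := by
    rw [incrementExponent, min_eq_right]
    · ring
    · rw [le_div_iff₀ (by linarith)]
      field_simp
      linarith
  -- `N` bounds the forcing in ℱ_2 and `A * N` the increment in 𝒦_2; the factor 2 is needed for the
  -- L² norm of the forcing on the cylinder.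
  refine ⟨2 * N + A * N, fun T P₀ P₀' hT hPP hm hK => ?_⟩
  obtain ⟨h1, h2, h3⟩ := hC T P₀' hm hK
  have hF := FBound_picardForcing hp hm h1 h2 h3
  rw [hexp, ← hN] at hF
  set F := picardForcing P₀' k with hFdef
  have hFm : Measurable (Function.uncurry F) := measurable_picardForcing hm k
  set w := picard P₀ (k + 1) - picard P₀ k with hw
  have hwt : ∀ t ∈ Icc 0 T, w t =ᵐ[volume] duhamel (-F) t := fun t ht => by
    rw [hw, picard_succ_sub_congr hPP k ht, duhamel_neg]
    -- Continuity is claimed on the closed interval; at t = 0 all Duhamel terms vanish.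
    rcases ht.1.eq_or_lt with rfl | ht0
    · rw [picard_succ_sub, Pi.sub_apply, Pi.neg_apply, duhamel_at_zero, duhamel_at_zero,
        duhamel_at_zero, sub_zero, neg_zero]
    · exact picard_succ_sub_ae hp hm h1 h2 ht0 ht.2
  have hFneg : Measurable (Function.uncurry (-F)) := hFm.neg
  have hwm : Measurable (Function.uncurry (duhamel (-F))) := measurable_duhamel hFneg
  have hdiff : Measurable (Function.uncurry (picard P₀' (k + 1) - picard P₀' k)) :=
    (measurable_picard hm (k + 1)).sub (measurable_picard hm k)
  have hwae : Function.uncurry w =ᵐ[cylinderMeasure T] Function.uncurry (duhamel (-F)) := by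
    have e1 : Function.uncurry w =ᵐ[cylinderMeasure T]
        Function.uncurry (picard P₀' (k + 1) - picard P₀' k) := by
      filter_upwards [ae_mem_Ioo_cylinderMeasure T] with z hz
      exact congrFun (picard_succ_sub_congr hPP k (Ioo_subset_Icc_self hz)) z.2
    refine e1.trans ?_
    -- The identity is known at each time for almost every x. Measurability of both sides, available
    -- for the representative P₀', upgrades it to almost every (t,x).
    refine (Measure.ae_prod_iff_ae_ae (measurableSet_eq_fun hdiff hwm)).2 ?_
    filter_upwards [ae_restrict_mem measurableSet_Ioo] with t ht
    have := hwt t (Ioo_subset_Icc_self ht)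
    rw [hw, picard_succ_sub_congr hPP k (Ioo_subset_Icc_self ht)] at this
    exact this
  have hpot : ∀ t ∈ Ioo 0 T, lnorm 2 (potential (fun s y => ‖(-F) s y‖ₑ) t) ≤
      (A * N : ℝ≥0) * ENNReal.ofReal (t ^ (1 / 4 : ℝ)) := fun t ht => by
    have := hA N hN0 (-F) hFneg T hF.neg t ht.1 ht.2.le
    norm_num at this ⊢
    exact this
  have hpotT : ∀ t ∈ Ioo 0 T, lnorm 2 (potential (fun s y => ‖(-F) s y‖ₑ) t) ≤
      (A * N : ℝ≥0) * ENNReal.ofReal (T ^ (1 / 4 : ℝ)) := fun t ht => by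
    refine (hpot t ht).trans ?_
    gcongr
    · exact ht.1.le
    · exact ht.2.le
  have hfin : ((A * N : ℝ≥0) * ENNReal.ofReal (T ^ (1 / 4 : ℝ)) : ℝ≥0∞) ^ (2 : ℝ) *
      ENNReal.ofReal T < ⊤ :=
    ENNReal.mul_lt_top (ENNReal.rpow_lt_top_of_nonneg (by norm_num)
      (ENNReal.mul_lt_top ENNReal.coe_lt_top ENNReal.ofReal_lt_top).ne) ENNReal.ofReal_lt_top
  have hpot2 : ∫⁻ z, potential (fun s y => ‖(-F) s y‖ₑ) z.1 z.2 ^ (2 : ℝ) ∂cylinderMeasure T < ⊤ :=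
    (lintegral_sq_cylinderMeasure_le (measurable_uncurry_potential
      (f := fun s y => ‖(-F) s y‖ₑ) hFneg.enorm) hpotT).trans_lt hfin
  have hwn : ∀ t ∈ Ioo 0 T, eLpNorm (w t) 2 volume ≤
      lnorm 2 (potential (fun s y => ‖(-F) s y‖ₑ) t) := fun t ht => by
    rw [eLpNorm_congr_ae (hwt t (Ioo_subset_Icc_self ht)), ← lnorm_two_eq_eLpNorm]
    exact lnorm_mono (by norm_num) (ae_of_all _ fun x => enorm_duhamel_le hFneg ht.1.le x)
  have hFae := picardForcing_congr hPP k
  have hFe := eLpNorm_two_le_of_FBound hFm hT hF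
  have hF2 : MemLp (Function.uncurry F) 2 (cylinderMeasure T) :=
    ⟨hFm.aestronglyMeasurable, hFe.trans_lt (ENNReal.mul_lt_top ENNReal.ofReal_lt_top
      ENNReal.coe_lt_top)⟩
  have hFP2 : MemLp (Function.uncurry (picardForcing P₀ k)) 2 (volume.restrict
      (Q (ENNReal.ofReal T))) := by
    rw [restrict_Q_eq hT]
    exact (memLp_congr_ae hFae).2 hF2
  have hw2 : MemLp (Function.uncurry w) 2 (cylinderMeasure T) := by
    refine (memLp_congr_ae hwae).2 ⟨hwm.aestronglyMeasurable, ?_⟩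
    rw [eLpNorm_two_eq]
    refine ENNReal.rpow_lt_top_of_nonneg (by norm_num) (ne_of_lt ?_)
    refine lt_of_le_of_lt (lintegral_mono_ae ?_) hpot2
    filter_upwards [ae_mem_Ioo_cylinderMeasure T] with z hz
    exact ENNReal.rpow_le_rpow (enorm_duhamel_le hFneg hz.1.le z.2) (by norm_num)
  have hkF : katoNorm (sF 2) 2 (ENNReal.ofReal T) (picardForcing P₀ k) ≤ N := by
    refine katoNorm_le hT ?_
    filter_upwards [hF, ae_restrict_mem measurableSet_Ioo, Measure.ae_ae_of_ae_prod hFae]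
      with t ht ht' hae
    have hae' : picardForcing P₀ k t =ᵐ[volume] F t := hae
    norm_num only at ht
    rw [eLpNorm_congr_ae hae', ← lnorm_two_eq_eLpNorm]
    calc _ ≤ ENNReal.ofReal (t ^ (-sF 2 / 2)) * (N * ENNReal.ofReal (t ^ (-(1 / 4) : ℝ))) := by
          gcongr
      _ = _ := by
          rw [mul_left_comm, ← ENNReal.ofReal_mul (by have := ht'.1; positivity),
            ← Real.rpow_add ht'.1]
          norm_num [sF]
  have hkw : katoNorm (sK 2) 2 (ENNReal.ofReal T) w ≤ (A * N : ℝ≥0) := by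
    refine katoNorm_le hT ?_
    filter_upwards [ae_restrict_mem measurableSet_Ioo] with t ht
    calc _ ≤ ENNReal.ofReal (t ^ (-sK 2 / 2)) *
          ((A * N : ℝ≥0) * ENNReal.ofReal (t ^ (1 / 4 : ℝ))) := by
          gcongr
          exact (hwn t ht).trans (hpot t ht)
      _ = _ := by
          rw [mul_left_comm, ← ENNReal.ofReal_mul (by have := ht.1; positivity),
            ← Real.rpow_add ht.1]
          norm_num [sK]
  have hkw0 : katoNorm 0 2 (ENNReal.ofReal T) w ≤
      (A * N : ℝ≥0) * ENNReal.ofReal (T ^ (1 / 4 : ℝ)) := by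
    refine katoNorm_le hT ?_
    filter_upwards [ae_restrict_mem measurableSet_Ioo] with t ht
    simpa using (hwn t ht).trans (hpotT t ht)
  obtain ⟨v, hv, hv'⟩ := continuousInL2_duhamel hFneg hN0 hF.neg
  exact
    { forcing_memLp := hFP2
      continuous_diff := ⟨v, hv, fun t ht => (hwt t ht).trans (hv' t ht)⟩
      gradient_diff := hasL2Gradient_of_ae_eq_duhamel hT hFneg hF2.neg hpot2 hwae hw2
      forcing_memKato := ⟨locallyIntegrableOn_of_memLp_two hFP2, hkF.trans_lt ENNReal.coe_lt_top⟩
      diff_memKato := ⟨locallyIntegrableOn_of_memLp_two (by rwa [restrict_Q_eq hT]),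
        hkw.trans_lt ENNReal.coe_lt_top⟩
      kato_bound := by
        refine (add_le_add hkF hkw).trans ?_
        rw [← ENNReal.coe_add, ENNReal.coe_le_coe]
        gcongr
        exact le_mul_of_one_le_left (zero_le) (by norm_num)
      energy_bound := by
        rw [restrict_Q_eq hT, eLpNorm_congr_ae hFae]
        refine (add_le_add hFe hkw0).trans (le_of_eq ?_)
        push_cast
        ring }

/-! ### Data in Kato spaces -/

/-- Raising p to max(p,4) costs nothing: for p < 4 the requirement becomes 0 ≤ k. -/
theorem le_two_div_max {p : ℝ} {k : ℕ} (hk : ⌈p / 2⌉ - 2 ≤ (k : ℤ)) : max p 4 / 2 - 2 ≤ k := by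
  rcases max_cases p 4 with ⟨h, -⟩ | ⟨h, -⟩
  · rw [h]
    have h1 := Int.le_ceil (p / 2)
    have h2 : ((⌈p / 2⌉ - 2 : ℤ) : ℝ) ≤ ((k : ℤ) : ℝ) := Int.cast_le.2 hk
    push_cast at h2
    linarith
  · rw [h]
    norm_num

/-- Interpolation between L^p and L^∞, from f^r = f^{r-p} f^p. -/
theorem lnorm_rpow_le_of_ae_le {p r : ℝ} (hp : 0 < p) (hpr : p ≤ r) {f : E3 → ℝ≥0∞} {S : ℝ≥0∞}
    (hS' : S ≠ ⊤) (hS : ∀ᵐ x, f x ≤ S) : lnorm r f ^ r ≤ S ^ (r - p) * lnorm p f ^ p := by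
  rw [lnorm_rpow (hp.trans_le hpr), lnorm_rpow hp]
  rw [← lintegral_const_mul' _ _ (ENNReal.rpow_ne_top_of_nonneg (by linarith) hS')]
  refine lintegral_mono_ae ?_
  filter_upwards [hS] with x hx
  calc f x ^ r = f x ^ (r - p) * f x ^ p := by
        rw [← ENNReal.rpow_add_of_nonneg _ _ (by linarith) hp.le]
        congr 1
        ring
    _ ≤ _ := by gcongr

theorem le_of_ofReal_rpow_mul_le {t a : ℝ} (ht : 0 < t) {X M : ℝ≥0∞}
    (h : ENNReal.ofReal (t ^ a) * X ≤ M) : X ≤ M * ENNReal.ofReal (t ^ (-a)) := by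
  calc X = ENNReal.ofReal (t ^ a) * X * ENNReal.ofReal (t ^ (-a)) := by
        rw [mul_right_comm, ← ENNReal.ofReal_mul (by positivity), ← Real.rpow_add ht]
        simp
    _ ≤ _ := by gcongr

/-- At each time, interpolate between the L^p bound of 𝒦_p and the L^∞ bound of 𝒳_T; the Carleson
part of the norm plays no role. Scale invariance yields the right power of t, and M^{r-p} M^p = M^r
preserves the constant. -/
theorem KBound_of_katoNorm_of_xNorm {p r : ℝ} (hp : 0 < p) (hpr : p ≤ r) {M : ℝ≥0} {T : ℝ}
    (hT : 0 < T) {u : ℝ → E3 → E3}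
    (h : katoNorm (sK p) (ENNReal.ofReal p) (ENNReal.ofReal T) u +
      xNorm (ENNReal.ofReal T) u ≤ M) : KBound (1 / r) M T u := by
  have hr : 0 < r := hp.trans_le hpr
  have h1 : ∀ᵐ t ∂volume.restrict (Ioo 0 T), ENNReal.ofReal (t ^ (-sK p / 2)) *
      eLpNorm (u t) (ENNReal.ofReal p) volume ≤ M := by
    have := (le_self_add).trans h
    rw [katoNorm, timeInterval_ofReal hT] at this
    filter_upwards [ENNReal.ae_le_essSup _] with t ht using ht.trans this
  have h2 : ∀ᵐ t ∂volume.restrict (Ioo 0 T), ENNReal.ofReal (t ^ (1 / 2 : ℝ)) *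
      eLpNorm (u t) ⊤ volume ≤ M := by
    have := (le_self_add).trans ((le_add_self).trans h)
    rw [timeInterval_ofReal hT] at this
    filter_upwards [ENNReal.ae_le_essSup _] with t ht using ht.trans this
  filter_upwards [h1, h2, ae_restrict_mem measurableSet_Ioo] with t ht1 ht2 ht
  have ht0 := ht.1
  have b1 := le_of_ofReal_rpow_mul_le ht0 ht1
  have b2 := le_of_ofReal_rpow_mul_le ht0 ht2
  rw [eLpNorm_eq_lnorm hp] at b1
  have b3 : ∀ᵐ x, ‖u t x‖ₑ ≤ M * ENNReal.ofReal (t ^ (-(1 / 2) : ℝ)) := by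
    rw [eLpNorm_exponent_top] at b2
    filter_upwards [ae_le_eLpNormEssSup (f := u t)] with x hx using hx.trans b2
  rw [one_div_one_div]
  refine (ENNReal.rpow_le_rpow_iff hr).1 ((lnorm_rpow_le_of_ae_le hp hpr
    (ENNReal.mul_lt_top ENNReal.coe_lt_top ENNReal.ofReal_lt_top).ne b3).trans ?_)
  have hq : ∀ a b : ℝ, 0 ≤ b → ((M : ℝ≥0∞) * ENNReal.ofReal (t ^ a)) ^ b =
      (M : ℝ≥0∞) ^ b * ENNReal.ofReal (t ^ (a * b)) := fun a b hb => by
    rw [ENNReal.mul_rpow_of_nonneg _ _ hb, ENNReal.ofReal_rpow_of_pos (by positivity),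
      Real.rpow_mul ht0.le]
  calc _ ≤ (M * ENNReal.ofReal (t ^ (-(1 / 2) : ℝ))) ^ (r - p) *
        ((M : ℝ≥0∞) * ENNReal.ofReal (t ^ (-(-sK p / 2)))) ^ p := by gcongr
    _ = (M : ℝ≥0∞) ^ (r - p) * (M : ℝ≥0∞) ^ p * (ENNReal.ofReal (t ^ (-(1 / 2) * (r - p))) *
        ENNReal.ofReal (t ^ (-(-sK p / 2) * p))) := by
        rw [hq _ _ (by linarith), hq _ _ hp.le]
        ring
    _ = _ := by
        rw [hq _ _ hr.le, ← ENNReal.rpow_add_of_nonneg _ _ (by linarith) hp.le,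
          ← ENNReal.ofReal_mul (by positivity), ← Real.rpow_add ht0]
        congr 2
        · ring
        · congr 1
          rw [sK]
          field_simp
          ring

/-- Finite energy forcing for iterates starting in `𝒦_p ∩ 𝒳_T`. -/
theorem exists_finiteEnergyForcing_of_katoNorm {p : ℝ} (hp : 3 < p) {k : ℕ}
    (hk : ⌈p / 2⌉ - 2 ≤ (k : ℤ)) (M : ℝ≥0) : ∃ C : ℝ≥0, ∀ (T : ℝ) (P₀ : ℝ → E3 → E3), 0 < T →
      LocallyIntegrableOn (Function.uncurry P₀) (Q (ENNReal.ofReal T)) →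
      katoNorm (sK p) (ENNReal.ofReal p) (ENNReal.ofReal T) P₀ +
        xNorm (ENNReal.ofReal T) P₀ ≤ M → FiniteEnergyForcing P₀ k T C := by
  obtain ⟨C, hC⟩ := exists_finiteEnergyForcing_of_KBound (le_max_right p 4) M (le_two_div_max hk)
  refine ⟨C, fun T P₀ hT hloc h => ?_⟩
  -- Local integrability is what provides a measurable representative to iterate from.
  have hae : AEStronglyMeasurable (Function.uncurry P₀) (cylinderMeasure T) := by
    rw [← restrict_Q_eq hT]
    exact hloc.aestronglyMeasurable
  have heq : Function.uncurry P₀ =ᵐ[cylinderMeasure T]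
      Function.uncurry (Function.curry (hae.mk _)) := hae.ae_eq_mk
  refine hC T P₀ (Function.curry (hae.mk _)) hT heq hae.stronglyMeasurable_mk.measurable ?_
  refine (KBound_of_katoNorm_of_xNorm (by linarith) (le_max_left p 4) hT h).of_le
    (by positivity) ?_
  filter_upwards [Measure.ae_ae_of_ae_prod heq] with t ht
  filter_upwards [ht] with x hx
  have hxt : P₀ t x = Function.curry (hae.mk _) t x := hx
  rw [hxt]

/-! ### Littlewood-Paley blocks and the heat kernel -/

/-- A smooth cutoff of `1 / |ξ|²` that is exact on the annulus `3/4 ≤ |ξ| ≤ 8/3`. -/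
theorem exists_contDiff_inv_norm_sq : ∃ A : E3 → ℂ, ContDiff ℝ ∞ A ∧ HasCompactSupport A ∧
    ∀ ξ : E3, 3 / 4 ≤ ‖ξ‖ → ‖ξ‖ ≤ 8 / 3 → A ξ * ((‖ξ‖ ^ 2 : ℝ) : ℂ) = 1 := by
  let f : ContDiffBump (0 : E3) := ⟨8 / 3, 3, by norm_num, by norm_num⟩
  let g : ContDiffBump (0 : E3) := ⟨1 / 4, 1 / 2, by norm_num, by norm_num⟩
  set a : E3 → ℝ := fun ξ => f ξ * ((1 - g ξ) * (‖ξ‖ ^ 2)⁻¹) with ha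
  have hs : ContDiff ℝ ∞ a := by
    refine f.contDiff.mul (contDiff_iff_contDiffAt.2 fun ξ => ?_)
    by_cases hξ : ξ = 0
    · subst hξ
      have : (fun ξ : E3 => (1 - g ξ) * (‖ξ‖ ^ 2)⁻¹) =ᶠ[𝓝 0] fun _ => 0 := by
        filter_upwards [g.eventuallyEq_one] with ξ hξ
        simp [hξ]
      exact contDiffAt_const.congr_of_eventuallyEq this
    · refine (contDiffAt_const.sub g.contDiffAt).mul (ContDiffAt.inv ?_ ?_)
      · exact (contDiff_norm_sq ℝ).contDiffAt
      · simpa using hξ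
  refine ⟨fun ξ => (a ξ : ℂ), Complex.ofRealCLM.contDiff.comp hs, ?_, fun ξ h1 h2 => ?_⟩
  · exact (f.hasCompactSupport.mul_right).comp_left (g := ((↑) : ℝ → ℂ)) rfl
  · have hf : f ξ = 1 := f.one_of_mem_closedBall (by simpa using h2)
    have hg : g ξ = 0 := g.zero_of_le_dist (by
      rw [dist_zero_right]
      change 1 / 2 ≤ ‖ξ‖
      linarith)
    have hn : ‖ξ‖ ^ 2 ≠ 0 := by
      have : 0 < ‖ξ‖ := by linarith
      positivity
    rw [← Complex.ofReal_mul]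
    simp only [ha, hf, hg]
    rw [sub_zero, one_mul, one_mul, inv_mul_cancel₀ hn, Complex.ofReal_one]

section Blocks

variable {φ : E3 → ℝ}

theorem hasTemperateGrowth_block (hφ : IsLittlewoodPaley φ) (j : ℤ) :
    Function.HasTemperateGrowth
      (fun ξ : E3 => ((φ ((2 : ℝ) ^ (-j) • (2 * Real.pi) • ξ) : ℝ) : ℂ)) := by
  have hc : HasCompactSupport φ := by
    refine HasCompactSupport.intro (isCompact_closedBall (0 : E3) (8 / 3)) fun ξ hξ => ?_
    by_contra h
    exact hξ (by simpa using (hφ.support_subset h).2)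
  have h2 : (2 * Real.pi) ≠ 0 := by positivity
  have h3 : (2 : ℝ) ^ (-j) ≠ 0 := by positivity
  refine HasCompactSupport.hasTemperateGrowth ?_ ?_
  · have : HasCompactSupport fun ξ => φ ((2 : ℝ) ^ (-j) • (2 * Real.pi) • ξ) :=
      (hc.comp_smul h3).comp_smul h2
    exact this.comp_left (g := ((↑) : ℝ → ℂ)) rfl
  · have hl : ContDiff ℝ ∞ fun ξ : E3 => (2 : ℝ) ^ (-j) • (2 * Real.pi) • ξ := by fun_prop
    exact Complex.ofRealCLM.contDiff.comp (hφ.smooth.comp hl)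

/-- A block sees the inverse Fourier transform of a test function only on the support of its symbol.
Test functions can therefore be modified at the other frequencies. -/
theorem lpBlock_congr (hφ : IsLittlewoodPaley φ) (j : ℤ) (f : 𝓢'(E3, C3)) {ψ θ : 𝓢(E3, ℂ)}
    (h : ∀ ξ, φ ((2 : ℝ) ^ (-j) • (2 * Real.pi) • ξ) ≠ 0 → (𝓕⁻ ψ) ξ = (𝓕⁻ θ) ξ) :
    lpBlock φ j f ψ = lpBlock φ j f θ := by
  rw [lpBlock, TemperedDistribution.fourierMultiplierCLM_apply_apply,
    TemperedDistribution.fourierMultiplierCLM_apply_apply]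
  congr 2
  ext ξ
  rw [SchwartzMap.smulLeftCLM_apply_apply (hasTemperateGrowth_block hφ j),
    SchwartzMap.smulLeftCLM_apply_apply (hasTemperateGrowth_block hφ j)]
  by_cases hξ : φ ((2 : ℝ) ^ (-j) • (2 * Real.pi) • ξ) = 0
  · rw [hξ, Complex.ofReal_zero, zero_smul, zero_smul]
  · rw [h ξ hξ]

end Blocks

theorem fourierInv_heatTest {t : ℝ} (ht : 0 < t) (x ξ : E3) :
    (𝓕⁻ (heatTest t ht x)) ξ = Complex.exp (((2 * Real.pi * inner ℝ x ξ : ℝ) : ℂ) * Complex.I) *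
      ((Real.exp (-(4 * Real.pi ^ 2 * (t * ‖ξ‖ ^ 2))) : ℝ) : ℂ) := by
  rw [SchwartzMap.fourierInv_coe, Real.fourierInv_eq',
    ← integral_sub_left_eq_self _ volume x]
  have hb : 0 < ((1 / (4 * t) : ℝ) : ℂ).re := by rw [Complex.ofReal_re]; positivity
  have hG := fourier_gaussian_innerProductSpace (V := E3) hb ξ
  have hpt : ∀ u : E3, Complex.exp (((2 * Real.pi * inner ℝ (x - u) ξ : ℝ) : ℂ) * Complex.I) •
      heatTest t ht x (x - u) =
      (Complex.exp (((2 * Real.pi * inner ℝ x ξ : ℝ) : ℂ) * Complex.I) *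
        (((4 * Real.pi * t) ^ (-(3 : ℝ) / 2) : ℝ) : ℂ)) *
      (Complex.exp (((-2 * Real.pi * inner ℝ u ξ : ℝ) : ℂ) * Complex.I) •
        Complex.exp (-((1 / (4 * t) : ℝ) : ℂ) * (‖u‖ : ℂ) ^ 2)) := fun u => by
    rw [heatTest_apply, sub_sub_cancel, heatKernel, Complex.ofReal_mul (_ ^ _),
      Complex.ofReal_exp]
    rw [show (((2 * Real.pi * inner ℝ (x - u) ξ : ℝ) : ℂ) * Complex.I) =
      (((2 * Real.pi * inner ℝ x ξ : ℝ) : ℂ) * Complex.I) +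
      (((-2 * Real.pi * inner ℝ u ξ : ℝ) : ℂ) * Complex.I) by
        rw [inner_sub_left]; push_cast; ring, Complex.exp_add]
    rw [show ((-(‖u‖ ^ 2 / (4 * t)) : ℝ) : ℂ) = -((1 / (4 * t) : ℝ) : ℂ) * (‖u‖ : ℂ) ^ 2 by
      push_cast; ring]
    simp only [smul_eq_mul]
    ring
  simp only [hpt]
  rw [integral_const_mul, ← Real.fourier_eq', hG]
  have h1 : ((Real.pi : ℂ) / ((1 / (4 * t) : ℝ) : ℂ)) ^ ((Module.finrank ℝ E3 : ℂ) / 2) =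
      (((4 * Real.pi * t) ^ ((3 : ℝ) / 2) : ℝ) : ℂ) := by
    rw [Complex.ofReal_cpow (by positivity)]
    congr 1
    · push_cast; field_simp
    · simp
  have h2 : -(Real.pi : ℂ) ^ 2 * (‖ξ‖ : ℂ) ^ 2 / ((1 / (4 * t) : ℝ) : ℂ) =
      ((-(4 * Real.pi ^ 2 * (t * ‖ξ‖ ^ 2)) : ℝ) : ℂ) := by
    push_cast
    field_simp
  rw [h1, h2, ← Complex.ofReal_exp, mul_assoc, ← mul_assoc (((4 * Real.pi * t) ^ (-(3 : ℝ) / 2) : ℝ) : ℂ),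
    ← Complex.ofReal_mul, ← Real.rpow_add (by positivity)]
  norm_num

/-! ### Heat kernels localized to a dyadic block. -/

/-- The `L¹`-normalized rescaling of `h`. -/
noncomputable def rescale (R : ℝ) (h : E3 → ℝ≥0∞) (z : E3) : ℝ≥0∞ :=
  ENNReal.ofReal (R ^ 3) * h (R • z)

theorem measurable_rescale (R : ℝ) {h : E3 → ℝ≥0∞} (hh : Measurable h) :
    Measurable (rescale R h) :=
  (hh.comp (measurable_const_smul R)).const_mul _

theorem lintegral_rescale {R : ℝ} (hR : 0 < R) {h : E3 → ℝ≥0∞} (hh : Measurable h) :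
    ∫⁻ z, rescale R h z = ∫⁻ z, h z := by
  have hc : Measurable fun z => h (R • z) := hh.comp (measurable_const_smul R)
  unfold rescale
  rw [lintegral_const_mul _ hc, lintegral_comp_smul_E3 hR h hh,
    ← mul_assoc, ← ENNReal.ofReal_mul (by positivity), mul_inv_cancel₀ (by positivity)]
  simp

theorem exists_schwartz_le (f : 𝓢(E3, ℂ)) : ∃ B : ℝ≥0, ∫⁻ z, ‖f z‖ₑ ≤ B ∧ ∀ z, ‖f z‖ₑ ≤ B := by
  have h1 : ∫⁻ z, ‖f z‖ₑ < ⊤ := f.integrable.2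
  lift ∫⁻ z, ‖f z‖ₑ to ℝ≥0 using h1.ne with A hA
  refine ⟨max A (SchwartzMap.seminorm ℝ 0 0 f).toNNReal, ENNReal.coe_le_coe.2 (le_max_left _ _),
    fun z => ?_⟩
  refine le_trans ?_ (ENNReal.coe_le_coe.2 (le_max_right _ _))
  rw [← ofReal_norm]
  exact ENNReal.ofReal_le_ofReal (SchwartzMap.norm_le_seminorm ℝ f z)

theorem enorm_heatTest {t : ℝ} (ht : 0 < t) (x y : E3) :
    ‖heatTest t ht x y‖ₑ =
      rescale (Real.sqrt t)⁻¹ (fun z => ‖heatTest 1 one_pos 0 z‖ₑ) (x - y) := by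
  have hs : 0 < Real.sqrt t := Real.sqrt_pos.2 ht
  rw [rescale, heatTest_apply, heatTest_apply, ← ofReal_norm, ← ofReal_norm,
    ← ENNReal.ofReal_mul (by positivity), Complex.norm_real, Complex.norm_real,
    zero_sub]
  congr 1
  have h0 : ∀ (t : ℝ) (z : E3), 0 < t → 0 ≤ heatKernel t z := fun t z ht => by
    unfold heatKernel; positivity
  rw [Real.norm_of_nonneg (h0 _ _ ht), Real.norm_of_nonneg (h0 _ _ one_pos), heatKernel, heatKernel,
    norm_neg, norm_smul, mul_pow, norm_inv, Real.norm_eq_abs, inv_pow, inv_pow, sq_abs, Real.sq_sqrt ht.le,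
    Real.mul_rpow (by positivity) ht.le, mul_one, ← mul_assoc, mul_comm _ ((4 * Real.pi) ^ _)]
  congr 1
  · congr 1
    rw [Real.sqrt_eq_rpow, ← Real.rpow_natCast, ← Real.rpow_mul ht.le, ← Real.rpow_neg ht.le]
    norm_num
  · congr 1
    field_simp

/-- The function `|ξ|² exp (-4π²|ξ|²)`, the symbol of `-(4π²)⁻¹ Δ S(1)`. -/
noncomputable def heatSymbol : 𝓢(E3, ℂ) :=
  SchwartzMap.smulLeftCLM ℂ (fun ξ : E3 => ((‖ξ‖ ^ 2 : ℝ) : ℂ))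
    (SchwartzMap.postcompCLM Complex.ofRealCLM (gaussianSchwartz (4 * Real.pi ^ 2) (by positivity)))

theorem hasTemperateGrowth_ofReal_norm_sq :
    Function.HasTemperateGrowth (fun ξ : E3 => ((‖ξ‖ ^ 2 : ℝ) : ℂ)) :=
  Function.Complex.hasTemperateGrowth_ofReal.comp (Function.hasTemperateGrowth_norm_sq E3)

theorem heatSymbol_apply (ξ : E3) : heatSymbol ξ =
    ((‖ξ‖ ^ 2 : ℝ) : ℂ) * ((Real.exp (-(4 * Real.pi ^ 2 * ‖ξ‖ ^ 2)) : ℝ) : ℂ) := by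
  rw [heatSymbol, SchwartzMap.smulLeftCLM_apply_apply hasTemperateGrowth_ofReal_norm_sq,
    smul_eq_mul]
  rfl

/-- A multiple of the Laplacian of the heat kernel centered at `x`, as a test function. -/
noncomputable def heatLaplacianTest (t : ℝ) (ht : 0 < t) (x : E3) : 𝓢(E3, ℂ) :=
  𝓕 (SchwartzMap.smulLeftCLM ℂ (fun ξ : E3 => ((‖ξ‖ ^ 2 : ℝ) : ℂ)) (𝓕⁻ (heatTest t ht x)))

/-- Scaling: |ξ|² exp(-4π²t|ξ|²) is t⁻¹ times `heatSymbol` at √t ξ, which gives the decay factor t⁻¹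
and an L¹-normalized profile. -/
theorem enorm_heatLaplacianTest {t : ℝ} (ht : 0 < t) (x y : E3) :
    ‖heatLaplacianTest t ht x y‖ₑ = ENNReal.ofReal t⁻¹ *
      rescale (Real.sqrt t)⁻¹ (fun z => ‖(𝓕⁻ heatSymbol) z‖ₑ) (x - y) := by
  have hs : 0 < Real.sqrt t := Real.sqrt_pos.2 ht
  have h1 : heatLaplacianTest t ht x y =
      𝓕⁻ (fun ξ => (t⁻¹ : ℂ) • heatSymbol (Real.sqrt t • ξ)) (x - y) := by
    rw [heatLaplacianTest, SchwartzMap.fourier_coe, Real.fourier_eq', Real.fourierInv_eq']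
    refine integral_congr_ae (ae_of_all _ fun ξ => ?_)
    simp only
    rw [SchwartzMap.smulLeftCLM_apply_apply hasTemperateGrowth_ofReal_norm_sq,
      fourierInv_heatTest, heatSymbol_apply, norm_smul, mul_pow, Real.norm_eq_abs, sq_abs,
      Real.sq_sqrt ht.le]
    rw [show (((2 * Real.pi * inner ℝ ξ (x - y) : ℝ) : ℂ) * Complex.I) =
      (((-2 * Real.pi * inner ℝ ξ y : ℝ) : ℂ) * Complex.I) +
      (((2 * Real.pi * inner ℝ x ξ : ℝ) : ℂ) * Complex.I) by
        rw [inner_sub_right, real_inner_comm x ξ]; push_cast; ring, Complex.exp_add]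
    have ht' : (t : ℂ) ≠ 0 := by exact_mod_cast ht.ne'
    simp only [smul_eq_mul]
    push_cast
    field_simp
  have h2 : 𝓕⁻ (fun ξ => (t⁻¹ : ℂ) • heatSymbol (Real.sqrt t • ξ)) (x - y) =
      (t⁻¹ : ℂ) • ((Real.sqrt t ^ 3)⁻¹ • (𝓕⁻ heatSymbol) ((Real.sqrt t)⁻¹ • (x - y))) := by
    rw [SchwartzMap.fourierInv_coe, ← fourierInv_comp_smul hs, Real.fourierInv_eq',
      Real.fourierInv_eq', ← integral_smul]
    refine integral_congr_ae (ae_of_all _ fun ξ => ?_)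
    simp only [smul_eq_mul]
    ring
  rw [h1, h2, rescale, enorm_smul, enorm_smul]
  congr 1
  · rw [← ofReal_norm, norm_inv, Complex.norm_real, Real.norm_of_nonneg ht.le]
  · congr 1
    rw [← ofReal_norm, Real.norm_of_nonneg (by positivity), inv_pow]

/-- The test function obtained from the heat kernel by inserting a Fourier cutoff `a(ξ) |ξ|²`. -/
noncomputable def cutoffHeatTest (a : 𝓢(E3, ℂ)) (t : ℝ) (ht : 0 < t) (x : E3) : 𝓢(E3, ℂ) :=
  SchwartzMap.convolution (ContinuousLinearMap.mul ℂ ℂ) (𝓕 a) (heatLaplacianTest t ht x)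

theorem fourierInv_schwartz_eq (f : 𝓢(E3, ℂ)) (ξ : E3) : (𝓕⁻ f) ξ = (𝓕 f) (-ξ) := by
  rw [SchwartzMap.fourierInv_coe, SchwartzMap.fourier_coe, Real.fourierInv_eq_fourier_neg]

/-- On the set where a(ξ)|ξ|² = 1 this agrees with the heat kernel, so a block cannot tell the two
test functions apart. -/
theorem fourierInv_cutoffHeatTest (a : 𝓢(E3, ℂ)) {t : ℝ} (ht : 0 < t) (x ξ : E3) :
    (𝓕⁻ (cutoffHeatTest a t ht x)) ξ = a ξ * ((‖ξ‖ ^ 2 : ℝ) : ℂ) * (𝓕⁻ (heatTest t ht x)) ξ := by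
  rw [fourierInv_schwartz_eq, cutoffHeatTest, SchwartzMap.fourier_convolution,
    SchwartzMap.pairing_apply_apply, ← fourierInv_schwartz_eq, ← fourierInv_schwartz_eq,
    heatLaplacianTest, FourierTransform.fourierInv_fourier_eq,
    FourierTransform.fourierInv_fourier_eq,
    SchwartzMap.smulLeftCLM_apply_apply hasTemperateGrowth_ofReal_norm_sq]
  simp [mul_assoc]

theorem enorm_cutoffHeatTest_le (a : 𝓢(E3, ℂ)) {t : ℝ} (ht : 0 < t) (x y : E3) :
    ‖cutoffHeatTest a t ht x y‖ₑ ≤ ENNReal.ofReal t⁻¹ *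
      lconv (rescale (Real.sqrt t)⁻¹ fun z => ‖(𝓕⁻ heatSymbol) z‖ₑ)
        (fun z => ‖(𝓕⁻ a) z‖ₑ) (x - y) := by
  rw [cutoffHeatTest, SchwartzMap.convolution_apply, convolution_def]
  refine (enorm_integral_le_lintegral_enorm _).trans (le_of_eq ?_)
  rw [lconv, ← lintegral_const_mul' _ _ ENNReal.ofReal_ne_top, ← lintegral_neg_eq_self]
  refine lintegral_congr fun w => ?_
  rw [ContinuousLinearMap.mul_apply', enorm_mul, enorm_heatLaplacianTest,
    fourierInv_schwartz_eq a w]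
  rw [show x - (y - -w) = x - y - w by abel]
  ring

/-- On the block the frequency is of size 2^j, so 1 can be written as |ξ|² times a cutoff of
|ξ|^{-2}. The first factor costs t⁻¹ against the heat kernel and the second costs 4^{-j}, whence the
decay (4^j t)⁻¹. This replaces the exponential decay in 4^j t and is enough for summation over j. -/
theorem exists_block_kernel {φ : E3 → ℝ} (hφ : IsLittlewoodPaley φ) : ∃ B : ℝ≥0, 0 < B ∧
    ∀ (j : ℤ) (t : ℝ) (ht : 0 < t), ∃ K : E3 → ℝ≥0∞, Measurable K ∧
      (∫⁻ z, K z ≤ B * ENNReal.ofReal (min 1 (((4 : ℝ) ^ j * t)⁻¹))) ∧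
      (∀ z, K z ≤ B * ENNReal.ofReal (min 1 (((4 : ℝ) ^ j * t)⁻¹)) *
        ENNReal.ofReal (t ^ (-(3 / 2) : ℝ))) ∧
      ∀ (f : 𝓢'(E3, C3)) (g : E3 → C3), (∀ ψ : 𝓢(E3, ℂ), lpBlock φ j f ψ = ∫ x, ψ x • g x) →
        ∀ x, ‖lpBlock φ j f (heatTest t ht x)‖ₑ ≤ lconv K (fun y => ‖g y‖ₑ) x := by
  obtain ⟨A, hA1, hA2, hA3⟩ := exists_contDiff_inv_norm_sq
  set a₀ : 𝓢(E3, ℂ) := hA2.toSchwartzMap hA1 with ha₀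
  obtain ⟨B₁, hB₁, hB₁'⟩ := exists_schwartz_le (heatTest 1 one_pos 0)
  obtain ⟨B₂, hB₂, hB₂'⟩ := exists_schwartz_le (𝓕⁻ heatSymbol)
  obtain ⟨B₃, hB₃, -⟩ := exists_schwartz_le (𝓕⁻ a₀)
  have hsqrt : ∀ t : ℝ, 0 < t → ((Real.sqrt t)⁻¹) ^ 3 = t ^ (-(3 / 2) : ℝ) := fun t ht => by
    rw [Real.sqrt_eq_rpow, ← Real.rpow_neg ht.le, ← Real.rpow_natCast, ← Real.rpow_mul ht.le]
    norm_num
  set P : ℝ≥0 := ((2 * Real.pi) ^ 2).toNNReal with hP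
  refine ⟨B₁ + B₂ * B₃ * P + 1, by positivity, fun j t ht => ?_⟩
  set B : ℝ≥0 := B₁ + B₂ * B₃ * P + 1 with hB
  have hBB₁ : B₁ ≤ B := by rw [hB, add_assoc]; exact le_self_add
  have hBB₂ : B₂ * B₃ * P ≤ B := by rw [hB, add_right_comm]; exact le_add_self
  have hs : 0 < Real.sqrt t := Real.sqrt_pos.2 ht
  have hmD : Measurable fun z => ‖(𝓕⁻ heatSymbol) z‖ₑ :=
    (𝓕⁻ heatSymbol : 𝓢(E3, ℂ)).continuous.measurable.enorm
  -- If 4^j t ≤ 1 the heat kernel itself is used; otherwise the cutoff provides the decay.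
  rcases min_cases (1 : ℝ) (((4 : ℝ) ^ j * t)⁻¹) with ⟨hmin, -⟩ | ⟨hmin, -⟩
  · rw [hmin]
    have hm : Measurable fun z => ‖heatTest 1 one_pos 0 z‖ₑ :=
      (heatTest 1 one_pos 0).continuous.measurable.enorm
    refine ⟨rescale (Real.sqrt t)⁻¹ fun z => ‖heatTest 1 one_pos 0 z‖ₑ,
      measurable_rescale _ hm, ?_, fun z => ?_, fun f g hg x => ?_⟩
    · rw [lintegral_rescale (by positivity) hm, ENNReal.ofReal_one, mul_one]
      exact hB₁.trans (ENNReal.coe_le_coe.2 hBB₁)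
    · rw [ENNReal.ofReal_one, mul_one, rescale, hsqrt t ht, mul_comm]
      gcongr
      exact (hB₁' _).trans (ENNReal.coe_le_coe.2 hBB₁)
    · rw [hg]
      refine (enorm_integral_le_lintegral_enorm _).trans (le_of_eq (lintegral_congr fun y => ?_))
      rw [enorm_smul, enorm_heatTest]
  · rw [hmin]
    -- The symbol of the block is φ(Rξ). The cutoff R² A(Rξ) equals 1/|ξ|² on its support, and the
    -- L¹ norm of its inverse transform is R² times a constant.
    set R : ℝ := (2 : ℝ) ^ (-j) * (2 * Real.pi) with hR
    have hR0 : 0 < R := by positivity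
    have hd : ContDiff ℝ ∞ fun ξ : E3 => ((R ^ 2 : ℝ) : ℂ) * A (R • ξ) :=
      contDiff_const.mul (hA1.comp (by fun_prop : ContDiff ℝ ∞ fun ξ : E3 => R • ξ))
    have hc : HasCompactSupport fun ξ : E3 => ((R ^ 2 : ℝ) : ℂ) * A (R • ξ) :=
      (hA2.comp_smul hR0.ne').mul_left
    set a : 𝓢(E3, ℂ) := hc.toSchwartzMap hd with ha
    have haI : ∀ z, ‖(𝓕⁻ a) z‖ₑ =
        ENNReal.ofReal (R ^ 2) * rescale R⁻¹ (fun z => ‖(𝓕⁻ a₀) z‖ₑ) z := fun z => by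
      have h1 : (𝓕⁻ a) z = ((R ^ 2 : ℝ) : ℂ) • ((R ^ 3)⁻¹ • (𝓕⁻ a₀) (R⁻¹ • z)) := by
        rw [SchwartzMap.fourierInv_coe, SchwartzMap.fourierInv_coe, ← fourierInv_comp_smul hR0,
          Real.fourierInv_eq', Real.fourierInv_eq', ← integral_smul]
        refine integral_congr_ae (ae_of_all _ fun ξ => ?_)
        simp only [smul_eq_mul]
        change _ * (((R ^ 2 : ℝ) : ℂ) * A (R • ξ)) = _ * (_ * A (R • ξ))
        ring
      rw [h1, rescale, enorm_smul, enorm_smul]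
      congr 1
      · rw [← ofReal_norm, Complex.norm_real, Real.norm_of_nonneg (by positivity)]
      · congr 1
        rw [← ofReal_norm, Real.norm_of_nonneg (by positivity), inv_pow]
    have hm0 : Measurable fun z => ‖(𝓕⁻ a₀) z‖ₑ :=
      (𝓕⁻ a₀ : 𝓢(E3, ℂ)).continuous.measurable.enorm
    have hma : Measurable fun z => ‖(𝓕⁻ a) z‖ₑ :=
      (𝓕⁻ a : 𝓢(E3, ℂ)).continuous.measurable.enorm
    have hIa : ∫⁻ z, ‖(𝓕⁻ a) z‖ₑ ≤ ENNReal.ofReal (R ^ 2) * B₃ := by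
      simp only [haI]
      rw [lintegral_const_mul _ (measurable_rescale _ hm0), lintegral_rescale (by positivity) hm0]
      gcongr
    have hconst : ENNReal.ofReal t⁻¹ * ENNReal.ofReal (R ^ 2) =
        P * ENNReal.ofReal (((4 : ℝ) ^ j * t)⁻¹) := by
      have h4 : R ^ 2 = (2 * Real.pi) ^ 2 * ((4 : ℝ) ^ j)⁻¹ := by
        rw [hR, mul_pow, ← zpow_natCast, ← zpow_mul, mul_comm (-j), zpow_mul, zpow_neg]
        norm_num
        ring
      rw [← ENNReal.ofReal_mul (by positivity), h4, hP, ← ENNReal.ofReal,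
        ← ENNReal.ofReal_mul (by positivity), mul_inv]
      congr 1
      ring
    have hmr := measurable_rescale (Real.sqrt t)⁻¹ hmD
    refine ⟨fun z => ENNReal.ofReal t⁻¹ *
      lconv (rescale (Real.sqrt t)⁻¹ fun z => ‖(𝓕⁻ heatSymbol) z‖ₑ)
        (fun z => ‖(𝓕⁻ a) z‖ₑ) z, ?_, ?_, fun z => ?_, fun f g hg x => ?_⟩
    · exact (measurable_lconv hmr hma).const_mul _
    · rw [lintegral_const_mul _ (measurable_lconv hmr hma)]
      have h1 := lnorm_lconv_le_mul hmr hma (A := B₂)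
        (by rw [lintegral_rescale (by positivity) hmD]; exact hB₂) le_rfl
      simp only [lnorm, ENNReal.rpow_one, div_one] at h1
      calc _ ≤ ENNReal.ofReal t⁻¹ * (B₂ * (ENNReal.ofReal (R ^ 2) * B₃)) := by
            gcongr
            refine h1.trans ?_
            gcongr
        _ = ((B₂ * B₃ * P : ℝ≥0) : ℝ≥0∞) * ENNReal.ofReal (((4 : ℝ) ^ j * t)⁻¹) := by
            rw [mul_left_comm, ← mul_assoc (ENNReal.ofReal t⁻¹), hconst]
            push_cast
            ring
        _ ≤ _ := by
            gcongr
    · have h1 : lconv (rescale (Real.sqrt t)⁻¹ fun z => ‖(𝓕⁻ heatSymbol) z‖ₑ)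
          (fun z => ‖(𝓕⁻ a) z‖ₑ) z ≤ ENNReal.ofReal (t ^ (-(3 / 2) : ℝ)) * B₂ *
            (ENNReal.ofReal (R ^ 2) * B₃) := by
        refine le_trans ?_ (mul_le_mul' le_rfl hIa)
        rw [lconv, ← lintegral_const_mul _ hma]
        refine lintegral_mono fun y => ?_
        gcongr
        rw [rescale, hsqrt t ht]
        gcongr
        exact hB₂' _
      calc _ ≤ ENNReal.ofReal t⁻¹ * (ENNReal.ofReal (t ^ (-(3 / 2) : ℝ)) * B₂ *
            (ENNReal.ofReal (R ^ 2) * B₃)) := mul_le_mul' le_rfl h1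
        _ = ENNReal.ofReal t⁻¹ * ENNReal.ofReal (R ^ 2) * (B₂ * B₃) *
            ENNReal.ofReal (t ^ (-(3 / 2) : ℝ)) := by ring
        _ = ((B₂ * B₃ * P : ℝ≥0) : ℝ≥0∞) * ENNReal.ofReal (((4 : ℝ) ^ j * t)⁻¹) *
            ENNReal.ofReal (t ^ (-(3 / 2) : ℝ)) := by
            rw [hconst]
            push_cast
            ring
        _ ≤ _ := by
            gcongr
    -- On the support of φ(Rξ) the inserted Fourier factor a(ξ)|ξ|² equals 1.
    · have hθ : lpBlock φ j f (heatTest t ht x) = lpBlock φ j f (cutoffHeatTest a t ht x) := by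
        refine lpBlock_congr hφ j f fun ξ hξ => ?_
        rw [fourierInv_cutoffHeatTest]
        have h1 := hφ.support_subset hξ
        rw [smul_smul, ← hR] at h1
        have h2 := hA3 _ h1.1 h1.2
        have h3 : a ξ * ((‖ξ‖ ^ 2 : ℝ) : ℂ) = 1 := by
          rw [← h2, norm_smul, mul_pow, Real.norm_eq_abs, sq_abs]
          change ((R ^ 2 : ℝ) : ℂ) * A (R • ξ) * _ = A (R • ξ) * _
          push_cast
          ring
        rw [h3, one_mul]
      rw [hθ, hg]
      refine (enorm_integral_le_lintegral_enorm _).trans (lintegral_mono fun y => ?_)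
      rw [enorm_smul]
      gcongr
      exact enorm_cutoffHeatTest_le a ht x y

/-! ### The heat evolution of data in a Besov space -/

/-- Up to a shift of j by the integer part of log₄(1/t), this is the series of min(1, 4^{-l})
2^{lγ}. It converges as l → -∞ because γ > 0 and as l → ∞ because γ ≤ 1 < 2. -/
theorem exists_tsum_dyadic_le {γ : ℝ} (hγ : 0 < γ) (hγ1 : γ ≤ 1) : ∃ C : ℝ≥0, ∀ t : ℝ, 0 < t →
    ∑' j : ℤ, ENNReal.ofReal (min 1 (((4 : ℝ) ^ j * t)⁻¹)) * ENNReal.ofReal ((2 : ℝ) ^ (j * γ)) ≤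
      C * ENNReal.ofReal (t ^ (-(γ / 2))) := by
  set s : ℤ → ℝ := fun l => min 1 (((4 : ℝ) ^ l)⁻¹) * (2 : ℝ) ^ (l * γ) with hs
  have hs0 : ∀ l, 0 ≤ s l := fun l => by
    have : 0 ≤ min 1 (((4 : ℝ) ^ l)⁻¹) := le_min zero_le_one (by positivity)
    positivity
  have hsum : Summable s := by
    refine Summable.of_nat_of_neg ?_ ?_
    · refine Summable.of_nonneg_of_le (fun n => hs0 n) (fun n => ?_)
        (summable_geometric_of_lt_one (r := 1 / 2) (by norm_num) (by norm_num))
      calc s n ≤ ((4 : ℝ) ^ n)⁻¹ * 2 ^ n := by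
            have h2 : (2 : ℝ) ^ (((n : ℤ) : ℝ) * γ) ≤ 2 ^ n := by
              rw [← Real.rpow_natCast]
              refine Real.rpow_le_rpow_of_exponent_le (by norm_num) ?_
              push_cast
              nlinarith [Nat.cast_nonneg (α := ℝ) n]
            have h1 : min 1 (((4 : ℝ) ^ (n : ℤ))⁻¹) ≤ ((4 : ℝ) ^ n)⁻¹ := by
              refine (min_le_right _ _).trans (le_of_eq ?_)
              rw [zpow_natCast]
            exact mul_le_mul h1 h2 (by positivity) (by positivity)
        _ = (1 / 2) ^ n := by
            rw [← inv_pow, ← mul_pow]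
            norm_num
    · refine Summable.of_nonneg_of_le (fun n => hs0 _) (fun n => ?_)
        (summable_geometric_of_lt_one (r := (2 : ℝ) ^ (-γ)) (by positivity)
          (Real.rpow_lt_one_of_one_lt_of_neg (by norm_num) (by linarith)))
      calc s (-n) ≤ 1 * (2 : ℝ) ^ (((-n : ℤ) : ℝ) * γ) := by
            simp only [hs]
            gcongr
            exact min_le_left _ _
        _ = _ := by
            rw [one_mul, ← Real.rpow_natCast, ← Real.rpow_mul (by norm_num)]
            congr 1
            push_cast
            ring
  refine ⟨(4 * ∑' l, s l).toNNReal, fun t ht => ?_⟩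
  -- The dyadic shift: 4^m ≤ 1/t < 4^{m+1}. Rounding t to a power of 4 costs the factor 4.
  obtain ⟨m, hm1, hm2⟩ := exists_mem_Ico_zpow (inv_pos.2 ht) (by norm_num : (1 : ℝ) < 4)
  have hterm : ∀ l : ℤ, ENNReal.ofReal (min 1 (((4 : ℝ) ^ (m + l) * t)⁻¹)) *
      ENNReal.ofReal ((2 : ℝ) ^ (((m + l : ℤ) : ℝ) * γ)) ≤
      ENNReal.ofReal (4 * s l) * ENNReal.ofReal (t ^ (-(γ / 2))) := fun l => by
    have h0 : 0 ≤ min 1 (((4 : ℝ) ^ (m + l) * t)⁻¹) := le_min zero_le_one (by positivity)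
    rw [← ENNReal.ofReal_mul h0, ← ENNReal.ofReal_mul (by have := hs0 l; positivity)]
    refine ENNReal.ofReal_le_ofReal ?_
    have h1 : min 1 (((4 : ℝ) ^ (m + l) * t)⁻¹) ≤ 4 * min 1 (((4 : ℝ) ^ l)⁻¹) := by
      rw [mul_min_of_nonneg _ _ (by norm_num)]
      refine min_le_min (by norm_num) ?_
      rw [zpow_add₀ (by norm_num), mul_right_comm, mul_inv]
      gcongr
      rw [zpow_add₀ (by norm_num), zpow_one, inv_lt_iff_one_lt_mul₀ ht] at hm2
      rw [inv_le_iff_one_le_mul₀ (by positivity)]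
      linarith
    have h2 : (2 : ℝ) ^ (((m + l : ℤ) : ℝ) * γ) ≤ (2 : ℝ) ^ (l * γ) * t ^ (-(γ / 2)) := by
      push_cast
      rw [add_mul, Real.rpow_add (by norm_num), mul_comm]
      gcongr
      calc (2 : ℝ) ^ (m * γ) = ((4 : ℝ) ^ m) ^ (γ / 2) := by
            rw [← Real.rpow_intCast, ← Real.rpow_mul (by norm_num),
              show (4 : ℝ) = 2 ^ (2 : ℝ) by norm_num, ← Real.rpow_mul (by norm_num)]
            congr 1
            ring
        _ ≤ (t⁻¹) ^ (γ / 2) := by gcongr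
        _ = _ := by rw [Real.inv_rpow ht.le, Real.rpow_neg ht.le]
    calc _ ≤ (4 * min 1 (((4 : ℝ) ^ l)⁻¹)) * ((2 : ℝ) ^ (l * γ) * t ^ (-(γ / 2))) :=
          mul_le_mul h1 h2 (by positivity) (h0.trans h1)
      _ = _ := by simp only [hs]; ring
  rw [← (Equiv.addLeft m).tsum_eq]
  refine (ENNReal.tsum_le_tsum hterm).trans (le_of_eq ?_)
  rw [ENNReal.tsum_mul_right, ← ENNReal.ofReal_tsum_of_nonneg
    (fun l => by have := hs0 l; positivity) (hsum.mul_left 4), tsum_mul_left]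
  rfl

/-- `distLpNorm` is an infimum; enlarging M to M + 1 makes the inequality strict, so some
representing function satisfies the bound. -/
theorem exists_block_representative {φ : E3 → ℝ} {s p : ℝ} (hp : 0 < p) {M : ℝ≥0}
    {u : 𝓢'(E3, C3)} (h : besovNorm φ s (ENNReal.ofReal p) u ≤ M) (j : ℤ) :
    ∃ g : E3 → C3, Measurable g ∧ (∀ ψ : 𝓢(E3, ℂ), lpBlock φ j u ψ = ∫ x, ψ x • g x) ∧
      lnorm p (fun x => ‖g x‖ₑ) ≤ (M + 1 : ℝ≥0) * ENNReal.ofReal ((2 : ℝ) ^ (j * -s)) := by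
  have h1 : ENNReal.ofReal ((2 : ℝ) ^ (j * s)) * distLpNorm (ENNReal.ofReal p) (lpBlock φ j u) ≤ M :=
    (le_iSup (fun j : ℤ => ENNReal.ofReal ((2 : ℝ) ^ ((j : ℝ) * s)) *
      distLpNorm (ENNReal.ofReal p) (lpBlock φ j u)) j).trans h
  have hpos : 0 < ENNReal.ofReal ((2 : ℝ) ^ (j * -s)) := ENNReal.ofReal_pos.2 (by positivity)
  have h2 : distLpNorm (ENNReal.ofReal p) (lpBlock φ j u) ≤
      M * ENNReal.ofReal ((2 : ℝ) ^ (j * -s)) := by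
    have := le_of_ofReal_rpow_mul_le (t := 2) (by norm_num) h1
    rwa [mul_neg]
  have h3 : distLpNorm (ENNReal.ofReal p) (lpBlock φ j u) <
      (M + 1 : ℝ≥0) * ENNReal.ofReal ((2 : ℝ) ^ (j * -s)) := by
    refine h2.trans_lt ?_
    rw [ENNReal.mul_lt_mul_iff_left hpos.ne' ENNReal.ofReal_ne_top, ENNReal.coe_lt_coe]
    simp
  simp only [distLpNorm, iInf_lt_iff] at h3
  obtain ⟨g, hg, hrep, hlt⟩ := h3
  refine ⟨hg.1.mk g, hg.1.stronglyMeasurable_mk.measurable, fun ψ => ?_, ?_⟩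
  · rw [hrep]
    refine integral_congr_ae ?_
    filter_upwards [hg.1.ae_eq_mk] with x hx
    rw [← hx]
  · rw [← eLpNorm_eq_lnorm hp, ← eLpNorm_congr_ae hg.1.ae_eq_mk]
    exact hlt.le

theorem MemBesov.tendsto_sum {φ : E3 → ℝ} {s : ℝ} {p : ℝ≥0∞} {u : 𝓢'(E3, C3)}
    (h : MemBesov φ s p u) (ψ : 𝓢(E3, ℂ)) :
    Tendsto (fun n : ℕ => ∑ j ∈ Finset.Icc (-(n : ℤ)) n, lpBlock φ j u ψ) atTop (𝓝 (u ψ)) := by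
  have hd : Tendsto (fun n : ℕ => (n, n)) atTop (atTop : Filter (ℕ × ℕ)) := by
    rw [← prod_atTop_atTop_eq]
    exact tendsto_id.prodMk tendsto_id
  have h1 := h.2.comp hd
  have h2 := (PointwiseConvergenceCLM.tendsto_iff_forall_tendsto.1 h1) ψ
  refine h2.congr fun n => ?_
  simp

theorem enorm_C3_re_le (v : C3) : ‖(WithLp.toLp 2 fun i => (v i).re : E3)‖ₑ ≤ ‖v‖ₑ := by
  rw [← ofReal_norm, ← ofReal_norm]
  refine ENNReal.ofReal_le_ofReal ?_
  rw [EuclideanSpace.norm_eq, EuclideanSpace.norm_eq]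
  refine Real.sqrt_le_sqrt (Finset.sum_le_sum fun i _ => ?_)
  gcongr
  exact Complex.abs_re_le_norm _

/-- Convergence of the Littlewood-Paley series is tested on the heat kernel centered at x; the bound
on the partial sums passes to the limit. -/
theorem enorm_heatEvolution_le {φ : E3 → ℝ} {s : ℝ} {p : ℝ≥0∞} {u : 𝓢'(E3, C3)}
    (h : MemBesov φ s p u) {t : ℝ} (ht : 0 < t) (x : E3) :
    ‖heatEvolution u t x‖ₑ ≤ ∑' j : ℤ, ‖lpBlock φ j u (heatTest t ht x)‖ₑ := by
  rw [heatEvolution, dif_pos ht]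
  refine (enorm_C3_re_le _).trans ?_
  refine le_of_tendsto (h.tendsto_sum (heatTest t ht x)).enorm (Eventually.of_forall fun n => ?_)
  exact (enorm_sum_le _ _).trans (ENNReal.sum_le_tsum _)

/-- A pointwise limit of partial sums over blocks, each of which is a parametric integral against a
measurable function and hence jointly measurable in (t,x). -/
theorem measurable_heatEvolution {φ : E3 → ℝ} {s : ℝ} {p : ℝ≥0∞} {u : 𝓢'(E3, C3)}
    (h : MemBesov φ s p u) {g : ℤ → E3 → C3} (hg : ∀ j, Measurable (g j))
    (hrep : ∀ (j : ℤ) (ψ : 𝓢(E3, ℂ)), lpBlock φ j u ψ = ∫ x, ψ x • g j x) :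
    Measurable (Function.uncurry (heatEvolution u)) := by
  have hk : Measurable (Function.uncurry heatKernel) := by
    unfold heatKernel Function.uncurry
    fun_prop
  have hm : ∀ j, Measurable fun z : ℝ × E3 => ∫ y, (heatKernel z.1 (z.2 - y) : ℂ) • g j y :=
    fun j => by
      have : Measurable fun w : (ℝ × E3) × E3 => (heatKernel w.1.1 (w.1.2 - w.2) : ℂ) • g j w.2 :=
        (Complex.measurable_ofReal.comp (hk.comp
          (f := fun w : (ℝ × E3) × E3 => (w.1.1, w.1.2 - w.2)) (by fun_prop))).smul
          ((hg j).comp measurable_snd)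
      exact (this.stronglyMeasurable.integral_prod_right' (ν := volume)).measurable
  have hS : MeasurableSet {z : ℝ × E3 | 0 < z.1} := measurableSet_lt (by fun_prop) (by fun_prop)
  have hre : Continuous fun v : C3 => (WithLp.toLp 2 fun i => (v i).re : E3) := by fun_prop
  refine measurable_of_tendsto_metrizable (f := fun (n : ℕ) (z : ℝ × E3) =>
    {z : ℝ × E3 | 0 < z.1}.indicator (fun z => (WithLp.toLp 2 fun i =>
      ((∑ j ∈ Finset.Icc (-(n : ℤ)) n, ∫ y, (heatKernel z.1 (z.2 - y) : ℂ) • g j y) i).re : E3)) z)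
    (fun n => ?_) ?_
  · exact (hre.measurable.comp (Finset.measurable_fun_sum _ fun j _ => hm j)).indicator hS
  · refine tendsto_pi_nhds.2 fun z => ?_
    by_cases hz : 0 < z.1
    · have h1 := (hre.tendsto _).comp (h.tendsto_sum (heatTest z.1 hz z.2))
      have h2 : Function.uncurry (heatEvolution u) z =
          (WithLp.toLp 2 fun i => (u (heatTest z.1 hz z.2) i).re : E3) := by
        simp only [Function.uncurry, heatEvolution, dif_pos hz]
      rw [h2]
      refine h1.congr fun n => ?_
      rw [indicator_of_mem (show z ∈ {z : ℝ × E3 | 0 < z.1} from hz)]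
      simp only [Function.comp, hrep, heatTest_apply]
    · have h2 : Function.uncurry (heatEvolution u) z = 0 := by
        simp only [Function.uncurry, heatEvolution, dif_neg hz]
      rw [h2]
      refine tendsto_const_nhds.congr fun n => ?_
      rw [indicator_of_notMem (show z ∉ {z : ℝ × E3 | 0 < z.1} from hz)]

/-- Minkowski's inequality with respect to the counting measure on ℤ. -/
theorem lnorm_tsum_le {r : ℝ} (hr : 1 ≤ r) {f : ℤ → E3 → ℝ≥0∞} (hf : ∀ j, Measurable (f j))
    {a : ℤ → ℝ≥0∞} (ha0 : ∀ j, a j ≠ 0) (ha1 : ∀ j, a j ≠ ⊤) (h : ∀ j, lnorm r (f j) ≤ a j) :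
    lnorm r (fun x => ∑' j, f j x) ≤ ∑' j, a j := by
  have hr0 : 0 < r := by linarith
  have hm : Measurable (Function.uncurry f) := measurable_from_prod_countable_right hf
  have key := lintegral_lintegral_rpow_le (μ := (Measure.count : Measure ℤ))
    (ν := (volume : Measure E3)) hm (measurable_of_countable a) hr (ae_of_all _ ha0)
    (ae_of_all _ ha1) (ae_of_all _ fun j => by
      rw [← lnorm_rpow hr0]
      exact ENNReal.rpow_le_rpow (h j) hr0.le)
  simp only [lintegral_count] at key
  rw [lnorm, one_div, ENNReal.rpow_inv_le_iff hr0]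
  exact key

/-- The heat evolution maps the critical Besov space to `𝒦_r`. -/
theorem exists_KBound_heatEvolution {φ : E3 → ℝ} (hφ : IsLittlewoodPaley φ) {p r : ℝ} (hp : 3 < p)
    (hpr : p ≤ r) (M : ℝ≥0) : ∃ C : ℝ≥0, ∀ u : 𝓢'(E3, C3),
      MemBesov φ (-1 + 3 / p) (ENNReal.ofReal p) u →
      besovNorm φ (-1 + 3 / p) (ENNReal.ofReal p) u ≤ M →
      Measurable (Function.uncurry (heatEvolution u)) ∧ ∀ T, KBound (1 / r) C T (heatEvolution u) := by
  have hp0 : 0 < p := by linarith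
  have hr0 : 0 < r := by linarith
  obtain ⟨B, hB0, hB⟩ := exists_block_kernel hφ
  -- Blocks of a critical distribution are of size 2^{j(1 - 3/p)} in L^p; the assumption p > 3 makes
  -- the sum over low frequencies converge.
  have hγ0 : 0 < 1 - 3 / p := by
    rw [sub_pos, div_lt_one hp0]; exact hp
  obtain ⟨C, hC⟩ := exists_tsum_dyadic_le hγ0 (by linarith [div_pos (by norm_num : (0:ℝ) < 3) hp0])
  refine ⟨B * (M + 1) * C, fun u hu huM => ?_⟩
  choose g hgm hrep hgn using exists_block_representative hp0 huM
  refine ⟨measurable_heatEvolution hu hgm hrep, fun T => ?_⟩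
  filter_upwards [ae_restrict_mem measurableSet_Ioo] with t htT
  have ht := htT.1
  choose K hKm hK1 hK2 hK3 using fun j => hB j t ht
  set δ : ℝ := 1 / p - 1 / r with hδ
  have hδ0 : 0 ≤ δ := sub_nonneg.2 (one_div_le_one_div_of_le hp0 hpr)
  have hδ1 : δ ≤ 1 := by
    have : 1 / p ≤ 1 := by rw [div_le_one hp0]; linarith
    have : 0 < 1 / r := by positivity
    linarith
  set m : ℤ → ℝ := fun j => min 1 (((4 : ℝ) ^ j * t)⁻¹) with hm
  have hm0 : ∀ j, 0 < m j := fun j => lt_min one_pos (by positivity)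
  set a : ℤ → ℝ≥0∞ := fun j => (B * (M + 1) : ℝ≥0) * ENNReal.ofReal (t ^ (-(3 / 2) * δ)) *
    (ENNReal.ofReal (m j) * ENNReal.ofReal ((2 : ℝ) ^ (j * (1 - 3 / p)))) with ha
  have hnorm : ∀ j, lnorm r (lconv (K j) fun y => ‖g j y‖ₑ) ≤ a j := fun j => by
    refine (lnorm_lconv_le (hKm j) (hgm j).enorm (hK1 j) (hK2 j) (by linarith) hpr).trans ?_
    have h1 : (B * ENNReal.ofReal (m j) : ℝ≥0∞) ^ (1 - δ) *
        (B * ENNReal.ofReal (m j) * ENNReal.ofReal (t ^ (-(3 / 2) : ℝ))) ^ δ =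
        B * ENNReal.ofReal (m j) * ENNReal.ofReal (t ^ (-(3 / 2) * δ)) := by
      rw [ENNReal.mul_rpow_of_nonneg _ _ hδ0, ← mul_assoc,
        ← ENNReal.rpow_add_of_nonneg _ _ (by linarith) hδ0, sub_add_cancel, ENNReal.rpow_one,
        ENNReal.ofReal_rpow_of_pos (by positivity), Real.rpow_mul ht.le]
    rw [h1]
    refine (mul_le_mul' le_rfl (hgn j)).trans (le_of_eq ?_)
    simp only [ha]
    rw [show -(-1 + 3 / p) = 1 - 3 / p by ring]
    push_cast
    ring
  rw [one_div_one_div]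
  calc _ ≤ lnorm r (fun x => ∑' j, lconv (K j) (fun y => ‖g j y‖ₑ) x) := by
        refine lnorm_mono hr0 (ae_of_all _ fun x => ?_)
        exact (enorm_heatEvolution_le hu ht x).trans
          (ENNReal.tsum_le_tsum fun j => hK3 j u (g j) (hrep j) x)
    _ ≤ ∑' j, a j := by
        refine lnorm_tsum_le (by linarith) (fun j => measurable_lconv (hKm j) (hgm j).enorm)
          (fun j => ?_) (fun j => ?_) hnorm
        · have h1 : 0 < ENNReal.ofReal (m j) := ENNReal.ofReal_pos.2 (hm0 j)
          have h2 : 0 < ENNReal.ofReal (t ^ (-(3 / 2) * δ)) := ENNReal.ofReal_pos.2 (by positivity)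
          have h3 : 0 < ENNReal.ofReal ((2 : ℝ) ^ (j * (1 - 3 / p))) :=
            ENNReal.ofReal_pos.2 (by positivity)
          have h4 : (0 : ℝ≥0∞) < (B * (M + 1) : ℝ≥0) := ENNReal.coe_pos.2 (by positivity)
          exact mul_ne_zero (mul_ne_zero h4.ne' h2.ne') (mul_ne_zero h1.ne' h3.ne')
        · exact (ENNReal.mul_lt_top (ENNReal.mul_lt_top ENNReal.coe_lt_top ENNReal.ofReal_lt_top)
            (ENNReal.mul_lt_top ENNReal.ofReal_lt_top ENNReal.ofReal_lt_top)).ne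
    _ ≤ (B * (M + 1) : ℝ≥0) * ENNReal.ofReal (t ^ (-(3 / 2) * δ)) *
        (C * ENNReal.ofReal (t ^ (-((1 - 3 / p) / 2)))) := by
        simp only [ha]
        rw [ENNReal.tsum_mul_left]
        gcongr
        exact hC t ht
    _ = ((B * (M + 1) * C : ℝ≥0) : ℝ≥0∞) * (ENNReal.ofReal (t ^ (-(3 / 2) * δ)) *
        ENNReal.ofReal (t ^ (-((1 - 3 / p) / 2)))) := by
        push_cast
        ring
    _ = _ := by
        -- The exponents combine to (3/2)(1/p - 1/r) + (1 - 3/p)/2 = 1/2 - 3/(2r), the decay rate of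
        -- 𝒦_r.
        rw [← ENNReal.ofReal_mul (by positivity), ← Real.rpow_add ht]
        congr 3
        rw [hδ]
        field_simp
        ring

end BesovNS

/-! ### The two parts of the theorem. -/

theorem lemma1p4 (p : ℝ) (hp : 3 < p) (k : ℕ) (hk : ⌈p / 2⌉ - 2 ≤ (k : ℤ)) (M : ℝ≥0) :
    -- unforced Picard iterates of data in the critical Besov space
    (∀ φ : BesovNS.E3 → ℝ, BesovNS.IsLittlewoodPaley φ →
      ∃ C : ℝ≥0, ∀ u₀ : 𝓢'(BesovNS.E3, BesovNS.C3),
        BesovNS.IsRealDistribution u₀ → BesovNS.IsDivergenceFree u₀ →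
        BesovNS.MemBesov φ (-1 + 3 / p) (ENNReal.ofReal p) u₀ →
        BesovNS.besovNorm φ (-1 + 3 / p) (ENNReal.ofReal p) u₀ ≤ M →
        ∀ T : ℝ, 0 < T →
          BesovNS.FiniteEnergyForcing (BesovNS.heatEvolution u₀) k T C) ∧
    -- the version with a forcing term and data in `BMO⁻¹`
    (∃ C : ℝ≥0, ∀ T : ℝ, 0 < T → ∀ u₀ : 𝓢'(BesovNS.E3, BesovNS.C3),
        BesovNS.IsRealDistribution u₀ → BesovNS.IsDivergenceFree u₀ → BesovNS.MemBMOInv u₀ →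
        ∀ F : ℝ → BesovNS.E3 → BesovNS.M33, BesovNS.MemForcing (ENNReal.ofReal T) F →
        BesovNS.MemKato (BesovNS.sK p) (ENNReal.ofReal p) (ENNReal.ofReal T)
          (BesovNS.picardZero u₀ F) →
        BesovNS.MemX (ENNReal.ofReal T) (BesovNS.picardZero u₀ F) →
        BesovNS.katoNorm (BesovNS.sK p) (ENNReal.ofReal p) (ENNReal.ofReal T)
            (BesovNS.picardZero u₀ F)
          + BesovNS.xNorm (ENNReal.ofReal T) (BesovNS.picardZero u₀ F) ≤ M →
          BesovNS.FiniteEnergyForcing (BesovNS.picardZero u₀ F) k T C) := by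
  refine ⟨fun φ hφ => ?_, ?_⟩
  -- The target exponent is max(p,4), admissible both for the heat estimate, which only asks r ≥ p,
  -- and for the iteration, which asks r ≥ 4.
  · obtain ⟨C₁, hC₁⟩ := BesovNS.exists_KBound_heatEvolution hφ hp (le_max_left p 4) M
    obtain ⟨C, hC⟩ := BesovNS.exists_finiteEnergyForcing_of_KBound (le_max_right p 4) C₁
      (BesovNS.le_two_div_max hk)
    refine ⟨C, fun u₀ _ _ hu huM T hT => ?_⟩
    obtain ⟨hm, hK⟩ := hC₁ u₀ hu huM
    exact hC T _ _ hT (Filter.EventuallyEq.refl _ _) hm (hK T)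
  · obtain ⟨C, hC⟩ := BesovNS.exists_finiteEnergyForcing_of_katoNorm hp hk M
    exact ⟨C, fun T hT u₀ _ _ _ F _ hP _ hM => hC T _ hT hP.1 hM⟩
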